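/- Theorem (Intrinsic offline RL bound). Let $M=(\mathcal S,\mathcal A,P,r,H,d_1)$ be a finite-horizon time-inhomogeneous MDP with finite nonempty state and action sets, $S=|\mathcal S|$, $A=|\mathcal A|$, horizon $H\ge 1$, initial distribution $d_1$ and transition kernels $P_h(\cdot\mid s,a)$, $h=1,\dots,H$. Given $(s_h,a_h)=(s,a)$, the realized reward at step $h$ is a $[0,1]$-valued random variable with a law depending on $(h,s,a)$ and mean $r_h(s,a)$, independent of $s_{h+1}\sim P_h(\cdot\mid s,a)$. For a (randomized, Markov, time-dependent) policy $\pi$ let $V^\pi_h$ be its value functions, $v^\pi=\mathbb E_{s\sim d_1}[V_1^\pi(s)]$, and $d^\pi_h(s,a)=\mathbb P_\pi[s_h=s,a_h=a]$; let $V^\star_h$ be the optimal value functions (solution of the Bellman optimality equations, $V^\star_{H+1}=0$) and $v^\star=\mathbb E_{s\sim d_1}[V_1^\star(s)]$. $\mathrm{Var}_{P_{s,a}}(r_h+V)$ denotes the variance of (realized reward at step $h$) $+\,V(s_{h+1})$ given $(s_h,a_h)=(s,a)$. The data $\mathcal D=\{(s_h^\tau,a_h^\tau,r_h^\tau,s_{h+1}^\tau)\}_{\tau\le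 n,\,h\le H}$ are $n$ independent episodes of $M$ rolled out with a behavior policy $\mu$. Put $\mathcal C_h=\{(s,a):d^\mu_h(s,a)>0\}$, $\bar d_m=\min\{d^\mu_h(s,a): h\in[H],\ (s,a)\in\mathcal C_h\}$ and, for $0<\delta<1$, $\iota=\log(HSA/\delta)$. APVI (LCBVI-Bernstein): let $n_{h}(s,a)=\#\{\tau:(s_h^\tau,a_h^\tau)=(s,a)\}$. If $n_h(s,a)\ge1$, let $\widehat P_h(\cdot\mid s,a)$ and $\widehat r_h(s,a)$ be the empirical next-state distribution and the empirical mean reward over the visits to $(s,a)$ at step $h$; otherwise $\widehat P_h(\cdot\mid s,a)$ is uniform and $\widehat r_h(s,a)=0$. Start from $\widehat V_{H+1}=0$ and for $h=H,\dots,1$ put $\widehat Q_h=\widehat r_h+\widehat P_h\widehat V_{h+1}$; $$\Gamma_h(s,a)=2\sqrt{\frac{\mathrm{Var}_{\widehat P_{s,a}}(\widehat r_h+\widehat V_{h+1})\,\iota}{n_h(s,a)}}+\frac{14H\iota}{n_h(s,a)}\ \text{ if } n_h(s,a)\ge1,\qquad \Gamma_h(s,a)=C H\iota\ \text{ if } n_h(s,a)=0,$$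 where $C\ge2$ is any constant and $\mathrm{Var}_{\widehat P_{s,a}}(\widehat r_h+\widehat V_{h+1})$ is the variance of $\rho+\widehat V_{h+1}(s')$ for independent $\rho$, drawn from the empirical distribution of the observed rewards at $(h,s,a)$, and $s'\sim\widehat P_h(\cdot\mid s,a)$; $\overline Q_h=\max\{\min\{\widehat Q_h-\Gamma_h,\,H-h+1\},0\}$; $\widehat\pi_h(\cdot\mid s)\in\arg\max_{p}\langle\overline Q_h(s,\cdot),p\rangle$ over probability distributions $p$ on $\mathcal A$, with ties broken arbitrarily; $\widehat V_h(s)=\langle\overline Q_h(s,\cdot),\widehat\pi_h(\cdot\mid s)\rangle$. The output is $\widehat\pi=(\widehat\pi_h)_{h\le H}$. Then there are absolute constants $c_0,C',C''>0$ and $k\in\mathbb N$ such that the following holds for all $M$, $\mu$, $n$, $0<\delta<1$, $C\ge 2$. Let $\pi^\star$ be an optimal policy (a maximizer of $v^\pi$) such that $d^\mu_h(s,a)>0$ whenever $d^{\pi^\star}_h(s,a)>0$. If $n>c_0\,\iota/\bar d_m$, then with probability at least $1-\delta$ every output $\widehat\pi$ of APVI satisfies $$0\le v^\star-v^{\widehat\pi}\le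 C'\sum_{h=1}^H\sum_{(s,a)\in\mathcal C_h}d^{\pi^\star}_h(s,a)\sqrt{\frac{\mathrm{Var}_{P_{s,a}}(r_h+V^\star_{h+1})\,\iota}{n\,d^\mu_h(s,a)}}+C''\,\frac{H^3\,\log^k(nHSA/\delta)}{n\,\bar d_m}.$$ -/

import Mathlib

open MeasureTheory
open scoped BigOperators

noncomputable section

namespace OfflineRL

/-- A finite-horizon, time-inhomogeneous tabular MDP with horizon `H`. Time steps are `0, …, H - 1`
(so the step `h : Fin H` is the step `h + 1` of the one-based convention). Given the state and the
action at step `h`, the realized reward has law `rewardLaw h s a`, which is carried by `[0, 1]`,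
and is independent of the next state, whose law is `trans h s a`. -/
structure MDP (S A : Type*) [Fintype S] [Fintype A] (H : ℕ) where
  init : stdSimplex ℝ S
  trans : Fin H → S → A → stdSimplex ℝ S
  rewardLaw : Fin H → S → A → Measure ℝ
  rewardLaw_prob : ∀ h s a, IsProbabilityMeasure (rewardLaw h s a)
  rewardLaw_bdd : ∀ h s a, ∀ᵐ x ∂(rewardLaw h s a), x ∈ Set.Icc (0 : ℝ) 1

/-- A (randomized, Markov, time-dependent) policy. -/
abbrev Policy (S A : Type*) [Fintype A] (H : ℕ) : Type _ := Fin H → S → stdSimplex ℝ A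

section Model

variable {S A : Type*} [Fintype S] [Fintype A] {H : ℕ}

/-- Expected reward `r_h(s, a)`. -/
def MDP.reward (M : MDP S A H) (h : Fin H) (s : S) (a : A) : ℝ := ∫ x, x ∂(M.rewardLaw h s a)

/-- The Bellman backup `r_h(s, a) + ∑_{s'} P_h(s' | s, a) V(s')`. -/
def MDP.backup (M : MDP S A H) (h : Fin H) (V : S → ℝ) (s : S) (a : A) : ℝ :=
  M.reward h s a + ∑ s', M.trans h s a s' * V s'

/-- `V^π_h`, with `V^π_H = 0` at the (zero-based) time `H`. -/
def MDP.value (M : MDP S A H) (π : Policy S A H) (h : ℕ) : S → ℝ :=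
  if hh : h < H then
    fun s => ∑ a, π ⟨h, hh⟩ s a * M.backup ⟨h, hh⟩ (M.value π (h + 1)) s a
  else 0
termination_by H - h

/-- The optimal value function `V^⋆_h`, from the Bellman optimality equation. -/
def MDP.optValue [Nonempty A] (M : MDP S A H) (h : ℕ) : S → ℝ :=
  if hh : h < H then
    fun s => Finset.univ.sup' Finset.univ_nonempty
      (fun a => M.backup ⟨h, hh⟩ (M.optValue (h + 1)) s a)
  else 0
termination_by H - h

/-- The performance `v^π = E_{s ∼ d_1} V^π_1(s)`. -/
def MDP.perf (M : MDP S A H) (π : Policy S A H) : ℝ := ∑ s, M.init s * M.value π 0 s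

/-- The optimal performance `v^⋆ = E_{s ∼ d_1} V^⋆_1(s)`. -/
def MDP.optPerf [Nonempty A] (M : MDP S A H) : ℝ := ∑ s, M.init s * M.optValue 0 s

/-- `π` is an optimal policy: it maximizes the performance over all policies. -/
def MDP.IsOptimal (M : MDP S A H) (π : Policy S A H) : Prop := ∀ π', M.perf π' ≤ M.perf π

/-- The probability that the state at time `h` is `s`, under the policy `π`. -/
def MDP.stateOcc (M : MDP S A H) (π : Policy S A H) : ℕ → S → ℝ
  | 0 => fun s => M.init s
  | h + 1 => fun s' =>
      if hh : h < H then
        ∑ s, ∑ a, M.stateOcc π h s * π ⟨h, hh⟩ s a * M.trans ⟨h, hh⟩ s a s'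
      else 0

/-- The marginal state-action occupancy `d^π_h(s, a)`. -/
def MDP.occ (M : MDP S A H) (π : Policy S A H) (h : Fin H) (s : S) (a : A) : ℝ :=
  M.stateOcc π h s * π h s a

/-- `d̄_m`, the smallest positive value of `d^μ_h(s, a)` over all `h, s, a`
(for `H ≥ 1` the infimum is over a finite nonempty set). -/
def MDP.minOcc (M : MDP S A H) (μ : Policy S A H) : ℝ :=
  sInf {x : ℝ | 0 < x ∧ ∃ h s a, x = M.occ μ h s a}

/-- `Var_{P_{s,a}}(r_h + V)`: the variance of `r + V(s')` when the realized reward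
`r ∼ rewardLaw h s a` and the next state `s' ∼ trans h s a` are independent. -/
def MDP.bellmanVar (M : MDP S A H) (h : Fin H) (V : S → ℝ) (s : S) (a : A) : ℝ :=
  ∫ x, ∑ s', M.trans h s a s' * (x + V s' - M.backup h V s a) ^ 2 ∂(M.rewardLaw h s a)

/-- An episode: the states `s_1, …, s_{H+1}`, the actions and the realized rewards. -/
abbrev Episode (S A : Type*) (H : ℕ) : Type _ :=
  (Fin (H + 1) → S) × (Fin H → A) × (Fin H → ℝ)

/-- Probability of a given sequence of states and actions under the policy `π`. -/
def MDP.pathProb (M : MDP S A H) (π : Policy S A H) (s : Fin (H + 1) → S) (a : Fin H → A) : ℝ :=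
  M.init (s 0) * ∏ h : Fin H,
    (π h (s h.castSucc) (a h) * M.trans h (s h.castSucc) (a h) (s h.succ))

/-- The law of an episode rolled out with the policy `π`: the sequence of states and actions is
drawn with the probabilities `pathProb`, and given that sequence the rewards are independent with
laws `rewardLaw h (s h) (a h)`. -/
def MDP.episodeLaw [MeasurableSpace S] [MeasurableSpace A] (M : MDP S A H)
    (π : Policy S A H) : Measure (Episode S A H) :=
  ∑ s : Fin (H + 1) → S, ∑ a : Fin H → A,
    ENNReal.ofReal (M.pathProb π s a) •
      ((Measure.dirac s).prod ((Measure.dirac a).prod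
        (Measure.pi fun h : Fin H => M.rewardLaw h (s h.castSucc) (a h))))

/-- The law of a dataset of `n` independent episodes rolled out with the policy `μ`. -/
def MDP.dataLaw [MeasurableSpace S] [MeasurableSpace A] (M : MDP S A H)
    (μ : Policy S A H) (n : ℕ) : Measure (Fin n → Episode S A H) :=
  Measure.pi fun _ => M.episodeLaw μ

end Model

section Algorithm

variable {S A : Type*} [Fintype S] [Fintype A] [DecidableEq S] [DecidableEq A] {H n : ℕ}

/-- The episodes of the dataset that visit `(s, a)` at time `h`. -/
def visits (D : Fin n → Episode S A H) (h : Fin H) (s : S) (a : A) : Finset (Fin n) :=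
  Finset.univ.filter fun τ => (D τ).1 h.castSucc = s ∧ (D τ).2.1 h = a

/-- The count `n_{s,a}` at time `h`. -/
def count (D : Fin n → Episode S A H) (h : Fin H) (s : S) (a : A) : ℕ := (visits D h s a).card

/-- The plug-in estimate `P̂_h(s' | s, a)`, uniform if `(s, a)` was not visited. -/
def empTrans (D : Fin n → Episode S A H) (h : Fin H) (s : S) (a : A) (s' : S) : ℝ :=
  if count D h s a = 0 then 1 / (Fintype.card S : ℝ)
  else (((visits D h s a).filter fun τ => (D τ).1 h.succ = s').card : ℝ) / count D h s a

/-- The plug-in estimate `r̂_h(s, a)`, zero if `(s, a)` was not visited. -/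
def empReward (D : Fin n → Episode S A H) (h : Fin H) (s : S) (a : A) : ℝ :=
  if count D h s a = 0 then 0
  else (∑ τ ∈ visits D h s a, (D τ).2.2 h) / count D h s a

/-- `Q̂ = r̂_h + P̂_h V`. -/
def empBackup (D : Fin n → Episode S A H) (h : Fin H) (V : S → ℝ) (s : S) (a : A) : ℝ :=
  empReward D h s a + ∑ s', empTrans D h s a s' * V s'

/-- `Var_{P̂_{s,a}}(r̂_h + V)`: the variance of `r + V(s')` in the empirical model, where `r` is drawn
from the empirical law of the rewards observed at `(s, a)` and, independently, `s'` from `P̂_h`.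
Only used when `(s, a)` was visited. -/
def empVar (D : Fin n → Episode S A H) (h : Fin H) (V : S → ℝ) (s : S) (a : A) : ℝ :=
  (∑ τ ∈ visits D h s a,
    ∑ s', empTrans D h s a s' * ((D τ).2.2 h + V s' - empBackup D h V s a) ^ 2) / count D h s a

/-- The Bernstein penalty `Γ_h(s, a)` with `C₁ = 2`, `C₂ = 14`; `C` is the constant of the penalty
`C H ι` at unvisited pairs. -/
def bonus (C ι : ℝ) (D : Fin n → Episode S A H) (h : Fin H) (V : S → ℝ) (s : S) (a : A) : ℝ :=
  if count D h s a = 0 then C * H * ι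
  else 2 * Real.sqrt (empVar D h V s a * ι / count D h s a) + 14 * H * ι / count D h s a

/-- The pessimistic `Q̄_h = max {min {Q̂ - Γ, number of remaining steps}, 0}` computed from the value
estimate `V` for the next time step. -/
def pessQ (C ι : ℝ) (D : Fin n → Episode S A H) (h : Fin H) (V : S → ℝ) (s : S) (a : A) : ℝ :=
  max (min (empBackup D h V s a - bonus C ι D h V s a) ((H : ℝ) - (h : ℕ))) 0

/-- The value estimates `V̂_h(s) = ⟨Q̄_h(s, ·), π̂_h(· | s)⟩`, computed backwards from
`V̂_H = 0` at the (zero-based) time `H`. -/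
def pessV (C ι : ℝ) (D : Fin n → Episode S A H) (π : Policy S A H) (h : ℕ) : S → ℝ :=
  if hh : h < H then
    fun s => ∑ a, π ⟨h, hh⟩ s a * pessQ C ι D ⟨h, hh⟩ (pessV C ι D π (h + 1)) s a
  else 0
termination_by H - h

/-- `ι = log (H S A / δ)`. -/
def logTerm (S A : Type*) [Fintype S] [Fintype A] (H : ℕ) (δ : ℝ) : ℝ :=
  Real.log ((H : ℝ) * Fintype.card S * Fintype.card A / δ)

/-- `π` is an output of adaptive pessimistic value iteration (LCBVI-Bernstein) on the dataset `D`: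
at each step and state, `π_h(· | s)` maximizes `⟨Q̄_h(s, ·), p⟩` over all distributions `p` on
actions (ties are broken in any way). -/
def IsAPVIOutput (C δ : ℝ) (D : Fin n → Episode S A H) (π : Policy S A H) : Prop :=
  ∀ (h : Fin H) (s : S) (p : stdSimplex ℝ A),
    ∑ a, p a * pessQ C (logTerm S A H δ) D h
        (pessV C (logTerm S A H δ) D π ((h : ℕ) + 1)) s a ≤
      ∑ a, π h s a * pessQ C (logTerm S A H δ) D h
        (pessV C (logTerm S A H δ) D π ((h : ℕ) + 1)) s a

end Algorithm

/-- The leading term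
`∑_h ∑_{(s,a) : d^μ_h(s,a) > 0} d^{π⋆}_h(s,a) √(Var_{P_{s,a}}(r_h + V^⋆_{h+1}) ι / (n d^μ_h(s,a)))`
of the bound. -/
def MDP.intrinsicBound {S A : Type*} [Fintype S] [Fintype A] [Nonempty A] {H : ℕ}
    (M : MDP S A H) (μ πstar : Policy S A H) (n : ℕ) (ι : ℝ) : ℝ :=
  open scoped Classical in
  ∑ h : Fin H, ∑ x ∈ Finset.univ.filter (fun x : S × A => 0 < M.occ μ h x.1 x.2),
    M.occ πstar h x.1 x.2 *
      Real.sqrt (M.bellmanVar h (M.optValue ((h : ℕ) + 1)) x.1 x.2 * ι /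
        (n * M.occ μ h x.1 x.2))

end OfflineRL

end

open MeasureTheory
open scoped BigOperators

noncomputable section

set_option linter.unusedSectionVars false

/-! Regret splits into two one-sided comparisons with the pessimistic values V̂ (`pessValue`). If V̂
never exceeds the Bellman backup of its successor by more than a second order amount, then V̂ is at
most the value of the output policy plus H times that amount. The performance difference identity
along the optimal policy then charges, at each visited pair, only the loss from the backup of V̂ to
`pessQ`. That loss is the Bernstein width, which gives the intrinsic term.

Both comparisons need the empirical backup of V̂ at step h to be close to its true backup. The
difficulty is that V̂ at h + 1 is computed from the same episodes as the step-h transitions, and a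
union bound over value functions would cost a factor S. V̂ is therefore split as V + w, where V
(`coveredValue`) is a deterministic function: the optimal value of the model in which pairs outside
the support of the behavior policy are worth zero. Bernstein's inequality applies to V with sharp
constants. Along the optimal policy V agrees with the optimal value function, so the variance is the
one in the theorem.

The gap w is first order small, |w| ≤ 12 H² u with u² = L / (n d̄_m) (`abs_pessValue_sub`), but it
depends on the data. It depends only on the data from time h + 1 on, so the chain is reversed in
time: given all that later data, the visits to (s, a) at step h are independent Bernoulli variables
whose parameter `backProb` depends on the next state (`lintegral_visit_future`,
`visit_future_concentration`). What remains is a sum over next states weighted by their counts.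
These have relative error 2u, and the centered gap integrates to zero under the true transition law.
The sampling error of w is thus of order |w| u, that is H² u² per step without a factor S
(`abs_gap_mean_le`), and H³ u² in total.

The empirical standard deviation is within 23 H² u of the true one (`abs_sqrt_empVar_sub`), and it
is multiplied by a width of order u, so this replacement is second order as well. The factor 2 in
the bonus matches Bernstein at level 2ι exactly, so the leading constants of the upper deviation are
kept sharp throughout. Small samples and a single action are trivial and treated apart. -/

namespace OfflineRL

/-! ### Path sums of controlled Markov chains -/

section Chain

variable {R : Type*} [CommSemiring R] {S A : Type*}

/-- The weight of a path of a controlled Markov chain with initial weights `p` and kernels `K`. -/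
def chainWeight {H : ℕ} (p : S → R) (K : Fin H → S → A → S → R) (s : Fin (H + 1) → S)
    (a : Fin H → A) : R :=
  p (s 0) * ∏ h : Fin H, K h (s h.castSucc) (a h) (s h.succ)

theorem sum_fin_succ_fun {X : Type*} [Fintype X] {n : ℕ} (f : (Fin (n + 1) → X) → R) :
    ∑ s, f s = ∑ x : X, ∑ s : Fin n → X, f (Fin.cons x s) := by
  rw [← Fintype.sum_prod_type' (f := fun x s => f (Fin.cons x s))]
  exact (Fintype.sum_equiv (Fin.consEquiv fun _ : Fin (n + 1) => X) _ _ fun _ => rfl).symm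

theorem chainWeight_cons {H : ℕ} (p : S → R) (K : Fin (H + 1) → S → A → S → R) (x : S)
    (s : Fin (H + 1) → S) (y : A) (a : Fin H → A) :
    chainWeight p K (Fin.cons x s) (Fin.cons y a) =
      p x * K 0 x y (s 0) *
        ∏ h : Fin H, K h.succ (s h.castSucc) (a h) (s h.succ) := by
  unfold chainWeight
  rw [Fin.prod_univ_succ, ← mul_assoc]
  congr 1

variable [Fintype S] [Fintype A]

/-- Summing out the first state and action replaces `p` by the weights one step later, so the
induction on the horizon lets `p` vary. The weights lie in a semiring because the sums are later
taken in `ENNReal`, where no integrability has to be discussed. -/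
theorem chainWeight_total {H : ℕ} (p : S → R) (K : Fin H → S → A → S → R)
    (hK : ∀ h x, ∑ y, ∑ z, K h x y z = 1) :
    ∑ s, ∑ a, chainWeight p K s a = ∑ x, p x := by
  induction H generalizing p with
  | zero =>
    simp only [chainWeight, Finset.univ_eq_empty, Finset.prod_empty, mul_one, Finset.sum_const,
      Finset.card_univ, Fintype.card_unique, one_smul]
    exact Fintype.sum_equiv (Equiv.funUnique (Fin 1) S) _ _ fun _ => rfl
  | succ H ih =>
    have key := ih (fun z => ∑ x, ∑ y, p x * K 0 x y z) (fun h => K h.succ) (fun h x => hK _ _)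
    have : ∑ z, ∑ x, ∑ y, p x * K 0 x y z = ∑ x, p x := by
      rw [Finset.sum_comm]
      refine Finset.sum_congr rfl fun x _ => ?_
      rw [Finset.sum_comm]
      simp only [← Finset.mul_sum]
      rw [hK, mul_one]
    rw [← this, ← key, sum_fin_succ_fun, Finset.sum_comm]
    refine Finset.sum_congr rfl fun s _ => ?_
    simp only [sum_fin_succ_fun (X := A), chainWeight_cons]
    unfold chainWeight
    simp only [Finset.sum_mul]
    rw [Finset.sum_comm' (t' := Finset.univ) (s' := fun _ => Finset.univ) (by simp)]
    conv_lhs => enter [2, y]; rw [Finset.sum_comm]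
    rw [Finset.sum_comm]
    refine Finset.sum_congr rfl fun a _ => ?_
    rw [Finset.sum_comm]

/-- Factorization of a path sum at step `h`: given the state at time `h + 1`, a function of the
states from time `h + 1` on and of the later actions is independent of step `h`. -/
theorem chainWeight_factor [Nonempty S] [Nonempty A] {H : ℕ} (p : S → R)
    (K : Fin H → S → A → S → R) (o : Fin (H + 1) → S → R) (ho : o 0 = p)
    (hos : ∀ (h : Fin H) z, o h.succ z = ∑ x, ∑ y, o h.castSucc x * K h x y z)
    (hK : ∀ h x, ∑ y, ∑ z, K h x y z = 1) (h : Fin H)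
    (G : (Fin (H + 1) → S) → (Fin H → A) → R)
    (hG : ∀ s s' a a', (∀ t, h.castSucc < t → s t = s' t) → (∀ t, h < t → a t = a' t) →
      G s a = G s' a') :
    ∃ Ψ : S → R, (∀ φ : S → A → S → R,
      ∑ s, ∑ a, chainWeight p K s a * (φ (s h.castSucc) (a h) (s h.succ) * G s a) =
        ∑ x, ∑ y, ∑ z, o h.castSucc x * K h x y z * (φ x y z * Ψ z)) ∧
      ((∀ s a, G s a = 1) → ∀ z, Ψ z = 1) := by
  classical
  induction H generalizing p with
  | zero => exact h.elim0
  | succ H ih =>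
    obtain ⟨x₀⟩ := ‹Nonempty S›
    obtain ⟨y₀⟩ := ‹Nonempty A›
    induction h using Fin.cases with
    | zero =>
      have hG' : ∀ x y s a, G (Fin.cons x s) (Fin.cons y a) =
          G (Fin.cons x₀ s) (Fin.cons y₀ a) := by
        intro x y s a
        apply hG
        · intro t ht
          induction t using Fin.cases with
          | zero => simp at ht
          | succ t => simp
        · intro t ht
          induction t using Fin.cases with
          | zero => simp at ht
          | succ t => simp
      -- `Ψ z` sums `G` over the paths of the remaining chain started at the point mass at `z`; the
      -- first state and action fed to `G` are arbitrary since `G` ignores them. As `Ψ` does not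
      -- involve `φ`, different functions of step `h` can be compared against the same future.
      refine ⟨fun z => ∑ s, ∑ a, chainWeight (fun x => if x = z then 1 else 0)
        (fun h => K h.succ) s a * G (Fin.cons x₀ s) (Fin.cons y₀ a), ?_, ?_⟩
      · intro φ
        rw [sum_fin_succ_fun]
        refine Finset.sum_congr rfl fun x _ => ?_
        simp only [sum_fin_succ_fun (X := A), chainWeight_cons, hG']
        rw [Finset.sum_comm]
        refine Finset.sum_congr rfl fun y _ => ?_
        symm
        simp only [Finset.mul_sum]
        rw [Finset.sum_comm]
        refine Finset.sum_congr rfl fun s _ => ?_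
        rw [Finset.sum_comm]
        refine Finset.sum_congr rfl fun a _ => ?_
        rw [Finset.sum_eq_single (s 0)]
        · simp [chainWeight, ho]
          ring
        · intro z _ hz
          simp [chainWeight, Ne.symm hz]
        · simp
      · intro h1 z
        simp only [h1, mul_one]
        rw [chainWeight_total _ _ (fun h x => hK _ _)]
        simp
    | succ j =>
      -- For a later step the first transition is summed out, and the shortened chain starts from
      -- the weights `o 1`.
      obtain ⟨Ψ, hΨ, hΨ1⟩ := ih (o 1) (fun h => K h.succ) (fun t => o t.succ) rfl
        (fun h z => hos h.succ z) (fun h x => hK _ _) j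
        (fun s a => G (Fin.cons x₀ s) (Fin.cons y₀ a))
        (by
          intro s s' a a' hs ha
          apply hG
          · intro t ht
            induction t using Fin.cases with
            | zero => simp at ht
            | succ t =>
              rw [Fin.cons_succ, Fin.cons_succ]
              refine hs t ?_
              rw [Fin.lt_def] at ht ⊢
              simp only [Fin.val_castSucc, Fin.val_succ] at ht ⊢
              omega
          · intro t ht
            induction t using Fin.cases with
            | zero => simp at ht
            | succ t =>
              rw [Fin.cons_succ, Fin.cons_succ]
              refine ha t ?_
              rw [Fin.lt_def] at ht ⊢
              simp only [Fin.val_succ] at ht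
              omega)
      have hG' : ∀ x y s a, G (Fin.cons x s) (Fin.cons y a) =
          G (Fin.cons x₀ s) (Fin.cons y₀ a) := by
        intro x y s a
        apply hG
        · intro t ht
          induction t using Fin.cases with
          | zero => simp at ht
          | succ t => simp
        · intro t ht
          induction t using Fin.cases with
          | zero => simp at ht
          | succ t => simp
      refine ⟨Ψ, fun φ => ?_, fun h1 => hΨ1 fun s a => h1 _ _⟩
      refine Eq.trans ?_ (hΨ φ)
      rw [sum_fin_succ_fun, Finset.sum_comm]
      refine Finset.sum_congr rfl fun s _ => ?_
      simp only [sum_fin_succ_fun (X := A), chainWeight_cons, hG']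
      have h1 : o 1 (s 0) = ∑ x, ∑ y, p x * K 0 x y (s 0) := by
        have := hos 0 (s 0)
        rw [← ho]; exact this
      unfold chainWeight
      simp only [h1, Finset.sum_mul]
      conv_lhs => enter [2, x]; rw [Finset.sum_comm]
      rw [Finset.sum_comm]
      refine Finset.sum_congr rfl fun a _ => ?_
      refine Finset.sum_congr rfl fun x _ => ?_
      refine Finset.sum_congr rfl fun y _ => ?_
      rfl

end Chain

/-! ### The law of an episode: Markov property and one-step marginals -/

section EpisodeLaw

variable {S A : Type*} [Fintype S] [Fintype A] {H : ℕ}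

theorem simplex_nonneg {X : Type*} [Fintype X] (p : stdSimplex ℝ X) (x : X) : 0 ≤ p x := p.2.1 x

theorem simplex_sum {X : Type*} [Fintype X] (p : stdSimplex ℝ X) : ∑ x, p x = 1 := p.2.2

theorem MDP.stateOcc_nonneg (M : MDP S A H) (π : Policy S A H) (h : ℕ) (s : S) :
    0 ≤ M.stateOcc π h s := by
  induction h generalizing s with
  | zero => exact simplex_nonneg M.init s
  | succ h ih =>
    simp only [MDP.stateOcc]
    split_ifs with hh
    · exact Finset.sum_nonneg fun x _ => Finset.sum_nonneg fun y _ =>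
        mul_nonneg (mul_nonneg (ih x) (simplex_nonneg (π _ x) y)) (simplex_nonneg (M.trans _ x y) s)
    · exact le_rfl

theorem MDP.occ_nonneg (M : MDP S A H) (π : Policy S A H) (h : Fin H) (s : S) (a : A) :
    0 ≤ M.occ π h s a :=
  mul_nonneg (M.stateOcc_nonneg π h s) (simplex_nonneg (π h s) a)

theorem MDP.stateOcc_succ (M : MDP S A H) (π : Policy S A H) (h : Fin H) (z : S) :
    M.stateOcc π (h + 1) z = ∑ x, ∑ y, M.occ π h x y * M.trans h x y z := by
  simp only [MDP.stateOcc, h.2, dif_pos, MDP.occ]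

theorem MDP.sum_occ (M : MDP S A H) (π : Policy S A H) (h : Fin H) (s : S) :
    ∑ a, M.occ π h s a = M.stateOcc π h s := by
  simp only [MDP.occ, ← Finset.mul_sum]
  rw [show ∑ a, π h s a = 1 from simplex_sum _, mul_one]

theorem MDP.occ_mul_trans_nonneg (M : MDP S A H) (π : Policy S A H) (h : Fin H) (s : S) (a : A)
    (z : S) : 0 ≤ M.occ π h s a * M.trans h s a z :=
  mul_nonneg (M.occ_nonneg π h s a) (simplex_nonneg _ _)

theorem MDP.occ_mul_trans_le (M : MDP S A H) (π : Policy S A H) (h : Fin H) (s : S) (a : A)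
    (z : S) : M.occ π h s a * M.trans h s a z ≤ M.stateOcc π (h + 1) z := by
  rw [M.stateOcc_succ]
  refine le_trans ?_ (Finset.single_le_sum (f := fun x => ∑ y, M.occ π h x y * M.trans h x y z)
    (fun x _ => Finset.sum_nonneg fun y _ => M.occ_mul_trans_nonneg π h x y z)
    (Finset.mem_univ s))
  exact Finset.single_le_sum (f := fun y => M.occ π h s y * M.trans h s y z)
    (fun y _ => M.occ_mul_trans_nonneg π h s y z) (Finset.mem_univ a)

/-- The conditional probability of having visited `(s, a)` at time `h` given the next state. -/
def MDP.backProb (M : MDP S A H) (π : Policy S A H) (h : Fin H) (s : S) (a : A) (z : S) : ℝ :=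
  M.occ π h s a * M.trans h s a z / M.stateOcc π (h + 1) z

theorem MDP.backProb_nonneg (M : MDP S A H) (π : Policy S A H) (h : Fin H) (s : S) (a : A)
    (z : S) : 0 ≤ M.backProb π h s a z :=
  div_nonneg (M.occ_mul_trans_nonneg π h s a z) (M.stateOcc_nonneg π _ z)

theorem MDP.backProb_le_one (M : MDP S A H) (π : Policy S A H) (h : Fin H) (s : S) (a : A)
    (z : S) : M.backProb π h s a z ≤ 1 :=
  div_le_one_of_le₀ (M.occ_mul_trans_le π h s a z) (M.stateOcc_nonneg π _ z)

/-- Bayes' rule. It survives at states of probability zero, where the quotient defaults to zero,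
because the joint probability is dominated by that of the next state. -/
theorem MDP.stateOcc_mul_backProb (M : MDP S A H) (π : Policy S A H) (h : Fin H) (s : S) (a : A)
    (z : S) :
    M.stateOcc π (h + 1) z * M.backProb π h s a z = M.occ π h s a * M.trans h s a z := by
  rcases eq_or_ne (M.stateOcc π (h + 1) z) 0 with h0 | h0
  · have := M.occ_mul_trans_le π h s a z
    rw [h0] at this
    rw [h0, zero_mul, le_antisymm this (M.occ_mul_trans_nonneg π h s a z)]
  · exact mul_div_cancel₀ _ h0

theorem MDP.ofReal_pathProb (M : MDP S A H) (π : Policy S A H) (s : Fin (H + 1) → S)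
    (a : Fin H → A) :
    ENNReal.ofReal (M.pathProb π s a) =
      chainWeight (fun x => ENNReal.ofReal (M.init x))
        (fun h x y z => ENNReal.ofReal (π h x y * M.trans h x y z)) s a := by
  unfold MDP.pathProb chainWeight
  rw [ENNReal.ofReal_mul (simplex_nonneg M.init _), ENNReal.ofReal_prod_of_nonneg]
  exact fun h _ => mul_nonneg (simplex_nonneg (π h _) _) (simplex_nonneg (M.trans h _ _) _)

variable [MeasurableSpace S] [MeasurableSpace A]

theorem MDP.lintegral_episodeLaw (M : MDP S A H) (π : Policy S A H)
    {f : Episode S A H → ENNReal} (hf : Measurable f) :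
    ∫⁻ ω, f ω ∂M.episodeLaw π = ∑ s, ∑ a, ENNReal.ofReal (M.pathProb π s a) *
      ∫⁻ r, f (s, a, r) ∂(Measure.pi fun h : Fin H => M.rewardLaw h (s h.castSucc) (a h)) := by
  have := M.rewardLaw_prob
  unfold MDP.episodeLaw
  rw [lintegral_finsetSum_measure]
  refine Finset.sum_congr rfl fun s _ => ?_
  rw [lintegral_finsetSum_measure]
  refine Finset.sum_congr rfl fun a _ => ?_
  rw [lintegral_smul_measure, lintegral_prod _ hf.aemeasurable, lintegral_dirac',
    lintegral_prod _ (by fun_prop), lintegral_dirac', smul_eq_mul]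
  · exact Measurable.lintegral_prod_right' (f := fun x : (Fin H → A) × (Fin H → ℝ) => f (s, x))
      (by fun_prop)
  · exact Measurable.lintegral_prod_right' hf

theorem MDP.sum_policy_trans (M : MDP S A H) (π : Policy S A H) (h : Fin H) (x : S) :
    ∑ y, ∑ z, ENNReal.ofReal (π h x y * M.trans h x y z) = 1 := by
  have h1 : ∀ y, ∑ z, M.trans h x y z = 1 := fun y => simplex_sum _
  have h2 : ∑ y, π h x y = 1 := simplex_sum _
  rw [← ENNReal.ofReal_one, ← h2]
  rw [ENNReal.ofReal_sum_of_nonneg (fun y _ => (simplex_nonneg (π h x) y))]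
  refine Finset.sum_congr rfl fun y _ => ?_
  rw [← ENNReal.ofReal_sum_of_nonneg
    (fun z _ => mul_nonneg (simplex_nonneg (π h x) y) (simplex_nonneg (M.trans h x y) z)), ← Finset.mul_sum, h1, mul_one]

instance MDP.isProbabilityMeasure_episodeLaw (M : MDP S A H) (π : Policy S A H) :
    IsProbabilityMeasure (M.episodeLaw π) := by
  have := M.rewardLaw_prob
  constructor
  have := M.lintegral_episodeLaw π (f := fun _ => 1) measurable_const
  simp only [lintegral_const, measure_univ, one_mul, mul_one] at this
  rw [this]
  simp only [M.ofReal_pathProb]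
  rw [chainWeight_total _ _ (M.sum_policy_trans π),
    ← ENNReal.ofReal_sum_of_nonneg (fun y _ => simplex_nonneg M.init y),
    show ∑ x, M.init x = 1 from simplex_sum _, ENNReal.ofReal_one]

instance MDP.isProbabilityMeasure_dataLaw (M : MDP S A H) (π : Policy S A H) (n : ℕ) :
    IsProbabilityMeasure (M.dataLaw π n) := by
  unfold MDP.dataLaw; infer_instance

theorem MDP.pathProb_factor [Nonempty S] [Nonempty A] (M : MDP S A H) (π : Policy S A H)
    (h : Fin H) (G : (Fin (H + 1) → S) → (Fin H → A) → ENNReal)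
    (hG : ∀ s s' a a', (∀ t, h.castSucc < t → s t = s' t) → (∀ t, h < t → a t = a' t) →
      G s a = G s' a') :
    ∃ Ψ : S → ENNReal, (∀ φ : S → A → S → ENNReal,
      ∑ s, ∑ a, ENNReal.ofReal (M.pathProb π s a) *
          (φ (s h.castSucc) (a h) (s h.succ) * G s a) =
        ∑ x, ∑ y, ∑ z, ENNReal.ofReal (M.occ π h x y * M.trans h x y z) * (φ x y z * Ψ z)) ∧
      ((∀ s a, G s a = 1) → ∀ z, Ψ z = 1) := by
  have hmul : ∀ h x y z, ENNReal.ofReal (M.stateOcc π (h : Fin H) x) *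
      ENNReal.ofReal (π h x y * M.trans h x y z) =
      ENNReal.ofReal (M.occ π h x y * M.trans h x y z) := by
    intro h x y z
    rw [← ENNReal.ofReal_mul (M.stateOcc_nonneg π h x), MDP.occ, mul_assoc]
  obtain ⟨Ψ, hΨ, hΨ1⟩ := chainWeight_factor (fun x => ENNReal.ofReal (M.init x))
    (fun h x y z => ENNReal.ofReal (π h x y * M.trans h x y z))
    (fun t x => ENNReal.ofReal (M.stateOcc π t x)) rfl
    (by
      intro h z
      simp only [Fin.val_succ, Fin.val_castSucc, hmul]
      rw [M.stateOcc_succ, ENNReal.ofReal_sum_of_nonneg]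
      · refine Finset.sum_congr rfl fun x _ => ?_
        rw [ENNReal.ofReal_sum_of_nonneg]
        exact fun y _ => mul_nonneg (M.occ_nonneg π h x y) (simplex_nonneg (M.trans h x y) z)
      · exact fun x _ => Finset.sum_nonneg fun y _ =>
          mul_nonneg (M.occ_nonneg π h x y) (simplex_nonneg (M.trans h x y) z))
    (M.sum_policy_trans π) h G hG
  refine ⟨Ψ, fun φ => ?_, hΨ1⟩
  simp only [M.ofReal_pathProb, hΨ φ, Fin.val_castSucc, hmul]

/-- The part of an episode from the state at time `h + 1` on, padded with constants. -/
def future [Nonempty S] [Nonempty A] (h : Fin H) (ω : Episode S A H) : Episode S A H :=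
  (fun t => if h.castSucc < t then ω.1 t else Classical.arbitrary S,
    fun t => if h < t then ω.2.1 t else Classical.arbitrary A,
    fun t => if h < t then ω.2.2 t else 0)

theorem measurable_future [Nonempty S] [Nonempty A] (h : Fin H) :
    Measurable (future (S := S) (A := A) h) := by
  unfold future
  refine Measurable.prodMk ?_ (Measurable.prodMk ?_ ?_)
  all_goals
    refine measurable_pi_lambda _ fun t => ?_
    split_ifs
    · fun_prop
    · exact measurable_const

/-- The Markov property in integrated form: `Ψ z` plays the role of the conditional integral of `G`
given the state `z` at time `h + 1`, and it is the same for all functions `φ` of step `h`. -/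
theorem MDP.lintegral_future [Nonempty S] [Nonempty A] [MeasurableSingletonClass S]
    [MeasurableSingletonClass A] (M : MDP S A H) (π : Policy S A H)
    (h : Fin H) {G : Episode S A H → ENNReal} (hG : Measurable G) :
    ∃ Ψ : S → ENNReal, ∀ φ : S → A → S → ENNReal,
      ∫⁻ ω, φ (ω.1 h.castSucc) (ω.2.1 h) (ω.1 h.succ) * G (future h ω) ∂M.episodeLaw π =
        ∑ x, ∑ y, ∑ z, ENNReal.ofReal (M.occ π h x y * M.trans h x y z) * (φ x y z * Ψ z) := by
  have := M.rewardLaw_prob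
  obtain ⟨Ψ, hΨ, -⟩ := M.pathProb_factor π h
    (fun s a => ∫⁻ r, G (future h (s, a, r))
      ∂(Measure.pi fun h : Fin H => M.rewardLaw h (s h.castSucc) (a h)))
    (by
      -- The reward laws at steps up to `h` depend on the past. Since `future` overwrites those
      -- rewards by zero, they can be replaced by Dirac masses at zero, which makes the integral a
      -- function of the later path only.
      have key : ∀ s a, ∫⁻ r, G (future h (s, a, r))
          ∂(Measure.pi fun h : Fin H => M.rewardLaw h (s h.castSucc) (a h)) =
          ∫⁻ r, G ((future h (s, a, 0)).1, (future h (s, a, 0)).2.1, r)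
            ∂(Measure.pi fun t : Fin H => if h < t then M.rewardLaw t (s t.castSucc) (a t)
              else Measure.dirac 0) := by
        intro s a
        have hmap : (Measure.pi fun t : Fin H => if h < t then M.rewardLaw t (s t.castSucc) (a t)
            else Measure.dirac 0) =
            (Measure.pi fun h : Fin H => M.rewardLaw h (s h.castSucc) (a h)).map
              (fun r t => if h < t then r t else 0) := by
          have := Measure.pi_map_pi (μ := fun h : Fin H => M.rewardLaw h (s h.castSucc) (a h))
            (f := fun t x => if h < t then x else (0 : ℝ))
            (hμ := fun t => by
              have := Measure.isProbabilityMeasure_map (μ := M.rewardLaw t (s t.castSucc) (a t))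
                (f := fun x => if h < t then x else (0 : ℝ))
                (by split_ifs; exacts [aemeasurable_id, aemeasurable_const])
              infer_instance)
            (fun t => by split_ifs; exacts [aemeasurable_id, aemeasurable_const])
          rw [this]
          congr 1
          funext t
          split_ifs
          · exact Measure.map_id'.symm
          · rw [Measure.map_const]; simp
        rw [hmap, lintegral_map]
        · rfl
        · fun_prop
        · refine measurable_pi_lambda _ fun t => ?_
          split_ifs <;> fun_prop
      intro s s' a a' hs ha
      rw [key, key]
      congr 1
      · congr 1
        funext t
        split_ifs with ht
        · rw [hs t.castSucc (by simpa using ht), ha t ht]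
        · rfl
      · funext r
        congr 2
        · funext t
          simp only [future]
          split_ifs with ht
          · exact hs t ht
          · rfl
        · congr 1
          funext t
          simp only [future]
          split_ifs with ht
          · exact ha t ht
          · rfl)
  refine ⟨Ψ, fun φ => ?_⟩
  have hφ : Measurable fun ω : Episode S A H => φ (ω.1 h.castSucc) (ω.2.1 h) (ω.1 h.succ) := by
    have h1 : Measurable (fun x : S × A × S => φ x.1 x.2.1 x.2.2) := measurable_of_countable _
    have h2 : Measurable fun ω : Episode S A H => (ω.1 h.castSucc, ω.2.1 h, ω.1 h.succ) := by
      fun_prop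
    exact h1.comp h2
  rw [M.lintegral_episodeLaw π (f := fun ω => φ (ω.1 h.castSucc) (ω.2.1 h) (ω.1 h.succ) *
    G (future h ω)) (hφ.mul (hG.comp (measurable_future h))), ← hΨ]
  refine Finset.sum_congr rfl fun s _ => Finset.sum_congr rfl fun a _ => ?_
  congr 1
  have hm : Measurable fun r : Fin H → ℝ => ((s, a, r) : Episode S A H) := by fun_prop
  have hG' : Measurable fun r : Fin H → ℝ => G (future h (s, a, r)) :=
    (hG.comp (measurable_future h)).comp hm
  exact lintegral_const_mul (φ (s h.castSucc) (a h) (s h.succ)) hG'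

/-- The joint law of the realized reward and the next state at `(h, s, a)`. -/
def MDP.stepLaw (M : MDP S A H) (h : Fin H) (s : S) (a : A) : Measure (ℝ × S) :=
  (M.rewardLaw h s a).prod (∑ z, ENNReal.ofReal (M.trans h s a z) • Measure.dirac z)

instance MDP.isProbabilityMeasure_sum_trans (M : MDP S A H) (h : Fin H) (s : S) (a : A) :
    IsProbabilityMeasure
      (∑ z, ENNReal.ofReal (M.trans h s a z) • Measure.dirac z : Measure S) := by
  constructor
  rw [Measure.finsetSum_apply]
  simp only [Measure.smul_apply, measure_univ, smul_eq_mul, mul_one]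
  rw [← ENNReal.ofReal_sum_of_nonneg (fun z _ => (simplex_nonneg (M.trans h s a) z)),
    show ∑ z, M.trans h s a z = 1 from simplex_sum _, ENNReal.ofReal_one]

instance MDP.isProbabilityMeasure_stepLaw (M : MDP S A H) (h : Fin H) (s : S) (a : A) :
    IsProbabilityMeasure (M.stepLaw h s a) := by
  have := M.rewardLaw_prob
  unfold MDP.stepLaw; infer_instance

/-- The episodes that visit `(s, a)` at time `h`. -/
def visitSet (h : Fin H) (s : S) (a : A) : Set (Episode S A H) :=
  {ω | ω.1 h.castSucc = s ∧ ω.2.1 h = a}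

/-- The realized reward at time `h` and the next state. -/
def stepOutcome (h : Fin H) (ω : Episode S A H) : ℝ × S := (ω.2.2 h, ω.1 h.succ)

theorem measurable_stepOutcome (h : Fin H) : Measurable (stepOutcome (S := S) (A := A) h) := by
  unfold stepOutcome; fun_prop

variable [MeasurableSingletonClass S] [MeasurableSingletonClass A]

theorem measurableSet_visitSet (h : Fin H) (s : S) (a : A) :
    MeasurableSet (visitSet h s a) := by
  have h1 : Measurable fun ω : Episode S A H => ω.1 h.castSucc := by fun_prop
  have h2 : Measurable fun ω : Episode S A H => ω.2.1 h := by fun_prop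
  exact (h1 (measurableSet_singleton s)).inter (h2 (measurableSet_singleton a))

theorem MDP.lintegral_stepLaw (M : MDP S A H) (h : Fin H) (s : S) (a : A)
    {g : ℝ × S → ENNReal} (hg : Measurable g) :
    ∫⁻ x, g x ∂M.stepLaw h s a =
      ∑ z, ENNReal.ofReal (M.trans h s a z) * ∫⁻ x, g (x, z) ∂M.rewardLaw h s a := by
  have := M.rewardLaw_prob
  unfold MDP.stepLaw
  rw [lintegral_prod _ hg.aemeasurable]
  simp only [lintegral_finsetSum_measure, lintegral_smul_measure, lintegral_dirac, smul_eq_mul]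
  rw [lintegral_finsetSum _ (fun z _ => by fun_prop)]
  refine Finset.sum_congr rfl fun z _ => ?_
  rw [lintegral_const_mul]
  fun_prop

/-- Reduces every integral over the visits to a pair to an integral under the one-step law, with
total mass the occupancy. It is the factorization of path sums with trivial future. -/
theorem MDP.map_stepOutcome [Nonempty S] [Nonempty A] (M : MDP S A H) (π : Policy S A H)
    (h : Fin H) (s : S) (a : A) :
    ((M.episodeLaw π).restrict (visitSet h s a)).map (stepOutcome h) =
      ENNReal.ofReal (M.occ π h s a) • M.stepLaw h s a := by
  classical
  have := M.rewardLaw_prob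
  refine Measure.ext_of_lintegral _ fun g hg => ?_
  rw [lintegral_map hg (measurable_stepOutcome h), lintegral_smul_measure,
    M.lintegral_stepLaw h s a hg, ← lintegral_indicator (measurableSet_visitSet h s a),
    M.lintegral_episodeLaw π (f := (visitSet h s a).indicator fun ω => g (stepOutcome h ω))
      ((hg.comp (measurable_stepOutcome h)).indicator (measurableSet_visitSet h s a))]
  obtain ⟨Ψ, hΨ, hΨ1⟩ := M.pathProb_factor π h (fun _ _ => 1) (fun _ _ _ _ _ _ => rfl)
  have h1 := hΨ1 fun _ _ => rfl
  -- The reward is integrated out first; what is left depends on the state, the action and the next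
  -- state only.
  have h2 := hΨ fun x y z => if x = s ∧ y = a then ∫⁻ r, g (r, z) ∂M.rewardLaw h s a else 0
  simp only [h1, mul_one] at h2
  rw [Finset.sum_eq_single s, Finset.sum_eq_single a] at h2
  · simp only [and_self, if_true] at h2
    rw [smul_eq_mul, Finset.mul_sum]
    refine Eq.trans ?_ (h2.trans ?_)
    · refine Finset.sum_congr rfl fun p _ => Finset.sum_congr rfl fun q _ => ?_
      congr 1
      by_cases hpq : p h.castSucc = s ∧ q h = a
      · rw [if_pos hpq, ← hpq.1, ← hpq.2]
        have hmp := measurePreserving_eval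
          (fun h : Fin H => M.rewardLaw h (p h.castSucc) (q h)) h
        rw [← hmp.lintegral_comp (f := fun r => g (r, p h.succ)) (by fun_prop)]
        refine lintegral_congr fun r => ?_
        rw [Set.indicator_of_mem]
        · rfl
        · exact ⟨rfl, rfl⟩
      · rw [if_neg hpq]
        refine (lintegral_congr fun r => ?_).trans lintegral_zero
        rw [Set.indicator_of_notMem]
        exact hpq
    · refine Finset.sum_congr rfl fun z _ => ?_
      rw [ENNReal.ofReal_mul (M.occ_nonneg π h s a), mul_assoc]
  · intro y _ hy
    simp [hy]
  · simp
  · intro x _ hx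
    simp [hx]
  · simp

end EpisodeLaw

/-! ### Exponential inequalities for independent samples -/

section Concentration

/-- Taylor with third order remainder. The coefficient 1/2 is kept up to the factor `1 + y`, which
is what gives Bernstein's inequality the sharp leading term needed to match the bonus. -/
theorem exp_le_quadratic {x y : ℝ} (hx : |x| ≤ y) (hy : y ≤ 1) :
    Real.exp x ≤ 1 + x + x ^ 2 / 2 * (1 + y) := by
  have h := (abs_le.1 (Real.exp_bound (hx.trans hy) (n := 3) (by norm_num))).2
  simp only [Finset.sum_range_succ, Finset.sum_range_zero, Nat.factorial] at h
  norm_num at h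
  have h2 : |x| ^ 3 ≤ x ^ 2 * y := by
    rw [pow_succ, sq_abs]
    exact mul_le_mul_of_nonneg_left hx (sq_nonneg x)
  nlinarith [sq_nonneg x, abs_nonneg x, pow_nonneg (abs_nonneg x) 3]

/-- Optimizes the Chernoff exponent. If the variance `m` is large, the unconstrained minimizer
`√(2t/m)` satisfies `l b ≤ 1`; otherwise the boundary value `1/b` is used, and the linear term `3bt`
pays for it. -/
theorem exists_bernstein_exponent {b m t : ℝ} (hb : 0 < b) (ht : 0 ≤ t) :
    ∃ l : ℝ, 0 ≤ l ∧ l * b ≤ 1 ∧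
      m * (l ^ 2 / 2 * (1 + l * b)) + t ≤ l * (√(2 * m * t) + 3 * b * t) := by
  rcases le_or_gt m (2 * t * b ^ 2) with h | h
  · refine ⟨1 / b, by positivity, by field_simp; exact le_rfl, ?_⟩
    have h1 : m * ((1 / b) ^ 2 / 2 * (1 + 1 / b * b)) = m / b ^ 2 := by field_simp; ring
    have h2 : m / b ^ 2 ≤ 2 * t := by rw [div_le_iff₀ (by positivity)]; exact h
    have h3 : 1 / b * (√(2 * m * t) + 3 * b * t) = √(2 * m * t) / b + 3 * t := by field_simp
    have h4 : 0 ≤ √(2 * m * t) / b := by positivity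
    rw [h1, h3]; linarith
  · have hm' : 0 < m := lt_of_le_of_lt (by positivity) h
    set l := √(2 * t / m) with hl
    have hl0 : 0 ≤ l := Real.sqrt_nonneg _
    have hl2 : l ^ 2 = 2 * t / m := Real.sq_sqrt (by positivity)
    have hlb : l * b ≤ 1 := by
      have : (l * b) ^ 2 ≤ 1 := by
        rw [mul_pow, hl2, div_mul_eq_mul_div, div_le_one hm']; exact h.le
      nlinarith [mul_nonneg hl0 hb.le]
    have hs : l * √(2 * m * t) = 2 * t := by
      rw [hl, ← Real.sqrt_mul (by positivity), show 2 * t / m * (2 * m * t) = (2 * t) ^ 2 by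
        field_simp, Real.sqrt_sq (by positivity)]
    refine ⟨l, hl0, hlb, ?_⟩
    have h1 : m * (l ^ 2 / 2 * (1 + l * b)) = t * (1 + l * b) := by
      rw [hl2]; field_simp
    rw [h1, mul_add l, hs]
    nlinarith [mul_nonneg (mul_nonneg hl0 hb.le) ht]

/-- Bernstein's inequality for independent copies of a bounded centered random variable. -/
theorem bernstein_pi {Ω : Type*} [MeasurableSpace Ω] (ν : Measure Ω) [IsProbabilityMeasure ν]
    {X : Ω → ℝ} (hX : Measurable X) {b v t : ℝ} (hb : 0 < b) (ht : 0 ≤ t)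
    (hbound : ∀ᵐ ω ∂ν, |X ω| ≤ b) (hmean : ∫ ω, X ω ∂ν = 0) (hvar : ∫ ω, X ω ^ 2 ∂ν ≤ v)
    (n : ℕ) :
    (Measure.pi fun _ : Fin n => ν) {D | √(2 * (n * v) * t) + 3 * b * t < ∑ τ, X (D τ)} ≤
      ENNReal.ofReal (Real.exp (-t)) := by
  obtain ⟨l, hl0, hlb, hl⟩ := exists_bernstein_exponent hb (m := n * v) ht
  have hint : Integrable X ν := Integrable.of_bound hX.aestronglyMeasurable b hbound
  have hint2 : Integrable (fun ω => X ω ^ 2) ν :=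
    Integrable.of_bound (hX.pow_const 2).aestronglyMeasurable (b ^ 2) (by
      filter_upwards [hbound] with ω hω
      rw [Real.norm_eq_abs, abs_pow]
      exact pow_le_pow_left₀ (abs_nonneg _) hω 2)
  have hmgf : ∫ ω, Real.exp (l * X ω) ∂ν ≤ Real.exp (l ^ 2 / 2 * (1 + l * b) * v) := by
    calc ∫ ω, Real.exp (l * X ω) ∂ν
        ≤ ∫ ω, (1 + l * X ω + l ^ 2 / 2 * (1 + l * b) * X ω ^ 2) ∂ν := by
          refine integral_mono_of_nonneg (Filter.Eventually.of_forall fun ω => (Real.exp_pos _).le)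
            (by fun_prop) ?_
          filter_upwards [hbound] with ω hω
          have := exp_le_quadratic (x := l * X ω) (y := l * b)
            (by rw [abs_mul, abs_of_nonneg hl0]; exact mul_le_mul_of_nonneg_left hω hl0) hlb
          refine this.trans (le_of_eq ?_)
          ring
      _ = 1 + l ^ 2 / 2 * (1 + l * b) * ∫ ω, X ω ^ 2 ∂ν := by
          rw [integral_add (by fun_prop) (by fun_prop), integral_add (by fun_prop) (by fun_prop),
            integral_const_mul, integral_const_mul, hmean]
          simp
      _ ≤ 1 + l ^ 2 / 2 * (1 + l * b) * v := by gcongr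
      _ ≤ _ := by
          rw [add_comm]; exact Real.add_one_le_exp _
  set μ := Measure.pi fun _ : Fin n => ν
  have hprod : ∫ D, Real.exp (l * ∑ τ, X (D τ)) ∂μ = (∫ ω, Real.exp (l * X ω) ∂ν) ^ n := by
    simp only [Finset.mul_sum, Real.exp_sum]
    rw [integral_fintype_prod_eq_prod (f := fun (_ : Fin n) ω => Real.exp (l * X ω))]
    simp
  have hbd : ∀ᵐ D ∂μ, ∀ τ : Fin n, |X (D τ)| ≤ b := by
    rw [ae_all_iff]
    intro τ
    exact (Measure.quasiMeasurePreserving_eval (fun _ : Fin n => ν) τ).ae hbound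
  have hintS : Integrable (fun D : Fin n → Ω => Real.exp (l * ∑ τ, X (D τ))) μ := by
    refine Integrable.of_bound (C := Real.exp (l * (n * b))) ?_ ?_
    · exact Measurable.aestronglyMeasurable (by fun_prop)
    · filter_upwards [hbd] with D hD
      rw [Real.norm_eq_abs, Real.abs_exp]
      gcongr
      calc ∑ τ, X (D τ) ≤ ∑ _τ : Fin n, b := Finset.sum_le_sum fun τ _ => (le_abs_self _).trans (hD τ)
        _ = n * b := by simp
  have hch := ProbabilityTheory.measure_ge_le_exp_mul_mgf (μ := μ)
    (X := fun D : Fin n → Ω => ∑ τ, X (D τ)) (√(2 * (n * v) * t) + 3 * b * t) hl0 hintS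
  have hfin : μ.real {D | √(2 * (n * v) * t) + 3 * b * t ≤ ∑ τ, X (D τ)} ≤ Real.exp (-t) := by
    refine hch.trans ?_
    rw [ProbabilityTheory.mgf, hprod]
    calc _ ≤ Real.exp (-l * (√(2 * (n * v) * t) + 3 * b * t)) *
          Real.exp (l ^ 2 / 2 * (1 + l * b) * v) ^ n := by
          gcongr
      _ = Real.exp (-l * (√(2 * (n * v) * t) + 3 * b * t) +
          n * (l ^ 2 / 2 * (1 + l * b) * v)) := by
          rw [← Real.exp_nat_mul, ← Real.exp_add]
      _ ≤ _ := by
          apply Real.exp_le_exp.2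
          nlinarith
  calc μ {D | √(2 * (n * v) * t) + 3 * b * t < ∑ τ, X (D τ)}
      ≤ μ {D | √(2 * (n * v) * t) + 3 * b * t ≤ ∑ τ, X (D τ)} :=
        measure_mono (Set.ofPred_subset_ofPred.2 fun D hD => hD.le)
    _ ≤ _ := by
        rw [← ENNReal.ofReal_toReal (measure_ne_top μ _)]
        exact ENNReal.ofReal_le_ofReal hfin

/-- If integrating out any single coordinate removes the corresponding factor, a product of
nonnegative functions of all coordinates has integral at most one. -/
theorem lintegral_pi_prod_le_one {Ω : Type*} [MeasurableSpace Ω] (ν : Measure Ω)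
    [IsProbabilityMeasure ν] {n : ℕ} (g : Fin n → (Fin n → Ω) → ENNReal)
    (hg : ∀ τ, Measurable (g τ))
    (hstep : ∀ (τ : Fin n) (T : Finset (Fin n)), τ ∉ T → ∀ D : Fin n → Ω,
      ∫⁻ ω, g τ (Function.update D τ ω) * ∏ σ ∈ T, g σ (Function.update D τ ω) ∂ν ≤
        ∫⁻ ω, ∏ σ ∈ T, g σ (Function.update D τ ω) ∂ν) :
    ∫⁻ D, ∏ τ, g τ D ∂(Measure.pi fun _ : Fin n => ν) ≤ 1 := by
  have hmain : ∀ T : Finset (Fin n),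
      ∫⁻ D, ∏ τ ∈ T, g τ D ∂(Measure.pi fun _ : Fin n => ν) ≤ 1 := by
    intro T
    induction T using Finset.induction_on with
    | empty => simp
    | insert τ T hτ ih =>
      refine le_trans ?_ ih
      rcases isEmpty_or_nonempty (Fin n → Ω) with hE | ⟨⟨D₀⟩⟩
      · simp [lintegral_of_isEmpty]
      -- Only the coordinate `τ` is integrated, the others being frozen. No filtration is involved,
      -- so each factor may depend on every coordinate.
      rw [lintegral_eq_lmarginal_univ D₀, lintegral_eq_lmarginal_univ D₀,
        lmarginal_erase' _ (by fun_prop) (Finset.mem_univ τ),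
        lmarginal_erase' _ (by fun_prop) (Finset.mem_univ τ)]
      refine lmarginal_mono (fun D => ?_) D₀
      simp only [Finset.prod_insert hτ]
      exact hstep τ T hτ D
  exact hmain Finset.univ

/-- Follows from `1 + b(e^{lf} - 1) ≤ exp(b(e^{lf} - 1))` and `e^{lf} - 1 ≤ lf + (lf)²`. The
compensator is proportional to `b`, so that deviations scale with the expected number of visits and
not with the number of episodes. -/
theorem bernoulli_exp_le_one {b f l : ℝ} (hb0 : 0 ≤ b) (hf : |f| ≤ 1) (hl0 : 0 ≤ l)
    (hl1 : l ≤ 1) :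
    b * Real.exp (l * ((1 - b) * f) - l ^ 2 * b) +
      (1 - b) * Real.exp (l * ((0 - b) * f) - l ^ 2 * b) ≤ 1 := by
  have hlf : |l * f| ≤ 1 := by
    rw [abs_mul, abs_of_nonneg hl0]
    exact mul_le_one₀ hl1 (abs_nonneg _) hf
  have h1 := (abs_le.1 (Real.abs_exp_sub_one_sub_id_le hlf)).2
  have h2 : (l * f) ^ 2 ≤ l ^ 2 := by
    rw [mul_pow]
    have : f ^ 2 ≤ 1 := by rw [← sq_abs]; exact pow_le_one₀ (abs_nonneg _) hf
    nlinarith [sq_nonneg l]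
  have e1 : Real.exp (l * ((1 - b) * f) - l ^ 2 * b) =
      Real.exp (l * ((0 - b) * f) - l ^ 2 * b) * Real.exp (l * f) := by
    rw [← Real.exp_add]; congr 1; ring
  have h3 : b * Real.exp (l * ((1 - b) * f) - l ^ 2 * b) +
      (1 - b) * Real.exp (l * ((0 - b) * f) - l ^ 2 * b) =
      Real.exp (l * ((0 - b) * f) - l ^ 2 * b) * (b * (Real.exp (l * f) - 1) + 1) := by
    rw [e1]; ring
  rw [h3]
  calc _ ≤ Real.exp (l * ((0 - b) * f) - l ^ 2 * b) * Real.exp (b * (Real.exp (l * f) - 1)) := by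
        gcongr
        exact Real.add_one_le_exp _
    _ = Real.exp (l * ((0 - b) * f) - l ^ 2 * b + b * (Real.exp (l * f) - 1)) := by
        rw [Real.exp_add]
    _ ≤ 1 := by
        rw [Real.exp_le_one_iff]
        nlinarith

end Concentration

/-! ### Time reversal, and concentration given the later data -/

section DataConcentration

variable {S A : Type*} [Fintype S] [Fintype A] [Nonempty S] [Nonempty A] [MeasurableSpace S]
  [MeasurableSpace A] [MeasurableSingletonClass S] [MeasurableSingletonClass A] {H : ℕ}

/-- Conditioning without conditional expectations: two functions of step `h` with the same integral
over each value of the next state are interchangeable against any function of the future. -/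
theorem MDP.lintegral_future_congr (M : MDP S A H) (π : Policy S A H) (h : Fin H)
    {G : Episode S A H → ENNReal} (hG : Measurable G) {φ φ' : S → A → S → ℝ}
    (hφ : ∀ x y z, 0 ≤ φ x y z) (hφ' : ∀ x y z, 0 ≤ φ' x y z)
    (heq : ∀ z, ∑ x, ∑ y, M.occ π h x y * M.trans h x y z * φ x y z =
      ∑ x, ∑ y, M.occ π h x y * M.trans h x y z * φ' x y z) :
    ∫⁻ ω, ENNReal.ofReal (φ (ω.1 h.castSucc) (ω.2.1 h) (ω.1 h.succ)) * G (future h ω)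
        ∂M.episodeLaw π =
      ∫⁻ ω, ENNReal.ofReal (φ' (ω.1 h.castSucc) (ω.2.1 h) (ω.1 h.succ)) * G (future h ω)
        ∂M.episodeLaw π := by
  obtain ⟨Ψ, hΨ⟩ := M.lintegral_future π h hG
  have key : ∀ φ : S → A → S → ℝ, (∀ x y z, 0 ≤ φ x y z) →
      ∫⁻ ω, ENNReal.ofReal (φ (ω.1 h.castSucc) (ω.2.1 h) (ω.1 h.succ)) * G (future h ω)
        ∂M.episodeLaw π = ∑ z, ENNReal.ofReal (∑ x, ∑ y, M.occ π h x y * M.trans h x y z *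
          φ x y z) * Ψ z := by
    intro φ hφ
    rw [hΨ fun x y z => ENNReal.ofReal (φ x y z)]
    have h0 : ∀ x y z, 0 ≤ M.occ π h x y * M.trans h x y z := fun x y z =>
      mul_nonneg (M.occ_nonneg π h x y) (simplex_nonneg _ _)
    have h1 : ∀ z, ENNReal.ofReal (∑ x, ∑ y, M.occ π h x y * M.trans h x y z * φ x y z) * Ψ z =
        ∑ x, ∑ y, ENNReal.ofReal (M.occ π h x y * M.trans h x y z) *
          (ENNReal.ofReal (φ x y z) * Ψ z) := by
      intro z
      rw [ENNReal.ofReal_sum_of_nonneg (fun x _ => Finset.sum_nonneg fun y _ =>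
        mul_nonneg (h0 x y z) (hφ x y z)), Finset.sum_mul]
      refine Finset.sum_congr rfl fun x _ => ?_
      rw [ENNReal.ofReal_sum_of_nonneg (fun y _ => mul_nonneg (h0 x y z) (hφ x y z)),
        Finset.sum_mul]
      refine Finset.sum_congr rfl fun y _ => ?_
      rw [ENNReal.ofReal_mul (h0 x y z), mul_assoc]
    simp only [h1]
    rw [Finset.sum_comm]
    conv_rhs => rw [Finset.sum_comm]
    rw [Finset.sum_comm]
    refine Finset.sum_congr rfl fun x _ => ?_
    rw [Finset.sum_comm]
  rw [key φ hφ, key φ' hφ']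
  simp only [heq]

/-- The reversed chain: given everything from time `h + 1` on, the visit to `(s, a)` is a Bernoulli
event whose parameter depends on the next state alone. -/
theorem MDP.lintegral_visit_future (M : MDP S A H) (π : Policy S A H) (h : Fin H) (s : S) (a : A)
    {G₁ G₀ : Episode S A H → ENNReal} (hG₁ : Measurable G₁) (hG₀ : Measurable G₀) :
    ∫⁻ ω, (visitSet h s a).indicator (fun ω => G₁ (future h ω)) ω +
        (visitSet h s a)ᶜ.indicator (fun ω => G₀ (future h ω)) ω ∂M.episodeLaw π =
      ∫⁻ ω, ENNReal.ofReal (M.backProb π h s a (ω.1 h.succ)) * G₁ (future h ω) +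
        ENNReal.ofReal (1 - M.backProb π h s a (ω.1 h.succ)) * G₀ (future h ω)
        ∂M.episodeLaw π := by
  classical
  have hb : ∀ z, ∑ x, ∑ y, M.occ π h x y * M.trans h x y z * M.backProb π h s a z =
      ∑ x, ∑ y, M.occ π h x y * M.trans h x y z * if x = s ∧ y = a then 1 else 0 := by
    intro z
    simp only [← Finset.sum_mul]
    rw [← M.stateOcc_succ, M.stateOcc_mul_backProb, Finset.sum_eq_single s, Finset.sum_eq_single a]
    · simp
    · intro y _ hy; simp [hy]
    · simp
    · intro x _ hx; simp [hx]
    · simp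
  have hmb : Measurable fun ω : Episode S A H => M.backProb π h s a (ω.1 h.succ) :=
    (measurable_of_countable (M.backProb π h s a)).comp (by fun_prop)
  have hf := measurable_future (S := S) (A := A) h
  have hm₁ : Measurable ((visitSet h s a).indicator fun ω => G₁ (future h ω)) :=
    (hG₁.comp hf).indicator (measurableSet_visitSet h s a)
  have hm₂ : Measurable fun ω : Episode S A H =>
      ENNReal.ofReal (M.backProb π h s a (ω.1 h.succ)) * G₁ (future h ω) :=
    hmb.ennreal_ofReal.mul (hG₁.comp hf)
  rw [lintegral_add_left hm₁, lintegral_add_left hm₂]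
  congr 1
  · rw [M.lintegral_future_congr π h hG₁ (φ := fun _ _ z => M.backProb π h s a z)
      (φ' := fun x y _ => if x = s ∧ y = a then 1 else 0)
      (fun _ _ z => M.backProb_nonneg π h s a z) (fun x y _ => by split_ifs <;> norm_num) hb]
    refine lintegral_congr fun ω => ?_
    by_cases hω : ω ∈ visitSet h s a
    · rw [Set.indicator_of_mem hω, if_pos (by exact hω)]; simp
    · rw [Set.indicator_of_notMem hω, if_neg (by exact hω)]; simp
  · rw [M.lintegral_future_congr π h hG₀ (φ := fun _ _ z => 1 - M.backProb π h s a z)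
      (φ' := fun x y _ => 1 - if x = s ∧ y = a then 1 else 0)
      (fun _ _ z => sub_nonneg.2 (M.backProb_le_one π h s a z))
      (fun x y _ => by split_ifs <;> norm_num)
      (fun z => by simp only [mul_sub, Finset.sum_sub_distrib, hb])]
    refine lintegral_congr fun ω => ?_
    by_cases hω : ω ∈ visitSet h s a
    · rw [Set.indicator_of_notMem (by simpa using hω), if_pos (by exact hω)]; simp
    · rw [Set.indicator_of_mem (by exact hω), if_neg (by exact hω)]; simp

theorem future_future (h : Fin H) (ω : Episode S A H) : future h (future h ω) = future h ω := by
  unfold future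
  refine Prod.ext ?_ (Prod.ext ?_ ?_) <;> funext t <;> dsimp only <;> split_ifs <;> rfl

theorem future_succ (h : Fin H) (ω : Episode S A H) : (future h ω).1 h.succ = ω.1 h.succ :=
  if_pos h.castSucc_lt_succ

/-- Concentration of the visit indicators of `(s, a)` at time `h` given all the data from time
`h + 1` on, tested against a function of the next state that may depend on the later data. -/
theorem MDP.visit_future_concentration (M : MDP S A H) (π : Policy S A H) (h : Fin H) (s : S)
    (a : A) {n : ℕ} (f : (Fin n → Episode S A H) → S → ℝ) (hfm : ∀ z, Measurable fun D => f D z)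
    (hf1 : ∀ D z, |f D z| ≤ 1) (hff : ∀ D, f D = f fun τ => future h (D τ))
    {l t : ℝ} (hl0 : 0 < l) (hl1 : l ≤ 1) :
    M.dataLaw π n {D | l * ∑ τ, M.backProb π h s a ((D τ).1 h.succ) + t / l <
      ∑ τ, ((visitSet h s a).indicator (fun _ => (1 : ℝ)) (D τ) -
        M.backProb π h s a ((D τ).1 h.succ)) * f D ((D τ).1 h.succ)} ≤
      ENNReal.ofReal (Real.exp (-t)) := by
  classical
  set b := M.backProb π h s a with hb
  have hfm' : Measurable fun x : (Fin n → Episode S A H) × S => f x.1 x.2 :=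
    measurable_from_prod_countable_left hfm
  have hbm : Measurable b := measurable_of_countable _
  have hev : ∀ τ : Fin n, Measurable fun D : Fin n → Episode S A H => (D τ).1 h.succ :=
    fun τ => by fun_prop
  have hbm' : ∀ τ : Fin n, Measurable fun D : Fin n → Episode S A H => b ((D τ).1 h.succ) :=
    fun τ => hbm.comp (hev τ)
  have hfm'' : ∀ τ : Fin n, Measurable fun D : Fin n → Episode S A H => f D ((D τ).1 h.succ) :=
    fun τ => hfm'.comp (measurable_id.prodMk (hev τ))
  let e : Fin n → (Fin n → Episode S A H) → ℝ → ENNReal := fun τ D i =>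
    ENNReal.ofReal (Real.exp (l * ((i - b ((D τ).1 h.succ)) * f D ((D τ).1 h.succ)) -
      l ^ 2 * b ((D τ).1 h.succ)))
  have hem : ∀ τ i, Measurable fun D => e τ D i := by
    intro τ i
    have := hbm' τ
    have := hfm'' τ
    simp only [e]
    fun_prop
  -- The exponential factor of episode `τ`, where `e τ D i` has the visit indicator frozen at `i`.
  -- With the indicator frozen, episode `τ` enters only through its future.
  let g : Fin n → (Fin n → Episode S A H) → ENNReal := fun τ D =>
    if D τ ∈ visitSet h s a then e τ D 1 else e τ D 0
  have hgm : ∀ τ, Measurable (g τ) := fun τ =>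
    Measurable.ite ((measurable_pi_apply τ) (measurableSet_visitSet h s a)) (hem τ 1) (hem τ 0)
  have hupd : ∀ (D : Fin n → Episode S A H) (τ : Fin n) (ω : Episode S A H),
      f (Function.update D τ ω) = f (Function.update D τ (future h ω)) := by
    intro D τ ω
    rw [hff, hff (Function.update D τ (future h ω))]
    congr 1
    funext σ
    by_cases hσ : σ = τ
    · subst hσ; simp [future_future]
    · simp [hσ]
  have hle : ∫⁻ D, ∏ τ, g τ D ∂(Measure.pi fun _ : Fin n => M.episodeLaw π) ≤ 1 := by
    refine lintegral_pi_prod_le_one _ g hgm fun τ T hτ D => ?_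
    let R : Episode S A H → ENNReal := fun y => ∏ σ ∈ T, g σ (Function.update D τ y)
    have hum : Measurable (Function.update D τ) := measurable_update D
    have hRm : Measurable R := Finset.measurable_prod _ fun σ _ => (hgm σ).comp hum
    -- The other factors contain the visit indicators of other episodes, and see episode `τ` only
    -- through `f`, which ignores step `h`. Hence they are constant once the future of `τ` is given.
    have hRf : ∀ ω, R ω = R (future h ω) := by
      intro ω
      refine Finset.prod_congr rfl fun σ hσ => ?_
      have hne : σ ≠ τ := fun hc => hτ (hc ▸ hσ)
      simp only [g, e, hupd D τ ω, Function.update_of_ne hne]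
    have hef : ∀ ω i, e τ (Function.update D τ ω) i = e τ (Function.update D τ (future h ω)) i := by
      intro ω i
      simp only [e, hupd D τ ω, Function.update_self, future_succ]
    have hgf : ∀ ω, g τ (Function.update D τ ω) * R ω =
        (visitSet h s a).indicator
          (fun ω => (fun y => e τ (Function.update D τ y) 1 * R y) (future h ω)) ω +
        (visitSet h s a)ᶜ.indicator
          (fun ω => (fun y => e τ (Function.update D τ y) 0 * R y) (future h ω)) ω := by
      intro ω
      by_cases hω : ω ∈ visitSet h s a
      · rw [Set.indicator_of_mem hω, Set.indicator_of_notMem (by simpa using hω), add_zero]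
        simp only [g, Function.update_self, if_pos hω]
        rw [← hRf, hef]
      · rw [Set.indicator_of_notMem hω, Set.indicator_of_mem (by exact hω), zero_add]
        simp only [g, Function.update_self, if_neg hω]
        rw [← hRf, hef]
    calc _ = ∫⁻ ω, g τ (Function.update D τ ω) * R ω ∂M.episodeLaw π := rfl
      _ ≤ ∫⁻ ω, R ω ∂M.episodeLaw π := by
        simp only [hgf]
        rw [M.lintegral_visit_future π h s a
          (G₁ := fun y => e τ (Function.update D τ y) 1 * R y)
          (G₀ := fun y => e τ (Function.update D τ y) 0 * R y)
          (((hem τ 1).comp hum).mul hRm) (((hem τ 0).comp hum).mul hRm)]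
        refine lintegral_mono fun ω => ?_
        dsimp only
        rw [← hRf, ← hef, ← hef, ← mul_assoc, ← mul_assoc, ← add_mul]
        refine mul_le_of_le_one_left zero_le ?_
        have hb0 := M.backProb_nonneg π h s a (ω.1 h.succ)
        have hb1 := M.backProb_le_one π h s a (ω.1 h.succ)
        simp only [e, Function.update_self]
        rw [← ENNReal.ofReal_mul hb0, ← ENNReal.ofReal_mul (sub_nonneg.2 hb1),
          ← ENNReal.ofReal_add (by positivity)
            (mul_nonneg (sub_nonneg.2 hb1) (Real.exp_pos _).le), ← ENNReal.ofReal_one]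
        exact ENNReal.ofReal_le_ofReal
          (bernoulli_exp_le_one hb0 (hf1 _ _) hl0.le hl1)
  have hprod : ∀ D, ∏ τ, g τ D = ENNReal.ofReal (Real.exp (l *
      (∑ τ, ((visitSet h s a).indicator (fun _ => (1 : ℝ)) (D τ) - b ((D τ).1 h.succ)) *
        f D ((D τ).1 h.succ)) - l ^ 2 * ∑ τ, b ((D τ).1 h.succ))) := by
    intro D
    have : ∀ τ, g τ D = ENNReal.ofReal (Real.exp (l *
        (((visitSet h s a).indicator (fun _ => (1 : ℝ)) (D τ) - b ((D τ).1 h.succ)) *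
          f D ((D τ).1 h.succ)) - l ^ 2 * b ((D τ).1 h.succ))) := by
      intro τ
      by_cases hω : D τ ∈ visitSet h s a
      · simp only [g, e, if_pos hω, Set.indicator_of_mem hω]
      · simp only [g, e, if_neg hω, Set.indicator_of_notMem hω]
    simp only [this]
    rw [← ENNReal.ofReal_prod_of_nonneg (fun _ _ => (Real.exp_pos _).le), ← Real.exp_sum,
      Finset.sum_sub_distrib, Finset.mul_sum, Finset.mul_sum]
  -- Markov's inequality at level `exp t`. On the bad event, multiplying by `l` shows that the
  -- exponent of the product exceeds `t`.
  have hmarkov := mul_meas_ge_le_lintegral (μ := M.dataLaw π n)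
    (f := fun D => ∏ τ, g τ D) (by fun_prop) (ENNReal.ofReal (Real.exp t))
  have h1 : ENNReal.ofReal (Real.exp t) * M.dataLaw π n
      {D | ENNReal.ofReal (Real.exp t) ≤ ∏ τ, g τ D} ≤ 1 := hmarkov.trans hle
  calc _ ≤ M.dataLaw π n {D | ENNReal.ofReal (Real.exp t) ≤ ∏ τ, g τ D} := by
        refine measure_mono (Set.ofPred_subset_ofPred.2 fun D hD => ?_)
        rw [hprod]
        refine ENNReal.ofReal_le_ofReal (Real.exp_le_exp.2 ?_)
        have := mul_lt_mul_of_pos_left hD hl0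
        rw [mul_add, mul_div_cancel₀ _ hl0.ne'] at this
        nlinarith
    _ = ENNReal.ofReal (Real.exp (-t)) * (ENNReal.ofReal (Real.exp t) * M.dataLaw π n
          {D | ENNReal.ofReal (Real.exp t) ≤ ∏ τ, g τ D}) := by
        rw [← mul_assoc, ← ENNReal.ofReal_mul (Real.exp_pos _).le, ← Real.exp_add]
        simp
    _ ≤ _ := by
        refine (mul_le_mul_right h1 _).trans ?_
        rw [mul_one]

/-! ### Bernstein bounds for sums over the visits to a pair -/

section Visits

variable [DecidableEq S] [DecidableEq A]

theorem sum_visits {n : ℕ} (D : Fin n → Episode S A H) (h : Fin H) (s : S) (a : A)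
    (f : Episode S A H → ℝ) :
    ∑ τ ∈ visits D h s a, f (D τ) = ∑ τ, (visitSet h s a).indicator f (D τ) := by
  classical
  rw [visits, Finset.sum_filter]
  refine Finset.sum_congr rfl fun τ _ => ?_
  by_cases hτ : D τ ∈ visitSet h s a
  · rw [Set.indicator_of_mem hτ]; exact if_pos hτ
  · rw [Set.indicator_of_notMem hτ]; exact if_neg hτ

theorem MDP.measure_visitSet (M : MDP S A H) (π : Policy S A H) (h : Fin H) (s : S) (a : A) :
    M.episodeLaw π (visitSet h s a) = ENNReal.ofReal (M.occ π h s a) := by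
  have h1 := congrArg (fun m => m Set.univ) (M.map_stepOutcome π h s a)
  simp only [Measure.smul_apply, measure_univ, smul_eq_mul, mul_one] at h1
  rw [Measure.map_apply (measurable_stepOutcome h) MeasurableSet.univ] at h1
  simpa using h1

theorem MDP.integral_visit (M : MDP S A H) (π : Policy S A H) (h : Fin H) (s : S) (a : A)
    {g : ℝ × S → ℝ} (hg : Measurable g) :
    ∫ ω, (visitSet h s a).indicator (fun ω => g (stepOutcome h ω)) ω ∂M.episodeLaw π =
      M.occ π h s a * ∫ x, g x ∂M.stepLaw h s a := by
  rw [integral_indicator (measurableSet_visitSet h s a),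
    ← integral_map (measurable_stepOutcome h).aemeasurable hg.aestronglyMeasurable,
    M.map_stepOutcome, integral_smul_measure, ENNReal.toReal_ofReal (M.occ_nonneg π h s a),
    smul_eq_mul]

theorem MDP.ae_visit (M : MDP S A H) (π : Policy S A H) (h : Fin H) (s : S) (a : A)
    {p : ℝ × S → Prop} (hp : ∀ᵐ x ∂M.stepLaw h s a, p x) :
    ∀ᵐ ω ∂M.episodeLaw π, ω ∈ visitSet h s a → p (stepOutcome h ω) := by
  rw [← ae_restrict_iff' (measurableSet_visitSet h s a)]
  refine ae_of_ae_map (measurable_stepOutcome h).aemeasurable ?_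
  rw [M.map_stepOutcome]
  exact Measure.ae_smul_measure hp _

/-- Bernstein's inequality for a centered function of the reward and the next state, summed over
the visits to `(s, a)` at time `h`. -/
theorem MDP.visit_bernstein (M : MDP S A H) (π : Policy S A H) (h : Fin H) (s : S) (a : A)
    {g : ℝ × S → ℝ} (hg : Measurable g) {b v t : ℝ} (hb : 0 < b) (ht : 0 ≤ t)
    (hbound : ∀ᵐ x ∂M.stepLaw h s a, |g x| ≤ b) (hmean : ∫ x, g x ∂M.stepLaw h s a = 0)
    (hvar : ∫ x, g x ^ 2 ∂M.stepLaw h s a ≤ v) (n : ℕ) :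
    M.dataLaw π n {D | √(2 * (n * (M.occ π h s a * v)) * t) + 3 * b * t <
      ∑ τ ∈ visits D h s a, g (stepOutcome h (D τ))} ≤ ENNReal.ofReal (Real.exp (-t)) := by
  have hsq : ∀ ω : Episode S A H, (visitSet h s a).indicator (fun ω => g (stepOutcome h ω)) ω ^ 2 =
      (visitSet h s a).indicator (fun ω => (fun x => g x ^ 2) (stepOutcome h ω)) ω := by
    intro ω
    by_cases hω : ω ∈ visitSet h s a
    · simp only [Set.indicator_of_mem hω]
    · simp only [Set.indicator_of_notMem hω]; norm_num
  have := bernstein_pi (M.episodeLaw π)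
    (X := (visitSet h s a).indicator fun ω => g (stepOutcome h ω))
    ((hg.comp (measurable_stepOutcome h)).indicator (measurableSet_visitSet h s a)) hb
    (v := M.occ π h s a * v) ht
    (by
      filter_upwards [M.ae_visit π h s a hbound] with ω hω
      by_cases hmem : ω ∈ visitSet h s a
      · rw [Set.indicator_of_mem hmem]; exact hω hmem
      · rw [Set.indicator_of_notMem hmem, abs_zero]; exact hb.le)
    (by rw [M.integral_visit π h s a hg, hmean, mul_zero])
    (by
      simp only [hsq]
      rw [M.integral_visit π h s a (hg.pow_const 2)]
      exact mul_le_mul_of_nonneg_left hvar (M.occ_nonneg π h s a)) n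
  have hsum := fun D : Fin n → Episode S A H => sum_visits D h s a fun ω => g (stepOutcome h ω)
  simp only [hsum]
  exact this

theorem MDP.count_concentration (M : MDP S A H) (π : Policy S A H) (h : Fin H) (s : S) (a : A)
    {t : ℝ} (ht : 0 ≤ t) (n : ℕ) :
    M.dataLaw π n {D | √(2 * (n * M.occ π h s a) * t) + 3 * t <
      |(count D h s a : ℝ) - n * M.occ π h s a|} ≤ 2 * ENNReal.ofReal (Real.exp (-t)) := by
  set p := M.occ π h s a with hp
  have hp0 : 0 ≤ p := M.occ_nonneg π h s a
  set B := visitSet (S := S) (A := A) h s a with hB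
  have hBm : MeasurableSet B := measurableSet_visitSet h s a
  have hBp : (M.episodeLaw π).real B = p := by
    rw [Measure.real, M.measure_visitSet, ENNReal.toReal_ofReal hp0]
  have hp1 : p ≤ 1 := by rw [← hBp]; exact measureReal_le_one
  have hI : ∫ ω, B.indicator (fun _ => (1 : ℝ)) ω ∂M.episodeLaw π = p := by
    rw [integral_indicator hBm]; simp [hBp]
  have hIm : Measurable (B.indicator fun _ => (1 : ℝ)) := measurable_const.indicator hBm
  have hI01 : ∀ ω, B.indicator (fun _ => (1 : ℝ)) ω = 0 ∨ B.indicator (fun _ => (1 : ℝ)) ω = 1 := by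
    intro ω
    by_cases hω : ω ∈ B
    · right; simp [hω]
    · left; simp [hω]
  have hIint : Integrable (B.indicator fun _ => (1 : ℝ)) (M.episodeLaw π) :=
    (integrable_const 1).indicator hBm
  have habs : ∀ ω, |B.indicator (fun _ => (1 : ℝ)) ω - p| ≤ 1 := by
    intro ω
    rcases hI01 ω with h | h <;> rw [h, abs_le] <;> constructor <;> linarith
  have hmean : ∫ ω, (B.indicator (fun _ => (1 : ℝ)) ω - p) ∂M.episodeLaw π = 0 := by
    rw [integral_sub hIint (integrable_const _), hI]; simp
  have hvar : ∫ ω, (B.indicator (fun _ => (1 : ℝ)) ω - p) ^ 2 ∂M.episodeLaw π ≤ p := by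
    have : ∀ ω, (B.indicator (fun _ => (1 : ℝ)) ω - p) ^ 2 =
        (1 - 2 * p) * B.indicator (fun _ => (1 : ℝ)) ω + p ^ 2 := by
      intro ω
      rcases hI01 ω with h | h <;> rw [h] <;> ring
    simp only [this]
    rw [integral_add (hIint.const_mul _) (integrable_const _), integral_const_mul, hI]
    simp only [integral_const, probReal_univ, smul_eq_mul]
    nlinarith
  have h1 := bernstein_pi (M.episodeLaw π) (X := fun ω => B.indicator (fun _ => (1 : ℝ)) ω - p)
    (hIm.sub_const p) one_pos ht (Filter.Eventually.of_forall habs) hmean hvar n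
  have h2 := bernstein_pi (M.episodeLaw π) (X := fun ω => -(B.indicator (fun _ => (1 : ℝ)) ω - p))
    (hIm.sub_const p).neg one_pos ht
    (Filter.Eventually.of_forall fun ω => by rw [abs_neg]; exact habs ω)
    (by rw [integral_neg, hmean, neg_zero])
    (by simpa only [neg_sq] using hvar) n
  have hcount : ∀ D : Fin n → Episode S A H, (count D h s a : ℝ) =
      ∑ τ, B.indicator (fun _ => (1 : ℝ)) (D τ) := by
    intro D
    rw [← sum_visits D h s a fun _ => (1 : ℝ), count]
    simp
  rw [two_mul (ENNReal.ofReal _), MDP.dataLaw]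
  refine le_trans (measure_mono ?_) ((measure_union_le _ _).trans (add_le_add h1 h2))
  intro D hD
  have hD' : √(2 * (n * p) * t) + 3 * t < |(count D h s a : ℝ) - n * p| := hD
  rw [lt_abs] at hD'
  simp only [Set.mem_union, Set.mem_ofPred_eq, Finset.sum_neg_distrib, Finset.sum_sub_distrib,
    Finset.sum_const, Finset.card_univ, Fintype.card_fin, nsmul_eq_mul, mul_one, ← hcount]
  exact hD'

end Visits

end DataConcentration

/-! ### Value functions, performance difference, and the covered model -/

theorem backward_induction {H : ℕ} {P : ℕ → Prop} (hH : P H)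
    (step : ∀ h : Fin H, P (h + 1) → P h) : ∀ h ≤ H, P h := by
  intro h hh
  induction hh using Nat.decreasingInduction with
  | self => exact hH
  | of_succ k hk ih => exact step ⟨k, hk⟩ ih

section Values

variable {S A : Type*} [Fintype S] [Fintype A] {H : ℕ}

theorem simplex_sum_le {X : Type*} [Fintype X] (p : stdSimplex ℝ X) {f : X → ℝ} {c : ℝ}
    (hf : ∀ x, f x ≤ c) : ∑ x, p x * f x ≤ c := by
  calc ∑ x, p x * f x ≤ ∑ x, p x * c :=
        Finset.sum_le_sum fun x _ => mul_le_mul_of_nonneg_left (hf x) (simplex_nonneg p x)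
    _ = c := by rw [← Finset.sum_mul, simplex_sum, one_mul]

theorem le_simplex_sum {X : Type*} [Fintype X] (p : stdSimplex ℝ X) {f : X → ℝ} {c : ℝ}
    (hf : ∀ x, c ≤ f x) : c ≤ ∑ x, p x * f x := by
  calc c = ∑ x, p x * c := by rw [← Finset.sum_mul, simplex_sum, one_mul]
    _ ≤ _ := Finset.sum_le_sum fun x _ => mul_le_mul_of_nonneg_left (hf x) (simplex_nonneg p x)

theorem MDP.reward_mem (M : MDP S A H) (h : Fin H) (s : S) (a : A) :
    0 ≤ M.reward h s a ∧ M.reward h s a ≤ 1 := by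
  have := M.rewardLaw_prob h s a
  have hb := M.rewardLaw_bdd h s a
  refine ⟨integral_nonneg_of_ae (hb.mono fun x hx => hx.1), ?_⟩
  have h1 := integral_mono_of_nonneg (μ := M.rewardLaw h s a) (f := fun x : ℝ => x)
    (g := fun _ => (1 : ℝ)) (hb.mono fun x hx => hx.1) (integrable_const _)
    (hb.mono fun x hx => hx.2)
  exact h1.trans (by simp)

theorem MDP.backup_mono (M : MDP S A H) (h : Fin H) {V W : S → ℝ} (hVW : ∀ s, V s ≤ W s) (s : S)
    (a : A) : M.backup h V s a ≤ M.backup h W s a :=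
  add_le_add le_rfl (Finset.sum_le_sum fun z _ =>
    mul_le_mul_of_nonneg_left (hVW z) (simplex_nonneg _ z))

theorem MDP.backup_add_const (M : MDP S A H) (h : Fin H) (V : S → ℝ) (c : ℝ) (s : S) (a : A) :
    M.backup h (fun z => V z + c) s a = M.backup h V s a + c := by
  simp only [MDP.backup, mul_add, Finset.sum_add_distrib, ← Finset.sum_mul, simplex_sum, one_mul]
  ring

theorem MDP.backup_nonneg (M : MDP S A H) (h : Fin H) {V : S → ℝ} (hV : ∀ s, 0 ≤ V s) (s : S)
    (a : A) : 0 ≤ M.backup h V s a :=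
  add_nonneg (M.reward_mem h s a).1 (le_simplex_sum _ hV)

theorem MDP.backup_le (M : MDP S A H) (h : Fin H) {V : S → ℝ} (hV : ∀ s, V s ≤ H - (h + 1 : ℕ))
    (s : S) (a : A) : M.backup h V s a ≤ H - (h : ℕ) := by
  have h1 := simplex_sum_le (M.trans h s a) hV
  have h2 := (M.reward_mem h s a).2
  push_cast at h1
  unfold MDP.backup
  linarith

theorem MDP.value_step (M : MDP S A H) (π : Policy S A H) (h : Fin H) (s : S) :
    M.value π h s = ∑ a, π h s a * M.backup h (M.value π (h + 1)) s a := by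
  rw [MDP.value, dif_pos h.2]

theorem MDP.value_end (M : MDP S A H) (π : Policy S A H) : M.value π H = 0 := by
  rw [MDP.value, dif_neg (lt_irrefl H)]

theorem MDP.value_nonneg (M : MDP S A H) (π : Policy S A H) :
    ∀ h ≤ H, ∀ s, 0 ≤ M.value π h s :=
  backward_induction (fun s => by rw [M.value_end]; exact le_rfl) fun h ih s => by
    rw [M.value_step]
    exact le_simplex_sum _ (M.backup_nonneg h ih s)

theorem MDP.perf_nonneg (M : MDP S A H) (π : Policy S A H) : 0 ≤ M.perf π :=
  le_simplex_sum _ (M.value_nonneg π 0 (Nat.zero_le _))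

/-- The occupancy flow turns the expected `W` at the next state into the expected `W` at time `h +
1`, so the sum telescopes. `W` need not be a value function of `π`; later it is the data-dependent
estimate. -/
theorem MDP.sum_occ_backup_sub (M : MDP S A H) (π : Policy S A H) (W : ℕ → S → ℝ)
    (hW : W H = 0) :
    ∑ h : Fin H, ∑ s, ∑ a, M.occ π h s a * (M.backup h (W (h + 1)) s a - W h s) =
      (∑ h : Fin H, ∑ s, ∑ a, M.occ π h s a * M.reward h s a) - ∑ s, M.init s * W 0 s := by
  have h1 : ∀ h : Fin H, ∑ s, ∑ a, M.occ π h s a * (M.backup h (W (h + 1)) s a - W h s) =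
      (∑ s, ∑ a, M.occ π h s a * M.reward h s a) +
        ((∑ s, M.stateOcc π (h + 1) s * W (h + 1) s) - ∑ s, M.stateOcc π h s * W h s) := by
    intro h
    have h2 : ∑ s, M.stateOcc π (h + 1) s * W (h + 1) s =
        ∑ s, ∑ a, M.occ π h s a * ∑ z, M.trans h s a z * W (h + 1) z := by
      simp only [M.stateOcc_succ, Finset.sum_mul, Finset.mul_sum]
      rw [Finset.sum_comm]
      refine Finset.sum_congr rfl fun s _ => ?_
      rw [Finset.sum_comm]
      simp only [mul_assoc]
    have h3 : ∑ s, M.stateOcc π h s * W h s = ∑ s, ∑ a, M.occ π h s a * W h s := by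
      simp only [← M.sum_occ, Finset.sum_mul]
    rw [h2, h3]
    simp only [MDP.backup, mul_sub, mul_add, Finset.sum_add_distrib, Finset.sum_sub_distrib]
    ring
  have h4 : ∑ h : Fin H, ((∑ s, M.stateOcc π ((h : ℕ) + 1) s * W (h + 1) s) -
      ∑ s, M.stateOcc π h s * W h s) = - ∑ s, M.init s * W 0 s := by
    rw [Fin.sum_univ_eq_sum_range (fun h => (∑ s, M.stateOcc π (h + 1) s * W (h + 1) s) -
      ∑ s, M.stateOcc π h s * W h s) H, Finset.sum_range_sub (fun h => ∑ s, M.stateOcc π h s * W h s), hW]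
    simp [MDP.stateOcc]
  simp only [h1]
  rw [Finset.sum_add_distrib, h4]
  ring

theorem MDP.perf_eq_sum_occ (M : MDP S A H) (π : Policy S A H) :
    M.perf π = ∑ h : Fin H, ∑ s, ∑ a, M.occ π h s a * M.reward h s a := by
  have h1 := M.sum_occ_backup_sub π (M.value π) (M.value_end π)
  have h2 : ∑ h : Fin H, ∑ s, ∑ a, M.occ π h s a *
      (M.backup h (M.value π (h + 1)) s a - M.value π h s) = 0 := by
    refine Finset.sum_eq_zero fun h _ => Finset.sum_eq_zero fun s _ => ?_
    simp only [mul_sub, Finset.sum_sub_distrib, ← Finset.sum_mul, M.sum_occ, M.value_step]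
    simp only [MDP.occ, mul_assoc, ← Finset.mul_sum, sub_self]
  rw [h2] at h1
  unfold MDP.perf
  linarith

/-- The performance difference identity. -/
theorem MDP.perf_sub (M : MDP S A H) (π : Policy S A H) (W : ℕ → S → ℝ) (hW : W H = 0) :
    M.perf π - ∑ s, M.init s * W 0 s =
      ∑ h : Fin H, ∑ s, ∑ a, M.occ π h s a * (M.backup h (W (h + 1)) s a - W h s) := by
  rw [M.sum_occ_backup_sub π W hW, M.perf_eq_sum_occ]

variable [Nonempty A]

theorem MDP.optValue_step (M : MDP S A H) (h : Fin H) (s : S) :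
    M.optValue h s = Finset.univ.sup' Finset.univ_nonempty
      (fun a => M.backup h (M.optValue (h + 1)) s a) := by
  rw [MDP.optValue, dif_pos h.2]

theorem MDP.optValue_end (M : MDP S A H) : M.optValue H = 0 := by
  rw [MDP.optValue, dif_neg (lt_irrefl H)]

theorem MDP.backup_le_optValue (M : MDP S A H) (h : Fin H) (s : S) (a : A) :
    M.backup h (M.optValue (h + 1)) s a ≤ M.optValue h s := by
  rw [M.optValue_step]
  exact Finset.le_sup' (fun a => M.backup h (M.optValue (h + 1)) s a) (Finset.mem_univ a)

theorem MDP.optValue_le (M : MDP S A H) : ∀ h ≤ H, ∀ s, M.optValue h s ≤ (H : ℝ) - (h : ℕ) :=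
  backward_induction (fun s => by rw [M.optValue_end]; simp) fun h ih s => by
    rw [M.optValue_step]
    exact Finset.sup'_le _ _ fun a _ => M.backup_le h ih s a

theorem MDP.optPerf_le (M : MDP S A H) : M.optPerf ≤ H :=
  simplex_sum_le _ fun s => by simpa using M.optValue_le 0 (Nat.zero_le _) s

theorem MDP.value_le_optValue (M : MDP S A H) (π : Policy S A H) :
    ∀ h ≤ H, ∀ s, M.value π h s ≤ M.optValue h s :=
  backward_induction (fun s => by rw [M.optValue_end, M.value_end]) fun h ih s => by
    rw [M.value_step]
    exact simplex_sum_le _ fun a => (M.backup_mono h ih s a).trans (M.backup_le_optValue h s a)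

theorem MDP.perf_le_optPerf (M : MDP S A H) (π : Policy S A H) : M.perf π ≤ M.optPerf :=
  Finset.sum_le_sum fun s _ => mul_le_mul_of_nonneg_left
    (M.value_le_optValue π 0 (Nat.zero_le _) s) (simplex_nonneg _ s)

theorem MDP.exists_perf_eq_optPerf (M : MDP S A H) : ∃ π : Policy S A H, M.perf π = M.optPerf := by
  classical
  have hex : ∀ (h : Fin H) (s : S), ∃ a, M.optValue h s = M.backup h (M.optValue (h + 1)) s a := by
    intro h s
    obtain ⟨a, -, ha⟩ := Finset.exists_mem_eq_sup' (s := Finset.univ) Finset.univ_nonempty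
      (fun a => M.backup h (M.optValue (h + 1)) s a)
    exact ⟨a, by rw [M.optValue_step, ha]⟩
  choose g hg using hex
  let π : Policy S A H := fun h s => ⟨Pi.single (g h s) 1, single_mem_stdSimplex ℝ (g h s)⟩
  have hπ : ∀ h s a, π h s a = if a = g h s then 1 else 0 := by
    intro h s a
    exact Pi.single_apply (g h s) (1 : ℝ) a
  have hval : ∀ h ≤ H, M.value π h = M.optValue h :=
    backward_induction (by rw [M.optValue_end, M.value_end]) fun h ih => by
      funext s
      rw [M.value_step, ih, hg]
      simp [hπ]
  exact ⟨π, by rw [MDP.perf, MDP.optPerf, hval 0 (Nat.zero_le _)]⟩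

theorem MDP.IsOptimal.perf_eq {M : MDP S A H} {π : Policy S A H} (hπ : M.IsOptimal π) :
    M.perf π = M.optPerf := by
  obtain ⟨π', hπ'⟩ := M.exists_perf_eq_optPerf
  exact le_antisymm (M.perf_le_optPerf π) (hπ' ▸ hπ π')

/-- All Bellman gaps of `optValue` have one sign, and their occupancy-weighted sum is the regret of
`π`, which is zero. Optimality is global, so nothing can be said at pairs that `π` does not visit.
-/
theorem MDP.IsOptimal.backup_eq {M : MDP S A H} {π : Policy S A H} (hπ : M.IsOptimal π)
    {h : Fin H} {s : S} {a : A} (hocc : 0 < M.occ π h s a) :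
    M.backup h (M.optValue (h + 1)) s a = M.optValue h s := by
  have h0 := M.perf_sub π M.optValue M.optValue_end
  have hle : ∀ (h : Fin H) s a,
      0 ≤ -(M.occ π h s a * (M.backup h (M.optValue (h + 1)) s a - M.optValue h s)) := by
    intro h s a
    have := M.backup_le_optValue h s a
    have := M.occ_nonneg π h s a
    nlinarith
  have h1 : ∑ h : Fin H, ∑ s, ∑ a,
      -(M.occ π h s a * (M.backup h (M.optValue (h + 1)) s a - M.optValue h s)) = 0 := by
    simp only [Finset.sum_neg_distrib]
    rw [← h0, hπ.perf_eq, MDP.optPerf, sub_self, neg_zero]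
  rw [Finset.sum_eq_zero_iff_of_nonneg fun h _ =>
    Finset.sum_nonneg fun s _ => Finset.sum_nonneg fun a _ => hle h s a] at h1
  have h2 := h1 h (Finset.mem_univ h)
  rw [Finset.sum_eq_zero_iff_of_nonneg fun s _ => Finset.sum_nonneg fun a _ => hle h s a] at h2
  have h3 := h2 s (Finset.mem_univ s)
  rw [Finset.sum_eq_zero_iff_of_nonneg fun a _ => hle h s a] at h3
  have h4 := h3 a (Finset.mem_univ a)
  rw [neg_eq_zero, mul_eq_zero] at h4
  rcases h4 with h4 | h4
  · exact absurd h4 hocc.ne'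
  · linarith

/-- The Bellman backup at the pairs visited by `μ` with positive probability, zero elsewhere. -/
def MDP.coveredBackup (M : MDP S A H) (μ : Policy S A H) (h : Fin H) (V : S → ℝ) (s : S) (a : A) :
    ℝ :=
  open scoped Classical in if 0 < M.occ μ h s a then M.backup h V s a else 0

/-- The optimal value function of the part of the model covered by `μ`. -/
def MDP.coveredValue (M : MDP S A H) (μ : Policy S A H) (h : ℕ) : S → ℝ :=
  if hh : h < H then
    fun s => Finset.univ.sup' Finset.univ_nonempty
      (fun a => M.coveredBackup μ ⟨h, hh⟩ (M.coveredValue μ (h + 1)) s a)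
  else 0
termination_by H - h

theorem MDP.coveredBackup_of_pos (M : MDP S A H) (μ : Policy S A H) {h : Fin H} {s : S} {a : A}
    (hocc : 0 < M.occ μ h s a) (V : S → ℝ) : M.coveredBackup μ h V s a = M.backup h V s a :=
  if_pos hocc

theorem MDP.coveredBackup_of_not_pos (M : MDP S A H) (μ : Policy S A H) {h : Fin H} {s : S} {a : A}
    (hocc : ¬0 < M.occ μ h s a) (V : S → ℝ) : M.coveredBackup μ h V s a = 0 :=
  if_neg hocc

theorem MDP.coveredValue_step (M : MDP S A H) (μ : Policy S A H) (h : Fin H) (s : S) :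
    M.coveredValue μ h s = Finset.univ.sup' Finset.univ_nonempty
      (fun a => M.coveredBackup μ h (M.coveredValue μ (h + 1)) s a) := by
  rw [MDP.coveredValue, dif_pos h.2]

theorem MDP.coveredValue_end (M : MDP S A H) (μ : Policy S A H) : M.coveredValue μ H = 0 := by
  rw [MDP.coveredValue, dif_neg (lt_irrefl H)]

theorem MDP.coveredBackup_le_coveredValue (M : MDP S A H) (μ : Policy S A H) (h : Fin H) (s : S)
    (a : A) : M.coveredBackup μ h (M.coveredValue μ (h + 1)) s a ≤ M.coveredValue μ h s := by
  rw [M.coveredValue_step]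
  exact Finset.le_sup' (fun a => M.coveredBackup μ h (M.coveredValue μ (h + 1)) s a)
    (Finset.mem_univ a)

theorem MDP.coveredBackup_mem (M : MDP S A H) (μ : Policy S A H) (h : Fin H) {V : S → ℝ}
    (hV : ∀ s, 0 ≤ V s ∧ V s ≤ (H : ℝ) - (h + 1 : ℕ)) (s : S) (a : A) :
    0 ≤ M.coveredBackup μ h V s a ∧ M.coveredBackup μ h V s a ≤ (H : ℝ) - (h : ℕ) := by
  unfold MDP.coveredBackup
  split_ifs
  · exact ⟨M.backup_nonneg h (fun s => (hV s).1) s a, M.backup_le h (fun s => (hV s).2) s a⟩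
  · have : ((h : ℕ) : ℝ) ≤ H := by exact_mod_cast h.2.le
    exact ⟨le_rfl, by linarith⟩

theorem MDP.coveredValue_mem (M : MDP S A H) (μ : Policy S A H) :
    ∀ h ≤ H, ∀ s, 0 ≤ M.coveredValue μ h s ∧ M.coveredValue μ h s ≤ (H : ℝ) - (h : ℕ) :=
  backward_induction (fun s => by rw [M.coveredValue_end]; simp) fun h ih s => by
    obtain ⟨a₀⟩ := ‹Nonempty A›
    refine ⟨(M.coveredBackup_mem μ h ih s a₀).1.trans
      (M.coveredBackup_le_coveredValue μ h s a₀), ?_⟩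
    rw [M.coveredValue_step]
    exact Finset.sup'_le _ _ fun a _ => (M.coveredBackup_mem μ h ih s a).2

theorem MDP.coveredValue_le_optValue (M : MDP S A H) (μ : Policy S A H) :
    ∀ h ≤ H, ∀ s, M.coveredValue μ h s ≤ M.optValue h s := by
  have hnn : ∀ h ≤ H, ∀ s, 0 ≤ M.optValue h s := fun h hh s => by
    obtain ⟨π, -⟩ := M.exists_perf_eq_optPerf
    exact (M.value_nonneg π h hh s).trans (M.value_le_optValue π h hh s)
  refine backward_induction (fun s => by rw [M.coveredValue_end, M.optValue_end]) fun h ih s => ?_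
  rw [M.coveredValue_step]
  refine Finset.sup'_le _ _ fun a _ => ?_
  unfold MDP.coveredBackup
  split_ifs
  · exact (M.backup_mono h ih s a).trans (M.backup_le_optValue h s a)
  · exact hnn h h.2.le s

/-- An optimal policy covered by `μ` only visits states where the covered value is optimal. -/
theorem MDP.IsOptimal.coveredValue_eq {M : MDP S A H} {π μ : Policy S A H} (hπ : M.IsOptimal π)
    (hcov : ∀ h s a, 0 < M.occ π h s a → 0 < M.occ μ h s a) :
    ∀ h ≤ H, ∀ s, 0 < M.stateOcc π h s → M.coveredValue μ h s = M.optValue h s := by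
  refine backward_induction (fun s _ => by rw [M.coveredValue_end, M.optValue_end])
    fun h ih s hs => ?_
  refine le_antisymm (M.coveredValue_le_optValue μ h h.2.le s) ?_
  have hex : ∃ a, 0 < M.occ π h s a := by
    by_contra! hcon
    have : M.stateOcc π h s ≤ 0 := by
      rw [← M.sum_occ]; exact Finset.sum_nonpos fun a _ => hcon a
    linarith
  obtain ⟨a, ha⟩ := hex
  rw [← hπ.backup_eq ha]
  refine le_trans ?_ (M.coveredBackup_le_coveredValue μ h s a)
  rw [M.coveredBackup_of_pos μ (hcov h s a ha)]
  refine add_le_add le_rfl (Finset.sum_le_sum fun z _ => ?_)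
  rcases (simplex_nonneg (M.trans h s a) z).eq_or_lt with h0 | h0
  · rw [← h0]; simp
  · rw [ih z ((mul_pos ha h0).trans_le (M.occ_mul_trans_le π h s a z))]

/-- The variance sees only next states of positive transition probability. `π` visits these, and
there the covered and the optimal values coincide. This brings the optimal value function back into
the final bound. -/
theorem MDP.IsOptimal.bellmanVar_coveredValue_eq {M : MDP S A H} {π μ : Policy S A H}
    (hπ : M.IsOptimal π) (hcov : ∀ h s a, 0 < M.occ π h s a → 0 < M.occ μ h s a)
    {h : Fin H} {s : S} {a : A} (hocc : 0 < M.occ π h s a) :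
    M.bellmanVar h (M.coveredValue μ (h + 1)) s a = M.bellmanVar h (M.optValue (h + 1)) s a := by
  have key : ∀ z, M.trans h s a z ≠ 0 →
      M.coveredValue μ (h + 1) z = M.optValue (h + 1) z := by
    intro z hz
    have h0 : 0 < M.trans h s a z := lt_of_le_of_ne (simplex_nonneg _ z) (Ne.symm hz)
    exact hπ.coveredValue_eq hcov (h + 1) h.2 z
      ((mul_pos hocc h0).trans_le (M.occ_mul_trans_le π h s a z))
  have hb : M.backup h (M.coveredValue μ (h + 1)) s a = M.backup h (M.optValue (h + 1)) s a := by
    unfold MDP.backup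
    congr 1
    refine Finset.sum_congr rfl fun z _ => ?_
    by_cases hz : M.trans h s a z = 0
    · rw [hz]; simp
    · rw [key z hz]
  unfold MDP.bellmanVar
  congr 1
  funext x
  refine Finset.sum_congr rfl fun z _ => ?_
  by_cases hz : M.trans h s a z = 0
  · rw [hz]; simp
  · rw [key z hz, hb]

end Values

/-! ### The smallest positive occupancy -/

section MinOcc

variable {S A : Type*} [Fintype S] [Fintype A] {H : ℕ}

theorem MDP.minOcc_le (M : MDP S A H) (μ : Policy S A H) {h : Fin H} {s : S} {a : A}
    (hocc : 0 < M.occ μ h s a) : M.minOcc μ ≤ M.occ μ h s a :=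
  csInf_le ⟨0, fun _ hx => hx.1.le⟩ ⟨hocc, h, s, a, rfl⟩

theorem MDP.minOcc_pos (M : MDP S A H) (μ : Policy S A H) (hH : 1 ≤ H) : 0 < M.minOcc μ := by
  have hfin : {x : ℝ | 0 < x ∧ ∃ h s a, x = M.occ μ h s a}.Finite := by
    refine (Set.finite_range fun p : Fin H × S × A => M.occ μ p.1 p.2.1 p.2.2).subset ?_
    rintro x ⟨-, h, s, a, rfl⟩
    exact ⟨(h, s, a), rfl⟩
  have hne : {x : ℝ | 0 < x ∧ ∃ h s a, x = M.occ μ h s a}.Nonempty := by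
    by_contra hcon
    rw [Set.not_nonempty_iff_eq_empty] at hcon
    have hle : ∀ s a, M.occ μ ⟨0, hH⟩ s a ≤ 0 := by
      intro s a
      by_contra! hpos
      have : M.occ μ ⟨0, hH⟩ s a ∈ {x : ℝ | 0 < x ∧ ∃ h s a, x = M.occ μ h s a} :=
        ⟨hpos, _, s, a, rfl⟩
      rw [hcon] at this
      exact this
    have h1 : ∑ s, M.init s = 1 := simplex_sum _
    have h2 : ∀ s, M.init s = ∑ a, M.occ μ ⟨0, hH⟩ s a := fun s =>
      (M.sum_occ μ ⟨0, hH⟩ s).symm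
    have h3 : ∑ s, M.init s ≤ 0 := Finset.sum_nonpos fun s _ => by
      rw [h2]; exact Finset.sum_nonpos fun a _ => hle s a
    linarith
  exact (hne.csInf_mem hfin).1

end MinOcc

/-! ### Sample means and variances over finite sets -/

section SampleVariance

variable {ι : Type*}

/-- The average of `x` over the finite set `T`. -/
def sampleMean (T : Finset ι) (x : ι → ℝ) : ℝ := (∑ i ∈ T, x i) / T.card

/-- The variance of `x` over the finite set `T`. -/
def sampleVar (T : Finset ι) (x : ι → ℝ) : ℝ :=
  sampleMean T fun i => (x i - sampleMean T x) ^ 2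

theorem sampleMean_add (T : Finset ι) (x y : ι → ℝ) :
    sampleMean T (fun i => x i + y i) = sampleMean T x + sampleMean T y := by
  simp only [sampleMean, Finset.sum_add_distrib, add_div]

theorem sampleMean_mul_left (T : Finset ι) (c : ℝ) (x : ι → ℝ) :
    sampleMean T (fun i => c * x i) = c * sampleMean T x := by
  simp only [sampleMean, ← Finset.mul_sum, mul_div_assoc]

theorem sampleMean_const {T : Finset ι} (hT : T.Nonempty) (c : ℝ) :
    sampleMean T (fun _ => c) = c := by
  have : (T.card : ℝ) ≠ 0 := by exact_mod_cast hT.card_pos.ne'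
  simp only [sampleMean, Finset.sum_const, nsmul_eq_mul]
  field_simp

theorem sampleMean_mono {T : Finset ι} {x y : ι → ℝ} (h : ∀ i ∈ T, x i ≤ y i) :
    sampleMean T x ≤ sampleMean T y :=
  div_le_div_of_nonneg_right (Finset.sum_le_sum h) (Nat.cast_nonneg _)

theorem sampleMean_sub_const {T : Finset ι} (hT : T.Nonempty) (x : ι → ℝ) (c : ℝ) :
    sampleMean T (fun i => x i - c) = sampleMean T x - c := by
  simp only [sub_eq_add_neg]
  rw [sampleMean_add, sampleMean_const hT]

/-- Used with `c` the true mean: the error of the sample variance then splits into a second moment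
deviation and the square of a mean deviation. -/
theorem sampleVar_eq {T : Finset ι} (hT : T.Nonempty) (x : ι → ℝ) (c : ℝ) :
    sampleVar T x = sampleMean T (fun i => (x i - c) ^ 2) - (sampleMean T fun i => x i - c) ^ 2 := by
  have h1 : ∀ i, (x i - sampleMean T x) ^ 2 =
      (x i - c) ^ 2 + (-(2 * (sampleMean T x - c)) * (x i - c) + (sampleMean T x - c) ^ 2) := by
    intro i; ring
  unfold sampleVar
  simp only [h1]
  rw [sampleMean_add, sampleMean_add, sampleMean_mul_left, sampleMean_const hT,
    sampleMean_sub_const hT]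
  ring

theorem sampleVar_nonneg (T : Finset ι) (x : ι → ℝ) : 0 ≤ sampleVar T x :=
  div_nonneg (Finset.sum_nonneg fun _ _ => sq_nonneg _) (Nat.cast_nonneg _)

theorem sampleVar_le_sq {T : Finset ι} (hT : T.Nonempty) {x : ι → ℝ} {c b : ℝ}
    (hx : ∀ i ∈ T, |x i - c| ≤ b) : sampleVar T x ≤ b ^ 2 := by
  rw [sampleVar_eq hT x c]
  have : sampleMean T (fun i => (x i - c) ^ 2) ≤ b ^ 2 := by
    rw [← sampleMean_const hT (b ^ 2)]
    exact sampleMean_mono fun i hi => by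
      rw [← sq_abs]; exact pow_le_pow_left₀ (abs_nonneg _) (hx i hi) 2
  nlinarith [sq_nonneg (sampleMean T fun i => x i - c)]

/-- The triangle inequality for the standard deviation, a seminorm dominated by the sup norm. It
holds for every perturbation, so a data-dependent one is allowed. -/
theorem sampleVar_add_le {T : Finset ι} (hT : T.Nonempty) {x w : ι → ℝ} {ε : ℝ} (hε : 0 ≤ ε)
    (hw : ∀ i ∈ T, |w i| ≤ ε) :
    sampleVar T (fun i => x i + w i) ≤ (√(sampleVar T x) + ε) ^ 2 := by
  set X : ι → ℝ := fun i => x i - sampleMean T x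
  set m := sampleMean T x
  have hX : sampleMean T (fun i => X i ^ 2) = sampleVar T x := rfl
  have hX0 : sampleMean T X = 0 := by
    simp only [X]; rw [sampleMean_sub_const hT, sub_self]
  have hle : sampleVar T (fun i => x i + w i) ≤
      sampleMean T fun i => (X i + w i) ^ 2 := by
    rw [sampleVar_eq hT _ m]
    have : ∀ i, x i + w i - m = X i + w i := fun i => by simp only [X]; ring
    simp only [this]
    nlinarith [sq_nonneg (sampleMean T fun i => X i + w i)]
  have hW : sampleMean T (fun i => w i ^ 2) ≤ ε ^ 2 := by
    rw [← sampleMean_const hT (ε ^ 2)]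
    exact sampleMean_mono fun i hi => by
      rw [← sq_abs]; exact pow_le_pow_left₀ (abs_nonneg _) (hw i hi) 2
  have hcs : (sampleMean T fun i => X i * w i) ^ 2 ≤
      sampleMean T (fun i => X i ^ 2) * sampleMean T (fun i => w i ^ 2) := by
    unfold sampleMean
    rw [div_pow, div_mul_div_comm, ← sq]
    exact div_le_div_of_nonneg_right (Finset.sum_mul_sq_le_sq_mul_sq T X w) (sq_nonneg _)
  have hV := sampleVar_nonneg T x
  have hcov : sampleMean T (fun i => X i * w i) ≤ √(sampleVar T x) * ε := by
    refine (le_abs_self _).trans (abs_le_of_sq_le_sq ?_ (by positivity))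
    rw [mul_pow, Real.sq_sqrt hV]
    refine hcs.trans ?_
    rw [hX]
    exact mul_le_mul_of_nonneg_left hW hV
  have hexp : sampleMean T (fun i => (X i + w i) ^ 2) =
      sampleVar T x + (2 * sampleMean T (fun i => X i * w i) + sampleMean T fun i => w i ^ 2) := by
    rw [← hX, ← sampleMean_mul_left, ← sampleMean_add, ← sampleMean_add]
    congr 1
    funext i
    ring
  refine hle.trans ?_
  rw [hexp, add_sq, Real.sq_sqrt hV]
  nlinarith

/-- The summand `a` stands for the reward variance, which the perturbation of the value function
leaves unchanged. -/
theorem sqrt_add_sampleVar_add_le {T : Finset ι} (hT : T.Nonempty) {x w : ι → ℝ} {ε a : ℝ}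
    (ha : 0 ≤ a) (hε : 0 ≤ ε) (hw : ∀ i ∈ T, |w i| ≤ ε) :
    √(a + sampleVar T (fun i => x i + w i)) ≤ √(a + sampleVar T x) + ε := by
  have hV := sampleVar_nonneg T x
  rw [Real.sqrt_le_left (by positivity)]
  have h1 := sampleVar_add_le hT (x := x) hε hw
  have h2 : √(sampleVar T x) ≤ √(a + sampleVar T x) := Real.sqrt_le_sqrt (by linarith)
  rw [add_sq, Real.sq_sqrt (by positivity)]
  rw [add_sq, Real.sq_sqrt hV] at h1
  nlinarith

end SampleVariance

/-! ### Structure of the algorithm's estimates -/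

section Algorithm

variable {S A : Type*} [Fintype S] [Fintype A] [DecidableEq S] [DecidableEq A] {H n : ℕ}

theorem visits_nonempty {D : Fin n → Episode S A H} {h : Fin H} {s : S} {a : A}
    (hc : count D h s a ≠ 0) : (visits D h s a).Nonempty :=
  Finset.card_pos.1 (Nat.pos_of_ne_zero hc)

theorem sum_empTrans_mul {D : Fin n → Episode S A H} {h : Fin H} {s : S} {a : A}
    (hc : count D h s a ≠ 0) (f : S → ℝ) :
    ∑ z, empTrans D h s a z * f z =
      sampleMean (visits D h s a) fun τ => f ((D τ).1 h.succ) := by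
  simp only [empTrans, if_neg hc, sampleMean]
  rw [← count]
  simp only [div_mul_eq_mul_div, ← Finset.sum_div]
  congr 1
  rw [← Finset.sum_fiberwise (visits D h s a) (fun τ => (D τ).1 h.succ)]
  refine Finset.sum_congr rfl fun z _ => ?_
  rw [Finset.sum_congr rfl (g := fun _ => f z)
    (fun τ hτ => by rw [(Finset.mem_filter.1 hτ).2])]
  rw [Finset.sum_const, nsmul_eq_mul]

theorem empBackup_eq {D : Fin n → Episode S A H} {h : Fin H} {s : S} {a : A}
    (hc : count D h s a ≠ 0) (V : S → ℝ) :
    empBackup D h V s a =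
      sampleMean (visits D h s a) fun τ => (D τ).2.2 h + V ((D τ).1 h.succ) := by
  rw [empBackup, sum_empTrans_mul hc, sampleMean_add, empReward, if_neg hc]
  rfl

/-- The empirical reward and next state are drawn independently, so the cross term vanishes and the
two variances can be estimated separately. -/
theorem empVar_eq {D : Fin n → Episode S A H} {h : Fin H} {s : S} {a : A}
    (hc : count D h s a ≠ 0) (V : S → ℝ) :
    empVar D h V s a = sampleVar (visits D h s a) (fun τ => (D τ).2.2 h) +
      sampleVar (visits D h s a) (fun τ => V ((D τ).1 h.succ)) := by
  have hT := visits_nonempty hc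
  set T := visits D h s a
  set r := sampleMean T fun τ => (D τ).2.2 h
  set m := sampleMean T fun τ => V ((D τ).1 h.succ)
  have hb : empBackup D h V s a = r + m := by rw [empBackup_eq hc, sampleMean_add]
  have h1 : ∀ τ, ∑ z, empTrans D h s a z * ((D τ).2.2 h + V z - empBackup D h V s a) ^ 2 =
      ((D τ).2.2 h - r) ^ 2 + sampleVar T fun τ => V ((D τ).1 h.succ) := by
    intro τ
    rw [sum_empTrans_mul hc fun z => ((D τ).2.2 h + V z - empBackup D h V s a) ^ 2, hb]
    have h2 : ∀ σ, ((D τ).2.2 h + V ((D σ).1 h.succ) - (r + m)) ^ 2 =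
        (V ((D σ).1 h.succ) - m) ^ 2 + (2 * ((D τ).2.2 h - r) * (V ((D σ).1 h.succ) - m) +
          ((D τ).2.2 h - r) ^ 2) := fun σ => by ring
    simp only [h2]
    rw [sampleMean_add, sampleMean_add, sampleMean_mul_left, sampleMean_const hT,
      sampleMean_sub_const hT, sub_self, sampleVar]
    ring
  unfold empVar
  simp only [h1]
  change sampleMean T (fun τ => ((D τ).2.2 h - r) ^ 2 + _) = _
  rw [sampleMean_add, sampleMean_const hT]
  rfl

variable [Nonempty A]

/-- The value estimates of pessimistic value iteration, with greedy maximization at each step. -/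
def pessValue (C ι : ℝ) (D : Fin n → Episode S A H) (h : ℕ) : S → ℝ :=
  if hh : h < H then
    fun s => Finset.univ.sup' Finset.univ_nonempty
      (fun a => pessQ C ι D ⟨h, hh⟩ (pessValue C ι D (h + 1)) s a)
  else 0
termination_by H - h

theorem pessValue_step (C ι : ℝ) (D : Fin n → Episode S A H) (h : Fin H) (s : S) :
    pessValue C ι D h s = Finset.univ.sup' Finset.univ_nonempty
      (fun a => pessQ C ι D h (pessValue C ι D (h + 1)) s a) := by
  rw [pessValue, dif_pos h.2]

theorem pessValue_end (C ι : ℝ) (D : Fin n → Episode S A H) : pessValue C ι D H = 0 := by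
  rw [pessValue, dif_neg (lt_irrefl H)]

theorem pessQ_le_pessValue (C ι : ℝ) (D : Fin n → Episode S A H) (h : Fin H) (s : S) (a : A) :
    pessQ C ι D h (pessValue C ι D (h + 1)) s a ≤ pessValue C ι D h s := by
  rw [pessValue_step]
  exact Finset.le_sup' (fun a => pessQ C ι D h (pessValue C ι D (h + 1)) s a) (Finset.mem_univ a)

theorem pessQ_mem (C ι : ℝ) (D : Fin n → Episode S A H) (h : Fin H) (V : S → ℝ) (s : S) (a : A) :
    0 ≤ pessQ C ι D h V s a ∧ pessQ C ι D h V s a ≤ (H : ℝ) - (h : ℕ) := by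
  have : ((h : ℕ) : ℝ) ≤ H := by exact_mod_cast h.2.le
  exact ⟨le_max_right _ _, max_le (min_le_right _ _) (by linarith)⟩

theorem pessValue_mem (C ι : ℝ) (D : Fin n → Episode S A H) :
    ∀ h ≤ H, ∀ s, 0 ≤ pessValue C ι D h s ∧ pessValue C ι D h s ≤ (H : ℝ) - (h : ℕ) :=
  backward_induction (fun s => by rw [pessValue_end]; simp) fun h _ s => by
    obtain ⟨a₀⟩ := ‹Nonempty A›
    refine ⟨(pessQ_mem C ι D h _ s a₀).1.trans (pessQ_le_pessValue C ι D h s a₀), ?_⟩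
    rw [pessValue_step]
    exact Finset.sup'_le _ _ fun a _ => (pessQ_mem C ι D h _ s a).2

/-- A linear functional on the simplex attains its maximum at a vertex, so every way of breaking
ties yields the same value estimates. Hence one event serves all outputs. -/
theorem IsAPVIOutput.pessV_eq {C δ : ℝ} {D : Fin n → Episode S A H} {π : Policy S A H}
    (hπ : IsAPVIOutput C δ D π) :
    ∀ h ≤ H, pessV C (logTerm S A H δ) D π h = pessValue C (logTerm S A H δ) D h := by
  refine backward_induction ?_ fun h ih => ?_
  · rw [pessValue_end, pessV, dif_neg (lt_irrefl H)]
  · funext s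
    have hstep : pessV C (logTerm S A H δ) D π h s = ∑ a, π h s a *
        pessQ C (logTerm S A H δ) D h (pessV C (logTerm S A H δ) D π (h + 1)) s a := by
      rw [pessV, dif_pos h.2]
    refine le_antisymm ?_ ?_
    · rw [hstep, ih]
      exact simplex_sum_le _ fun a => pessQ_le_pessValue C _ D h s a
    · rw [pessValue_step]
      refine Finset.sup'_le _ _ fun a _ => ?_
      rw [hstep]
      refine le_trans (le_of_eq ?_) (hπ h s ⟨Pi.single a 1, single_mem_stdSimplex ℝ a⟩)
      have hpt : ∀ b, (⟨Pi.single a 1, single_mem_stdSimplex ℝ a⟩ : stdSimplex ℝ A) b =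
          if b = a then 1 else 0 := fun b => Pi.single_apply a (1 : ℝ) b
      simp only [hpt, ih]
      simp

theorem pessValue_congr {C ι : ℝ} {D D' : Fin n → Episode S A H} {t : ℕ} (ht : t ≤ H)
    (hs : ∀ τ (j : Fin (H + 1)), t ≤ j → (D τ).1 j = (D' τ).1 j)
    (ha : ∀ τ (j : Fin H), t ≤ j → (D τ).2.1 j = (D' τ).2.1 j)
    (hr : ∀ τ (j : Fin H), t ≤ j → (D τ).2.2 j = (D' τ).2.2 j) :
    pessValue C ι D t = pessValue C ι D' t := by
  have key : ∀ h ≤ H, t ≤ h → pessValue C ι D h = pessValue C ι D' h := by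
    refine backward_induction (fun _ => by rw [pessValue_end, pessValue_end]) fun h ih hth => ?_
    funext s
    rw [pessValue_step, pessValue_step, ih (by omega)]
    congr 1
    funext a
    have h1 : ∀ τ, (D τ).1 h.castSucc = (D' τ).1 h.castSucc := fun τ => hs τ _ (by simpa using hth)
    have h2 : ∀ τ, (D τ).1 h.succ = (D' τ).1 h.succ := fun τ => hs τ _ (by simp; omega)
    have h3 : ∀ τ, (D τ).2.1 h = (D' τ).2.1 h := fun τ => ha τ _ hth
    have h4 : ∀ τ, (D τ).2.2 h = (D' τ).2.2 h := fun τ => hr τ _ hth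
    have hv : visits D h s a = visits D' h s a := by simp only [visits, h1, h3]
    have hcnt : count D h s a = count D' h s a := by rw [count, hv, count]
    have ht' : empTrans D h s a = empTrans D' h s a := by
      funext z; simp only [empTrans, hcnt, hv, h2]
    have hrw : empReward D h s a = empReward D' h s a := by simp only [empReward, hcnt, hv, h4]
    simp only [pessQ, empBackup, bonus, empVar, hcnt, hv, ht', hrw, h4]
  exact key t ht le_rfl

/-- The recursion runs backwards: the estimate at `h + 1` reads the states from time `h + 1` on and
the later actions and rewards, but nothing of step `h`. This is the form of independence that
`visit_future_concentration` needs. -/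
theorem pessValue_future [Nonempty S] (C ι : ℝ) (D : Fin n → Episode S A H) (h : Fin H) :
    pessValue C ι D (h + 1) = pessValue C ι (fun τ => future h (D τ)) (h + 1) := by
  refine pessValue_congr h.2 (fun τ j hj => ?_) (fun τ j hj => ?_) (fun τ j hj => ?_)
  all_goals
    exact (if_pos (Nat.lt_of_succ_le hj)).symm

/-! ### Measurability of the estimates as functions of the data -/

section Measurability

variable [MeasurableSpace S] [MeasurableSpace A] [MeasurableSingletonClass S]
  [MeasurableSingletonClass A]

theorem measurable_sum_visits [Nonempty S] (h : Fin H) (s : S) (a : A)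
    {f : Fin n → (Fin n → Episode S A H) → ℝ} (hf : ∀ τ, Measurable (f τ)) :
    Measurable fun D : Fin n → Episode S A H => ∑ τ ∈ visits D h s a, f τ D := by
  simp only [visits, Finset.sum_filter]
  refine Finset.measurable_sum _ fun τ _ => Measurable.ite ?_ (hf τ) measurable_const
  have hm : MeasurableSet ((fun D : Fin n → Episode S A H => D τ) ⁻¹' visitSet h s a) :=
    measurable_pi_apply τ (measurableSet_visitSet h s a)
  exact hm

theorem measurable_count [Nonempty S] (h : Fin H) (s : S) (a : A) :
    Measurable fun D : Fin n → Episode S A H => (count D h s a : ℝ) := by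
  have := measurable_sum_visits (n := n) h s a (f := fun _ _ => (1 : ℝ))
    (fun _ => measurable_const)
  simpa [count] using this

theorem measurable_ite_count [Nonempty S] (h : Fin H) (s : S) (a : A)
    {f g : (Fin n → Episode S A H) → ℝ} (hf : Measurable f) (hg : Measurable g) :
    Measurable fun D : Fin n → Episode S A H => if count D h s a = 0 then f D else g D := by
  refine Measurable.ite ?_ hf hg
  have h1 := measurable_count (n := n) h s a (measurableSet_singleton (0 : ℝ))
  have h2 : {D : Fin n → Episode S A H | count D h s a = 0} =
      (fun D : Fin n → Episode S A H => (count D h s a : ℝ)) ⁻¹' {0} := by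
    ext D
    simp
  rw [h2]
  exact h1

theorem measurable_pessQ [Nonempty S] (C ι : ℝ) (h : Fin H)
    {V : (Fin n → Episode S A H) → S → ℝ} (hV : ∀ z, Measurable fun D => V D z) (s : S) (a : A) :
    Measurable fun D => pessQ C ι D h (V D) s a := by
  have hc := measurable_count (n := n) h s a
  have hr : ∀ τ : Fin n, Measurable fun D : Fin n → Episode S A H => (D τ).2.2 h :=
    fun τ => by fun_prop
  have ht : ∀ z, Measurable fun D : Fin n → Episode S A H => empTrans D h s a z := by
    intro z
    unfold empTrans
    refine measurable_ite_count h s a measurable_const (Measurable.div ?_ hc)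
    have h1 : ∀ D : Fin n → Episode S A H,
        (((visits D h s a).filter fun τ => (D τ).1 h.succ = z).card : ℝ) =
        ∑ τ ∈ visits D h s a, if (D τ).1 h.succ = z then 1 else 0 := by
      intro D
      rw [Finset.card_filter]
      push_cast
      rfl
    simp only [h1]
    refine measurable_sum_visits h s a fun τ => Measurable.ite ?_ measurable_const measurable_const
    have : Measurable fun D : Fin n → Episode S A H => (D τ).1 h.succ := by fun_prop
    exact this (measurableSet_singleton z)
  have hrw : Measurable fun D : Fin n → Episode S A H => empReward D h s a := by
    unfold empReward
    exact measurable_ite_count h s a measurable_const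
      ((measurable_sum_visits h s a hr).div hc)
  have hb : Measurable fun D : Fin n → Episode S A H => empBackup D h (V D) s a := by
    unfold empBackup
    exact hrw.add (Finset.measurable_sum _ fun z _ => (ht z).mul (hV z))
  have hv : Measurable fun D : Fin n → Episode S A H => empVar D h (V D) s a := by
    unfold empVar
    refine (measurable_sum_visits h s a fun τ => ?_).div hc
    exact Finset.measurable_sum _ fun z _ =>
      (ht z).mul ((((hr τ).add (hV z)).sub hb).pow_const 2)
  have hbon : Measurable fun D : Fin n → Episode S A H => bonus C ι D h (V D) s a := by
    unfold bonus
    refine measurable_ite_count h s a measurable_const ?_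
    exact (((hv.mul_const ι).div hc).sqrt.const_mul 2).add (measurable_const.div hc)
  unfold pessQ
  exact ((hb.sub hbon).min measurable_const).max measurable_const

theorem measurable_pessValue [Nonempty S] (C ι : ℝ) :
    ∀ h ≤ H, ∀ s : S, Measurable fun D : Fin n → Episode S A H => pessValue C ι D h s := by
  refine backward_induction (fun s => ?_) fun h ih s => ?_
  · simp only [pessValue_end]
    exact measurable_const
  · simp only [pessValue_step]
    have := Finset.measurable_sup' (s := (Finset.univ : Finset A)) Finset.univ_nonempty
      (f := fun a (D : Fin n → Episode S A H) => pessQ C ι D h (pessValue C ι D (h + 1)) s a)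
      (fun a _ => measurable_pessQ C ι h ih s a)
    convert this using 1
    funext D
    rw [Finset.sup'_apply]

end Measurability

end Algorithm

/-! ### Reward and transition parts of the Bellman variance -/

section Variance

variable {S A : Type*} [Fintype S] [Fintype A] {H : ℕ}

/-- The expectation of `V` at the next state. -/
def MDP.transMean (M : MDP S A H) (h : Fin H) (V : S → ℝ) (s : S) (a : A) : ℝ :=
  ∑ z, M.trans h s a z * V z

/-- The variance of `V` at the next state. -/
def MDP.transVar (M : MDP S A H) (h : Fin H) (V : S → ℝ) (s : S) (a : A) : ℝ :=
  ∑ z, M.trans h s a z * (V z - M.transMean h V s a) ^ 2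

/-- The variance of the realized reward. -/
def MDP.rewardVar (M : MDP S A H) (h : Fin H) (s : S) (a : A) : ℝ :=
  ∫ x, (x - M.reward h s a) ^ 2 ∂M.rewardLaw h s a

theorem MDP.transVar_nonneg (M : MDP S A H) (h : Fin H) (V : S → ℝ) (s : S) (a : A) :
    0 ≤ M.transVar h V s a :=
  le_simplex_sum _ fun _ => sq_nonneg _

theorem MDP.rewardVar_nonneg (M : MDP S A H) (h : Fin H) (s : S) (a : A) :
    0 ≤ M.rewardVar h s a :=
  integral_nonneg fun _ => sq_nonneg _

theorem MDP.sum_trans_mul_sub (M : MDP S A H) (h : Fin H) (V : S → ℝ) (s : S) (a : A) :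
    ∑ z, M.trans h s a z * (V z - M.transMean h V s a) = 0 := by
  simp only [mul_sub, Finset.sum_sub_distrib, ← Finset.sum_mul, simplex_sum, one_mul]
  exact sub_self _

theorem MDP.transMean_mem (M : MDP S A H) (h : Fin H) {V : S → ℝ} {b : ℝ}
    (hV : ∀ z, 0 ≤ V z ∧ V z ≤ b) (s : S) (a : A) :
    0 ≤ M.transMean h V s a ∧ M.transMean h V s a ≤ b :=
  ⟨le_simplex_sum _ fun z => (hV z).1, simplex_sum_le _ fun z => (hV z).2⟩

theorem MDP.abs_sub_reward_le (M : MDP S A H) (h : Fin H) (s : S) (a : A) {x : ℝ}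
    (hx : x ∈ Set.Icc (0 : ℝ) 1) : |x - M.reward h s a| ≤ 1 := by
  have := M.reward_mem h s a
  rw [abs_le]; constructor <;> linarith [hx.1, hx.2]

theorem MDP.abs_sub_transMean_le (M : MDP S A H) (h : Fin H) {V : S → ℝ} {b : ℝ}
    (hV : ∀ z, 0 ≤ V z ∧ V z ≤ b) (s : S) (a : A) (z : S) : |V z - M.transMean h V s a| ≤ b := by
  have := M.transMean_mem h hV s a
  have := hV z
  rw [abs_le]; constructor <;> linarith

theorem MDP.integrable_bounded_reward (M : MDP S A H) (h : Fin H) (s : S) (a : A) {f : ℝ → ℝ}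
    (hf : Measurable f) {b : ℝ} (hb : ∀ x ∈ Set.Icc (0 : ℝ) 1, |f x| ≤ b) :
    Integrable f (M.rewardLaw h s a) := by
  have := M.rewardLaw_prob h s a
  exact Integrable.of_bound hf.aestronglyMeasurable b
    ((M.rewardLaw_bdd h s a).mono fun x hx => hb x hx)

theorem MDP.integral_sub_reward (M : MDP S A H) (h : Fin H) (s : S) (a : A) :
    ∫ x, (x - M.reward h s a) ∂M.rewardLaw h s a = 0 := by
  have := M.rewardLaw_prob h s a
  rw [integral_sub (f := fun x => x) (M.integrable_bounded_reward h s a measurable_id (b := 1)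
    fun x hx => abs_le.2 ⟨by linarith [hx.1], hx.2⟩) (integrable_const _)]
  simp [MDP.reward]

theorem MDP.bellmanVar_eq (M : MDP S A H) (h : Fin H) (V : S → ℝ) (s : S) (a : A) :
    M.bellmanVar h V s a = M.rewardVar h s a + M.transVar h V s a := by
  have := M.rewardLaw_prob h s a
  have h1 : ∀ x : ℝ, ∑ z, M.trans h s a z * (x + V z - M.backup h V s a) ^ 2 =
      (x - M.reward h s a) ^ 2 + M.transVar h V s a := by
    intro x
    have h2 : ∀ z, M.trans h s a z * (x + V z - M.backup h V s a) ^ 2 =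
        M.trans h s a z * (x - M.reward h s a) ^ 2 +
          (2 * (x - M.reward h s a) * (M.trans h s a z * (V z - M.transMean h V s a)) +
          M.trans h s a z * (V z - M.transMean h V s a) ^ 2) := by
      intro z
      rw [show M.backup h V s a = M.reward h s a + M.transMean h V s a from rfl]
      ring
    simp only [h2, Finset.sum_add_distrib, ← Finset.sum_mul, ← Finset.mul_sum, simplex_sum,
      M.sum_trans_mul_sub, one_mul, mul_zero, zero_add]
    rfl
  unfold MDP.bellmanVar
  simp only [h1]
  rw [integral_add (M.integrable_bounded_reward h s a (by fun_prop) (b := 1) fun x hx => ?_)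
    (integrable_const _)]
  · simp [MDP.rewardVar]
  · rw [abs_pow]; exact pow_le_one₀ (abs_nonneg _) (M.abs_sub_reward_le h s a hx)

theorem MDP.bellmanVar_nonneg (M : MDP S A H) (h : Fin H) (V : S → ℝ) (s : S) (a : A) :
    0 ≤ M.bellmanVar h V s a := by
  rw [M.bellmanVar_eq]
  exact add_nonneg (M.rewardVar_nonneg h s a) (M.transVar_nonneg h V s a)

end Variance

/-! ### The deviation inequalities defining the good event -/

section GoodData

variable {S A : Type*} [Fintype S] [Fintype A] [DecidableEq S] [DecidableEq A] [Nonempty A]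
  {H n : ℕ}

/-- The difference between the pessimistic value estimate for the next step and the covered value,
centered at `(s, a)`, normalized and clipped to `[-1, 1]`. -/
def MDP.clippedGap (M : MDP S A H) (μ : Policy S A H) (C ι ε : ℝ) (h : Fin H) (s : S) (a : A)
    (D : Fin n → Episode S A H) (z : S) : ℝ :=
  -- The exponential inequality requires a bound valid for all data, hence the clipping. If the gap
  -- is at most `ε`, the centered gap is at most `2ε` and the clipping does nothing.
  max (min ((pessValue C ι D (h + 1) z - M.coveredValue μ (h + 1) z -
    M.transMean h (fun y => pessValue C ι D (h + 1) y - M.coveredValue μ (h + 1) y) s a) /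
      (2 * ε)) 1) (-1)

/-- The deviation inequalities at `(h, s, a)` that are used in the analysis. -/
structure MDP.GoodAt (M : MDP S A H) (μ : Policy S A H) (C ι L ε : ℝ)
    (D : Fin n → Episode S A H) (h : Fin H) (s : S) (a : A) : Prop where
  count_near : |(count D h s a : ℝ) - n * M.occ μ h s a| ≤
    √(2 * (n * M.occ μ h s a) * L) + 3 * L
  -- Level `2ι`, because `√(2 · Nσ² · 2ι) = 2σ√(Nι)` with `N` the expected count is precisely the
  -- leading part of the bonus. The failure probability `(δ / HSA)²` still affords the union bound.
  upper : ∑ τ ∈ visits D h s a, ((D τ).2.2 h + M.coveredValue μ (h + 1) ((D τ).1 h.succ) -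
      M.backup h (M.coveredValue μ (h + 1)) s a) ≤
    √(2 * (n * (M.occ μ h s a * M.bellmanVar h (M.coveredValue μ (h + 1)) s a)) * (2 * ι)) +
      3 * H * (2 * ι)
  -- Here constants do not matter, and the higher level `3ι` saves failure probability.
  lower : ∑ τ ∈ visits D h s a, -((D τ).2.2 h + M.coveredValue μ (h + 1) ((D τ).1 h.succ) -
      M.backup h (M.coveredValue μ (h + 1)) s a) ≤
    √(2 * (n * (M.occ μ h s a * M.bellmanVar h (M.coveredValue μ (h + 1)) s a)) * (3 * ι)) +
      3 * H * (3 * ι)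
  reward_mean : |∑ τ ∈ visits D h s a, ((D τ).2.2 h - M.reward h s a)| ≤
    √(2 * (n * (M.occ μ h s a * M.rewardVar h s a)) * L) + 3 * 1 * L
  reward_sq : |∑ τ ∈ visits D h s a, (((D τ).2.2 h - M.reward h s a) ^ 2 - M.rewardVar h s a)| ≤
    √(2 * (n * (M.occ μ h s a * (1 ^ 2 * M.rewardVar h s a))) * L) + 3 * 1 ^ 2 * L
  next_mean : |∑ τ ∈ visits D h s a, (M.coveredValue μ (h + 1) ((D τ).1 h.succ) -
      M.transMean h (M.coveredValue μ (h + 1)) s a)| ≤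
    √(2 * (n * (M.occ μ h s a * M.transVar h (M.coveredValue μ (h + 1)) s a)) * L) + 3 * H * L
  next_sq : |∑ τ ∈ visits D h s a, ((M.coveredValue μ (h + 1) ((D τ).1 h.succ) -
      M.transMean h (M.coveredValue μ (h + 1)) s a) ^ 2 -
        M.transVar h (M.coveredValue μ (h + 1)) s a)| ≤
    √(2 * (n * (M.occ μ h s a * ((H : ℝ) ^ 2 * M.transVar h (M.coveredValue μ (h + 1)) s a))) * L) +
      3 * (H : ℝ) ^ 2 * L
  -- The exponent in `visit_future_concentration` is `√(L / N)` with `N` the expected count, which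
  -- balances the two terms.
  later : 0 < M.occ μ h s a →
    |∑ τ, ((visitSet h s a).indicator (fun _ => (1 : ℝ)) (D τ) -
        M.backProb μ h s a ((D τ).1 h.succ)) *
          M.clippedGap μ C ι ε h s a D ((D τ).1 h.succ)| ≤
      √(L / (n * M.occ μ h s a)) * ∑ τ, M.backProb μ h s a ((D τ).1 h.succ) +
        L / √(L / (n * M.occ μ h s a))

/-- The event on which the regret bound holds. -/
structure MDP.GoodData (M : MDP S A H) (μ : Policy S A H) (C ι L ε : ℝ)
    (D : Fin n → Episode S A H) : Prop where
  reward_mem : ∀ τ h, (D τ).2.2 h ∈ Set.Icc (0 : ℝ) 1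
  unvisited : ∀ h s a, ¬0 < M.occ μ h s a → count D h s a = 0
  good : ∀ h s a, M.GoodAt μ C ι L ε D h s a

end GoodData

/-! ### The good event has probability at least 1 - δ -/

section Probability

theorem measure_union_le_of_le {Ω : Type*} [MeasurableSpace Ω] {ν : Measure Ω} {B₁ B₂ : Set Ω}
    {c₁ c₂ : ENNReal} (h₁ : ν B₁ ≤ c₁) (h₂ : ν B₂ ≤ c₂) : ν (B₁ ∪ B₂) ≤ c₁ + c₂ :=
  (measure_union_le _ _).trans (add_le_add h₁ h₂)

variable {S A : Type*} [Fintype S] [Fintype A] [DecidableEq S] [DecidableEq A] [Nonempty S]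
  [Nonempty A] [MeasurableSpace S] [MeasurableSpace A] [MeasurableSingletonClass S]
  [MeasurableSingletonClass A] {H n : ℕ}

theorem MDP.ae_stepLaw (M : MDP S A H) (h : Fin H) (s : S) (a : A) :
    ∀ᵐ x ∂M.stepLaw h s a, x.1 ∈ Set.Icc (0 : ℝ) 1 := by
  have := M.rewardLaw_prob
  exact Measure.quasiMeasurePreserving_fst.ae (M.rewardLaw_bdd h s a)

theorem MDP.integral_stepLaw (M : MDP S A H) (h : Fin H) (s : S) (a : A) {g : ℝ × S → ℝ}
    (hg : Measurable g) {b : ℝ} (hb : ∀ x z, x ∈ Set.Icc (0 : ℝ) 1 → |g (x, z)| ≤ b) :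
    ∫ x, g x ∂M.stepLaw h s a = ∫ x, ∑ z, M.trans h s a z * g (x, z) ∂M.rewardLaw h s a := by
  have := M.rewardLaw_prob
  have hint : Integrable g (M.stepLaw h s a) := Integrable.of_bound hg.aestronglyMeasurable b
    ((M.ae_stepLaw h s a).mono fun x hx => hb x.1 x.2 hx)
  unfold MDP.stepLaw at hint ⊢
  rw [integral_prod _ hint]
  refine integral_congr_ae (Filter.Eventually.of_forall fun x => ?_)
  dsimp only
  have hfin : ∀ z : S, IsFiniteMeasure (ENNReal.ofReal (M.trans h s a z) • Measure.dirac z) :=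
    fun z => Measure.smul_finite _ ENNReal.ofReal_ne_top
  rw [integral_finsetSum_measure fun z _ => Integrable.of_finite]
  refine Finset.sum_congr rfl fun z _ => ?_
  rw [integral_smul_measure, integral_dirac, ENNReal.toReal_ofReal (simplex_nonneg _ z),
    smul_eq_mul]

theorem MDP.visit_bernstein_abs (M : MDP S A H) (π : Policy S A H) (h : Fin H) (s : S) (a : A)
    {g : ℝ × S → ℝ} (hg : Measurable g) {b v t : ℝ} (hb : 0 < b) (ht : 0 ≤ t)
    (hbound : ∀ᵐ x ∂M.stepLaw h s a, |g x| ≤ b) (hmean : ∫ x, g x ∂M.stepLaw h s a = 0)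
    (hvar : ∫ x, g x ^ 2 ∂M.stepLaw h s a ≤ v) (n : ℕ) :
    M.dataLaw π n {D | √(2 * (n * (M.occ π h s a * v)) * t) + 3 * b * t <
      |∑ τ ∈ visits D h s a, g (stepOutcome h (D τ))|} ≤ 2 * ENNReal.ofReal (Real.exp (-t)) := by
  have h1 := M.visit_bernstein π h s a hg hb ht hbound hmean hvar n
  have h2 := M.visit_bernstein π h s a (g := fun x => -g x) hg.neg hb ht
    (by simpa only [abs_neg] using hbound) (by rw [integral_neg, hmean, neg_zero])
    (by simpa only [neg_sq] using hvar) n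
  rw [two_mul (ENNReal.ofReal _)]
  refine le_trans (measure_mono ?_) ((measure_union_le _ _).trans (add_le_add h1 h2))
  intro D hD
  have hD' : √(2 * (n * (M.occ π h s a * v)) * t) + 3 * b * t <
      |∑ τ ∈ visits D h s a, g (stepOutcome h (D τ))| := hD
  rw [lt_abs] at hD'
  simpa only [Set.mem_union, Set.mem_ofPred_eq, Finset.sum_neg_distrib] using hD'

/-- Concentration of the sample second moment of a bounded centered variable. -/
theorem MDP.visit_sq_concentration (M : MDP S A H) (π : Policy S A H) (h : Fin H) (s : S) (a : A)
    {g : ℝ × S → ℝ} (hg : Measurable g) {b v t : ℝ} (hb : 0 < b) (ht : 0 ≤ t)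
    (hbound : ∀ᵐ x ∂M.stepLaw h s a, |g x| ≤ b)
    (hvar : ∫ x, g x ^ 2 ∂M.stepLaw h s a = v) (n : ℕ) :
    M.dataLaw π n {D | √(2 * (n * (M.occ π h s a * (b ^ 2 * v))) * t) + 3 * b ^ 2 * t <
      |∑ τ ∈ visits D h s a, (g (stepOutcome h (D τ)) ^ 2 - v)|} ≤
        2 * ENNReal.ofReal (Real.exp (-t)) := by
  have hsq : ∀ᵐ x ∂M.stepLaw h s a, g x ^ 2 ≤ b ^ 2 := by
    filter_upwards [hbound] with x hx
    rw [← sq_abs]; exact pow_le_pow_left₀ (abs_nonneg _) hx 2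
  have hint2 : Integrable (fun x => g x ^ 2) (M.stepLaw h s a) :=
    Integrable.of_bound (hg.pow_const 2).aestronglyMeasurable (b ^ 2) (by
      filter_upwards [hsq] with x hx
      rwa [Real.norm_eq_abs, abs_of_nonneg (sq_nonneg _)])
  have hv0 : 0 ≤ v := hvar ▸ integral_nonneg fun _ => sq_nonneg _
  have hvb : v ≤ b ^ 2 := by
    rw [← hvar]
    have := integral_mono_ae hint2 (integrable_const (b ^ 2)) hsq
    exact this.trans (by simp)
  have hbd : ∀ᵐ x ∂M.stepLaw h s a, |g x ^ 2 - v| ≤ b ^ 2 := by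
    filter_upwards [hsq] with x hx
    rw [abs_le]; constructor <;> nlinarith [sq_nonneg (g x)]
  refine M.visit_bernstein_abs π h s a (g := fun x => g x ^ 2 - v)
    ((hg.pow_const 2).sub_const v) (by positivity) ht hbd ?_ ?_ n
  · rw [integral_sub hint2 (integrable_const _), hvar]; simp
  · have h1 : ∫ x, (g x ^ 2 - v) ^ 2 ∂M.stepLaw h s a ≤
        ∫ x, ((b ^ 2 - 2 * v) * g x ^ 2 + v ^ 2) ∂M.stepLaw h s a := by
      refine integral_mono_of_nonneg (Filter.Eventually.of_forall fun x => sq_nonneg _)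
        ((hint2.const_mul _).add (integrable_const _)) ?_
      filter_upwards [hsq] with x hx
      nlinarith [sq_nonneg (g x)]
    refine h1.trans ?_
    rw [integral_add (hint2.const_mul _) (integrable_const _), integral_const_mul, hvar]
    simp only [integral_const, probReal_univ, smul_eq_mul]
    nlinarith

theorem MDP.ae_reward_mem (M : MDP S A H) (π : Policy S A H) (h : Fin H) :
    ∀ᵐ ω ∂M.episodeLaw π, ω.2.2 h ∈ Set.Icc (0 : ℝ) 1 := by
  have h1 : ∀ s a, ∀ᵐ ω ∂M.episodeLaw π, ω ∈ visitSet h s a →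
      (stepOutcome h ω).1 ∈ Set.Icc (0 : ℝ) 1 := fun s a =>
    M.ae_visit π h s a (M.ae_stepLaw h s a)
  have h2 := ae_all_iff.2 fun s => ae_all_iff.2 fun a => h1 s a
  filter_upwards [h2] with ω hω
  exact hω _ _ ⟨rfl, rfl⟩

theorem MDP.ae_unvisited (M : MDP S A H) (π : Policy S A H) (h : Fin H) (s : S) (a : A)
    (hocc : ¬0 < M.occ π h s a) : ∀ᵐ ω ∂M.episodeLaw π, ω ∉ visitSet h s a := by
  have h0 := M.measure_visitSet π h s a
  rw [ENNReal.ofReal_of_nonpos (not_lt.1 hocc)] at h0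
  exact measure_eq_zero_iff_ae_notMem.1 h0

theorem MDP.ae_data (M : MDP S A H) (π : Policy S A H) {p : Episode S A H → Prop}
    (hp : ∀ᵐ ω ∂M.episodeLaw π, p ω) : ∀ᵐ D ∂M.dataLaw π n, ∀ τ, p (D τ) := by
  rw [ae_all_iff]
  intro τ
  exact (Measure.quasiMeasurePreserving_eval (fun _ : Fin n => M.episodeLaw π) τ).ae hp

theorem MDP.abs_clippedGap_le (M : MDP S A H) (μ : Policy S A H) (C ι ε : ℝ) (h : Fin H) (s : S)
    (a : A) (D : Fin n → Episode S A H) (z : S) : |M.clippedGap μ C ι ε h s a D z| ≤ 1 :=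
  abs_le.2 ⟨le_max_right _ _, max_le (min_le_right _ _) (by norm_num)⟩

theorem MDP.measurable_clippedGap (M : MDP S A H) (μ : Policy S A H) (C ι ε : ℝ) (h : Fin H)
    (s : S) (a : A) (z : S) :
    Measurable fun D : Fin n → Episode S A H => M.clippedGap μ C ι ε h s a D z := by
  have := measurable_pessValue (n := n) (S := S) (A := A) C ι (h + 1) h.2
  have hm : Measurable fun D : Fin n → Episode S A H => M.transMean h
      (fun y => pessValue C ι D (h + 1) y - M.coveredValue μ (h + 1) y) s a := by
    unfold MDP.transMean
    exact Finset.measurable_sum _ fun y _ => ((this y).sub_const _).const_mul _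
  unfold MDP.clippedGap
  exact (((((this z).sub_const _).sub hm).div_const _).min measurable_const).max measurable_const

/-- The eight deviation bounds at `(h, s, a)` fail with small probability. -/
theorem MDP.measure_not_goodAt_le (M : MDP S A H) (μ : Policy S A H) (C ε : ℝ) {ι L : ℝ}
    (hι : 0 ≤ ι) (hL : 0 < L) (h : Fin H) (s : S) (a : A)
    (hn : 0 < M.occ μ h s a → L ≤ n * M.occ μ h s a) :
    M.dataLaw μ n {D | ¬M.GoodAt μ C ι L ε D h s a} ≤
      ENNReal.ofReal (Real.exp (-(2 * ι)) + Real.exp (-(3 * ι)) + 12 * Real.exp (-L)) := by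
  have := M.rewardLaw_prob
  have hHpos : 0 < H := Nat.pos_of_ne_zero fun h0 => by subst h0; exact h.elim0
  have hH1 : (1 : ℝ) ≤ H := by exact_mod_cast hHpos
  have hh1 : ((h : ℕ) : ℝ) + 1 ≤ H := by exact_mod_cast h.2
  set V := M.coveredValue μ (h + 1) with hV
  have hVmem : ∀ z, 0 ≤ V z ∧ V z ≤ (H : ℝ) - 1 := fun z => by
    have := M.coveredValue_mem μ (h + 1) h.2 z
    push_cast at this
    exact ⟨this.1, by linarith [Nat.cast_nonneg (α := ℝ) (h : ℕ)]⟩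
  have hVmem' : ∀ z, 0 ≤ V z ∧ V z ≤ (H : ℝ) := fun z => ⟨(hVmem z).1, by linarith [hVmem z]⟩
  have hVm : Measurable V := measurable_of_countable V
  set T := M.transMean h V s a
  have hae := M.ae_stepLaw h s a
  -- the joint variable
  let gX : ℝ × S → ℝ := fun x => x.1 + V x.2 - M.backup h V s a
  have gXm : Measurable gX := by fun_prop
  have gXb : ∀ x z, x ∈ Set.Icc (0 : ℝ) 1 → |gX (x, z)| ≤ H := by
    intro x z hx
    have h1 := M.reward_mem h s a
    have h2 := M.transMean_mem h hVmem s a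
    have h3 := hVmem z
    have h4 : M.backup h V s a = M.reward h s a + T := rfl
    simp only [gX, h4]
    rw [abs_le]
    constructor <;> linarith [hx.1, hx.2]
  have gXmean : ∫ x, gX x ∂M.stepLaw h s a = 0 := by
    rw [M.integral_stepLaw h s a gXm gXb]
    refine Eq.trans ?_ (M.integral_sub_reward h s a)
    congr 1
    funext x
    have h4 : M.backup h V s a = M.reward h s a + T := rfl
    simp only [gX, h4, mul_sub, mul_add, Finset.sum_sub_distrib, Finset.sum_add_distrib,
      ← Finset.sum_mul, simplex_sum, one_mul]
    have : ∑ z, M.trans h s a z * V z = T := rfl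
    rw [this]; ring
  have gXvar : ∫ x, gX x ^ 2 ∂M.stepLaw h s a = M.bellmanVar h V s a := by
    rw [M.integral_stepLaw h s a (g := fun x => gX x ^ 2) (gXm.pow_const 2) (b := (H : ℝ) ^ 2)
      fun x z hx => by rw [abs_pow]; exact pow_le_pow_left₀ (abs_nonneg _) (gXb x z hx) 2]
    rfl
  -- the reward
  let gR : ℝ × S → ℝ := fun x => x.1 - M.reward h s a
  have gRm : Measurable gR := by fun_prop
  have gRb : ∀ x z, x ∈ Set.Icc (0 : ℝ) 1 → |gR (x, z)| ≤ 1 := fun x z hx =>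
    M.abs_sub_reward_le h s a hx
  have gRmean : ∫ x, gR x ∂M.stepLaw h s a = 0 := by
    rw [M.integral_stepLaw h s a gRm gRb]
    simp only [gR, ← Finset.sum_mul, simplex_sum, one_mul]
    exact M.integral_sub_reward h s a
  have gRvar : ∫ x, gR x ^ 2 ∂M.stepLaw h s a = M.rewardVar h s a := by
    rw [M.integral_stepLaw h s a (g := fun x => gR x ^ 2) (gRm.pow_const 2) (b := 1)
      fun x z hx => by rw [abs_pow]; exact pow_le_one₀ (abs_nonneg _) (gRb x z hx)]
    simp only [gR, ← Finset.sum_mul, simplex_sum, one_mul]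
    rfl
  -- the next state
  let gV : ℝ × S → ℝ := fun x => V x.2 - T
  have gVm : Measurable gV := by fun_prop
  have gVb : ∀ x z, x ∈ Set.Icc (0 : ℝ) 1 → |gV (x, z)| ≤ H := fun x z _ =>
    M.abs_sub_transMean_le h hVmem' s a z
  have gVmean : ∫ x, gV x ∂M.stepLaw h s a = 0 := by
    rw [M.integral_stepLaw h s a gVm gVb]
    simp only [gV, T, M.sum_trans_mul_sub, integral_zero]
  have gVvar : ∫ x, gV x ^ 2 ∂M.stepLaw h s a = M.transVar h V s a := by
    rw [M.integral_stepLaw h s a (g := fun x => gV x ^ 2) (gVm.pow_const 2) (b := (H : ℝ) ^ 2)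
      fun x z hx => by rw [abs_pow]; exact pow_le_pow_left₀ (abs_nonneg _) (gVb x z hx) 2]
    simp only [gV]
    rw [show ∑ z, M.trans h s a z * (V z - T) ^ 2 = M.transVar h V s a from rfl]
    simp
  have hH0 : (0 : ℝ) < H := by linarith
  have e1 := M.count_concentration μ h s a hL.le n
  have e2 := M.visit_bernstein μ h s a gXm hH0 (t := 2 * ι) (by positivity)
    (hae.mono fun x hx => gXb x.1 x.2 hx) gXmean gXvar.le n
  have e3 := M.visit_bernstein μ h s a (g := fun x => -gX x) gXm.neg hH0 (t := 3 * ι)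
    (by positivity) (hae.mono fun x hx => by rw [abs_neg]; exact gXb x.1 x.2 hx)
    (by rw [integral_neg, gXmean, neg_zero])
    (by simpa only [neg_sq] using gXvar.le) n
  have e4 := M.visit_bernstein_abs μ h s a gRm one_pos hL.le
    (hae.mono fun x hx => gRb x.1 x.2 hx) gRmean gRvar.le n
  have e5 := M.visit_sq_concentration μ h s a gRm one_pos hL.le
    (hae.mono fun x hx => gRb x.1 x.2 hx) gRvar n
  have e6 := M.visit_bernstein_abs μ h s a gVm hH0 hL.le
    (hae.mono fun x hx => gVb x.1 x.2 hx) gVmean gVvar.le n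
  have e7 := M.visit_sq_concentration μ h s a gVm hH0 hL.le
    (hae.mono fun x hx => gVb x.1 x.2 hx) gVvar n
  have e8 : M.dataLaw μ n {D | ¬(0 < M.occ μ h s a →
    |∑ τ, ((visitSet h s a).indicator (fun _ => (1 : ℝ)) (D τ) -
        M.backProb μ h s a ((D τ).1 h.succ)) *
          M.clippedGap μ C ι ε h s a D ((D τ).1 h.succ)| ≤
      √(L / (n * M.occ μ h s a)) * ∑ τ, M.backProb μ h s a ((D τ).1 h.succ) +
        L / √(L / (n * M.occ μ h s a)))} ≤ 2 * ENNReal.ofReal (Real.exp (-L)) := by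
    by_cases hocc : 0 < M.occ μ h s a
    · have hn' := hn hocc
      have hl0 : 0 < √(L / (n * M.occ μ h s a)) := Real.sqrt_pos.2 (div_pos hL (by linarith))
      have hl1 : √(L / (n * M.occ μ h s a)) ≤ 1 := by
        rw [Real.sqrt_le_one]
        exact div_le_one_of_le₀ hn' (by linarith)
      have hfut : ∀ D : Fin n → Episode S A H, M.clippedGap μ C ι ε h s a D =
          M.clippedGap μ C ι ε h s a fun τ => future h (D τ) := by
        intro D
        unfold MDP.clippedGap
        rw [← pessValue_future]
      have p1 := M.visit_future_concentration μ h s a (M.clippedGap μ C ι ε h s a)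
        (M.measurable_clippedGap μ C ι ε h s a) (M.abs_clippedGap_le μ C ι ε h s a) hfut
        hl0 hl1 (t := L) (n := n)
      have p2 := M.visit_future_concentration μ h s a (fun D z => -M.clippedGap μ C ι ε h s a D z)
        (fun z => (M.measurable_clippedGap μ C ι ε h s a z).neg)
        (fun D z => by rw [abs_neg]; exact M.abs_clippedGap_le μ C ι ε h s a D z)
        (fun D => by rw [hfut D]) hl0 hl1 (t := L) (n := n)
      rw [two_mul (ENNReal.ofReal _)]
      refine le_trans (measure_mono ?_) ((measure_union_le _ _).trans (add_le_add p1 p2))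
      intro D hD
      rw [Set.mem_ofPred_eq, Classical.not_imp, not_le, lt_abs] at hD
      simpa only [Set.mem_union, Set.mem_ofPred_eq, mul_neg, Finset.sum_neg_distrib] using hD.2
    · simp [hocc]
  set x2 := ENNReal.ofReal (Real.exp (-(2 * ι)))
  set x3 := ENNReal.ofReal (Real.exp (-(3 * ι)))
  set x := ENNReal.ofReal (Real.exp (-L)) with hx
  -- The six two-sided bounds at level `L` cost twelve terms; the two one-sided ones at levels `2ι`
  -- and `3ι` cost one term each.
  have hsum : ENNReal.ofReal (Real.exp (-(2 * ι)) + Real.exp (-(3 * ι)) + 12 * Real.exp (-L)) =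
      2 * x + (x2 + (x3 + (2 * x + (2 * x + (2 * x + (2 * x + 2 * x)))))) := by
    rw [ENNReal.ofReal_add (by positivity) (by positivity),
      ENNReal.ofReal_add (by positivity) (by positivity), ENNReal.ofReal_mul (by norm_num), ← hx,
      show ENNReal.ofReal 12 = 12 by norm_num]
    ring
  rw [hsum]
  refine le_trans (measure_mono ?_) (measure_union_le_of_le e1 (measure_union_le_of_le e2
    (measure_union_le_of_le e3 (measure_union_le_of_le e4 (measure_union_le_of_le e5
    (measure_union_le_of_le e6 (measure_union_le_of_le e7 e8)))))))
  intro D hD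
  by_contra hcon
  simp only [Set.mem_union, Set.mem_ofPred_eq, not_or, not_lt, not_not] at hcon
  obtain ⟨c1, c2, c3, c4, c5, c6, c7, c8⟩ := hcon
  exact hD ⟨c1, c2, c3, c4, c5, c6, c7, c8⟩

/-- The event of all the deviation bounds has probability at least `1 - δ`. -/
theorem MDP.measure_not_goodData_le (M : MDP S A H) (μ : Policy S A H) (C ε : ℝ) {ι L : ℝ}
    (hι : 0 ≤ ι) (hL : 0 < L)
    (hn : ∀ h s a, 0 < M.occ μ h s a → L ≤ n * M.occ μ h s a) :
    M.dataLaw μ n {D | ¬M.GoodData μ C ι L ε D} ≤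
      ENNReal.ofReal ((H : ℝ) * Fintype.card S * Fintype.card A *
        (Real.exp (-(2 * ι)) + Real.exp (-(3 * ι)) + 12 * Real.exp (-L))) := by
  set c := Real.exp (-(2 * ι)) + Real.exp (-(3 * ι)) + 12 * Real.exp (-L) with hc
  have h1 : ∀ᵐ D ∂M.dataLaw μ n, ∀ τ, ∀ h, (D τ).2.2 h ∈ Set.Icc (0 : ℝ) 1 :=
    M.ae_data μ (ae_all_iff.2 fun h => M.ae_reward_mem μ h)
  have h2 : ∀ᵐ D ∂M.dataLaw μ n, ∀ h s a, ¬0 < M.occ μ h s a → count D h s a = 0 := by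
    rw [ae_all_iff]; intro h
    rw [ae_all_iff]; intro s
    rw [ae_all_iff]; intro a
    by_cases hocc : 0 < M.occ μ h s a
    · exact Filter.Eventually.of_forall fun D hD => absurd hocc hD
    · filter_upwards [M.ae_data (n := n) μ (M.ae_unvisited μ h s a hocc)] with D hD _
      rw [count, Finset.card_eq_zero, visits, Finset.filter_eq_empty_iff]
      exact fun τ _ => hD τ
  have h12 := h1.and h2
  have hnull : M.dataLaw μ n {D | ¬((∀ τ, ∀ h, (D τ).2.2 h ∈ Set.Icc (0 : ℝ) 1) ∧
      ∀ h s a, ¬0 < M.occ μ h s a → count D h s a = 0)} = 0 := ae_iff.1 h12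
  have hsub : {D | ¬M.GoodData μ C ι L ε D} ⊆
      {D | ¬((∀ τ, ∀ h, (D τ).2.2 h ∈ Set.Icc (0 : ℝ) 1) ∧
        ∀ h s a, ¬0 < M.occ μ h s a → count D h s a = 0)} ∪
      ⋃ p : Fin H × S × A, {D : Fin n → Episode S A H |
        ¬M.GoodAt μ C ι L ε D p.1 p.2.1 p.2.2} := by
    intro D hD
    by_contra hcon
    simp only [Set.mem_union, Set.mem_iUnion, Set.mem_ofPred_eq, not_or, not_exists, not_not] at hcon
    exact hD ⟨hcon.1.1, hcon.1.2, fun h s a => hcon.2 (h, s, a)⟩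
  refine (measure_mono hsub).trans ((measure_union_le _ _).trans ?_)
  rw [hnull, zero_add]
  refine (measure_iUnion_fintype_le _ _).trans ?_
  refine (Finset.sum_le_sum fun p _ => M.measure_not_goodAt_le μ C ε hι hL p.1 p.2.1 p.2.2
    (hn _ _ _)).trans ?_
  rw [Finset.sum_const, ← hc, nsmul_eq_mul, Finset.card_univ, Fintype.card_prod, Fintype.card_prod,
    Fintype.card_fin, ← mul_assoc, ENNReal.ofReal_mul (by positivity)]
  refine mul_le_mul_left (le_of_eq ?_) _
  rw [← ENNReal.ofReal_natCast]
  push_cast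
  rfl

end Probability

/-! ### Elementary inequalities for counts, means and standard deviations -/

section RealBounds

variable {N c L u ι : ℝ}

/-- Throughout this part `N` stands for the expected count of a pair, `c` for its actual count, and
`u` bounds `√(L / N)`; powers of `u` measure the order of an error term. -/
theorem abs_count_sub_le (hu0 : 0 < u) (hu : u ≤ 1 / 100) (hL : L ≤ N * u ^ 2) (hN : 0 < N)
    (hc : |c - N| ≤ √(2 * N * L) + 3 * L) : |c - N| ≤ 2 * u * N := by
  have h1 : √(2 * N * L) ≤ 3 / 2 * u * N := by
    rw [Real.sqrt_le_left (by positivity)]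
    nlinarith [mul_le_mul_of_nonneg_left hL hN.le, sq_nonneg (u * N)]
  have h2 : N * u ^ 2 ≤ N * u * (1 / 100) := by
    nlinarith [mul_pos hN hu0]
  nlinarith [mul_pos hN hu0]

theorem div_count_le {v b x : ℝ} (hu0 : 0 < u) (hL : L ≤ N * u ^ 2) (hN : 0 < N) (hc : N / 2 ≤ c)
    (hv : 0 ≤ v) (hb : 0 ≤ b) (hx : x ≤ √(2 * (N * v) * L) + 3 * b * L) :
    x / c ≤ 3 * √v * u + 6 * b * u ^ 2 := by
  have hc0 : 0 < c := by linarith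
  have h1 : √(2 * (N * v) * L) ≤ 3 / 2 * √v * u * N := by
    rw [Real.sqrt_le_left (by positivity)]
    have : (3 / 2 * √v * u * N) ^ 2 = 9 / 4 * v * (u * N) ^ 2 := by
      rw [mul_pow, mul_pow, mul_pow, Real.sq_sqrt hv]; ring
    rw [this]
    nlinarith [mul_le_mul_of_nonneg_left hL (mul_nonneg hN.le hv),
      mul_nonneg hv (sq_nonneg (u * N))]
  have h2 : b * L ≤ b * (N * u ^ 2) := mul_le_mul_of_nonneg_left hL hb
  rw [div_le_iff₀ hc0]
  calc x ≤ (3 * √v * u + 6 * b * u ^ 2) * (N / 2) := by nlinarith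
    _ ≤ _ := by gcongr

theorem abs_div_count_le {v b x : ℝ} (hu0 : 0 < u) (hL : L ≤ N * u ^ 2) (hN : 0 < N)
    (hc : N / 2 ≤ c) (hv : 0 ≤ v) (hb : 0 ≤ b) (hx : |x| ≤ √(2 * (N * v) * L) + 3 * b * L) :
    |x / c| ≤ 3 * √v * u + 6 * b * u ^ 2 := by
  rw [abs_div, abs_of_pos (show 0 < c by linarith)]
  exact div_count_le hu0 hL hN hc hv hb hx

/-- Here `q` is the second moment about the true mean and `m` the error of the mean. The correction
`m²` is of order `b² u²` and joins the lower order term. -/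
theorem abs_sub_sq_le {m q v b : ℝ} (hu0 : 0 < u) (hu : u ≤ 1 / 100)
    (hb : 0 ≤ b) (hvb : v ≤ b ^ 2) (hm : |m| ≤ 3 * √v * u + 6 * b * u ^ 2)
    (hq : |q - v| ≤ 3 * √(b ^ 2 * v) * u + 6 * b ^ 2 * u ^ 2) :
    |q - m ^ 2 - v| ≤ 3 * b * √v * u + 22 * b ^ 2 * u ^ 2 := by
  have h1 : √(b ^ 2 * v) = b * √v := by rw [Real.sqrt_mul (sq_nonneg b), Real.sqrt_sq hb]
  have h2 : √v ≤ b := by rw [Real.sqrt_le_left hb]; exact hvb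
  have h3 : |m| ≤ 4 * b * u := by nlinarith [mul_nonneg hb hu0.le, Real.sqrt_nonneg v]
  have h4 : m ^ 2 ≤ 16 * b ^ 2 * u ^ 2 := by
    rw [← sq_abs]; nlinarith [abs_nonneg m]
  rw [h1] at hq
  rw [abs_le] at hq ⊢
  constructor <;> nlinarith [sq_nonneg m, hq.1, hq.2]

/-- Factor `p - q = (√p - √q)(√p + √q)`: a gap above `11B` between the roots would contradict the
hypothesis. A variance error proportional to the standard deviation thus becomes a standard
deviation error free of it. -/
theorem abs_sqrt_sub_sqrt_le {p q B : ℝ} (hp : 0 ≤ p) (hq : 0 ≤ q) (hB : 0 ≤ B)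
    (h : |p - q| ≤ 6 * B * √q + 44 * B ^ 2) : |√p - √q| ≤ 11 * B := by
  have hx := Real.sqrt_nonneg p
  have hy := Real.sqrt_nonneg q
  have hx2 := Real.sq_sqrt hp
  have hy2 := Real.sq_sqrt hq
  rw [abs_le] at h
  rw [abs_le]
  constructor
  · by_contra! hcon
    nlinarith [h.1]
  · by_contra! hcon
    nlinarith [h.2]

theorem sqrt_div_count_le (hu0 : 0 < u) (hL : L ≤ N * u ^ 2) (hN : 0 < N) (hc : N / 2 ≤ c)
    (hι : ι ≤ L) : ι / c ≤ 2 * u ^ 2 ∧ √(ι / c) ≤ 2 * u := by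
  have hc0 : 0 < c := by linarith
  have h1 : ι / c ≤ 2 * u ^ 2 := by
    rw [div_le_iff₀ hc0]
    nlinarith [mul_le_mul_of_nonneg_right hc (sq_nonneg u)]
  refine ⟨h1, ?_⟩
  rw [Real.sqrt_le_left (by positivity)]
  nlinarith [sq_nonneg u]

/-- Replacing the expected count by the actual one costs only the factor `1 + 2u`, from `N ≤ (1 +
2u)² c`. A constant factor would be fatal, as the 2 in front has to be matched by the bonus. -/
theorem bernstein_div_count_le {σ b x : ℝ} (hu0 : 0 < u) (hu : u ≤ 1 / 100) (hN : 0 < N)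
    (hcN : |c - N| ≤ 2 * u * N) (hι : 0 ≤ ι) (hσ : 0 ≤ σ)
    (hx : x ≤ √(2 * (N * σ ^ 2) * (2 * ι)) + 3 * b * (2 * ι)) :
    x / c ≤ 2 * σ * √(ι / c) * (1 + 2 * u) + 6 * b * (ι / c) := by
  rw [abs_le] at hcN
  have hc0 : 0 < c := by nlinarith
  have h1 : √(2 * (N * σ ^ 2) * (2 * ι)) ≤ 2 * σ * √(ι / c) * (1 + 2 * u) * c := by
    rw [Real.sqrt_le_left (by positivity)]
    have e : (2 * σ * √(ι / c) * (1 + 2 * u) * c) ^ 2 = 4 * σ ^ 2 * ι * ((1 + 2 * u) ^ 2 * c) := by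
      have : √(ι / c) ^ 2 = ι / c := Real.sq_sqrt (by positivity)
      calc _ = 4 * σ ^ 2 * √(ι / c) ^ 2 * (1 + 2 * u) ^ 2 * c ^ 2 := by ring
        _ = _ := by rw [this]; field_simp
    rw [e]
    have h2 : N ≤ (1 + 2 * u) ^ 2 * c := by
      have h3 : (1 + 2 * u) ^ 2 * (N - 2 * u * N) ≤ (1 + 2 * u) ^ 2 * c :=
        mul_le_mul_of_nonneg_left (by linarith) (sq_nonneg _)
      have h4 : 1 ≤ (1 + 2 * u) ^ 2 * (1 - 2 * u) := by nlinarith [mul_pos hu0 hu0]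
      nlinarith
    calc 2 * (N * σ ^ 2) * (2 * ι) = 4 * σ ^ 2 * ι * N := by ring
      _ ≤ _ := mul_le_mul_of_nonneg_left h2 (by positivity)
  rw [div_le_iff₀ hc0]
  have h5 : (2 * σ * √(ι / c) * (1 + 2 * u) + 6 * b * (ι / c)) * c =
      2 * σ * √(ι / c) * (1 + 2 * u) * c + 6 * b * ι := by field_simp
  rw [h5]
  linarith

theorem bernstein_div_count_le' {σ b x : ℝ} (hN : 0 < N) (hc : N / 2 ≤ c) (hι : 0 ≤ ι)
    (hσ : 0 ≤ σ) (hb : 0 ≤ b) (hx : x ≤ √(2 * (N * σ ^ 2) * (3 * ι)) + 3 * b * (3 * ι)) :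
    x / c ≤ 5 * (σ * √(ι / N)) + 18 * b * (ι / N) := by
  have hc0 : 0 < c := by linarith
  have h1 : √(2 * (N * σ ^ 2) * (3 * ι)) ≤ 5 * (σ * √(ι / N)) * (N / 2) := by
    rw [Real.sqrt_le_left (by positivity)]
    have : √(ι / N) ^ 2 = ι / N := Real.sq_sqrt (by positivity)
    have e : (5 * (σ * √(ι / N)) * (N / 2)) ^ 2 = 25 / 4 * σ ^ 2 * ι * N := by
      calc _ = 25 / 4 * σ ^ 2 * √(ι / N) ^ 2 * N ^ 2 := by ring
        _ = _ := by rw [this]; field_simp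
    rw [e]
    nlinarith [mul_nonneg (mul_nonneg (sq_nonneg σ) hι) hN.le]
  rw [div_le_iff₀ hc0]
  have h2 : 3 * b * (3 * ι) = 18 * b * (ι / N) * (N / 2) := by field_simp; ring
  calc x ≤ (5 * (σ * √(ι / N)) + 18 * b * (ι / N)) * (N / 2) := by rw [add_mul, ← h2]; linarith
    _ ≤ _ := by gcongr

end RealBounds

/-! ### First order accuracy of the value estimates on the good event -/

section Deterministic

variable {S A : Type*} [Fintype S] [Fintype A] [DecidableEq S] [DecidableEq A] [Nonempty A]
  {H n : ℕ}

/-- The sample size is large: `L / (n d)` is at most `u ^ 2` at all covered pairs, and `H * u` is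
small. -/
structure MDP.LargeSample (M : MDP S A H) (μ : Policy S A H) (n : ℕ) (C ι L u : ℝ) : Prop where
  u_pos : 0 < u
  u_le : (H : ℝ) * u ≤ 1 / 100
  one_le_H : 1 ≤ H
  two_le_C : 2 ≤ C
  half_le_ι : 1 / 2 ≤ ι
  ι_le : ι ≤ L
  L_le : ∀ h s a, 0 < M.occ μ h s a → L ≤ n * M.occ μ h s a * u ^ 2

variable {M : MDP S A H} {μ : Policy S A H} {C ι L u ε : ℝ} {D : Fin n → Episode S A H}

theorem MDP.LargeSample.one_le (hs : M.LargeSample μ n C ι L u) : (1 : ℝ) ≤ H := by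
  exact_mod_cast hs.one_le_H

theorem MDP.LargeSample.u_le' (hs : M.LargeSample μ n C ι L u) : u ≤ 1 / 100 := by
  nlinarith [hs.one_le, hs.u_le, hs.u_pos]

theorem MDP.LargeSample.expCount_pos (hs : M.LargeSample μ n C ι L u) {h : Fin H} {s : S} {a : A}
    (hocc : 0 < M.occ μ h s a) : 0 < n * M.occ μ h s a := by
  have h1 := hs.L_le h s a hocc
  have h2 : 0 < n * M.occ μ h s a * u ^ 2 := by
    linarith [hs.half_le_ι, hs.ι_le]
  exact pos_of_mul_pos_left h2 (sq_nonneg u)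

/-- The error is relative and holds at uncovered pairs too, where both counts vanish. It can
therefore be summed over actions without losing a factor. -/
theorem MDP.GoodData.abs_count_sub (hG : M.GoodData μ C ι L ε D)
    (hs : M.LargeSample μ n C ι L u) (h : Fin H) (s : S) (a : A) :
    |(count D h s a : ℝ) - n * M.occ μ h s a| ≤ 2 * u * (n * M.occ μ h s a) := by
  by_cases hocc : 0 < M.occ μ h s a
  · exact abs_count_sub_le hs.u_pos hs.u_le' (hs.L_le h s a hocc) (hs.expCount_pos hocc)
      (hG.good h s a).count_near
  · have h0 : M.occ μ h s a = 0 := le_antisymm (not_lt.1 hocc) (M.occ_nonneg μ h s a)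
    rw [hG.unvisited h s a hocc, h0]
    simp

theorem MDP.GoodData.half_le_count (hG : M.GoodData μ C ι L ε D)
    (hs : M.LargeSample μ n C ι L u) {h : Fin H} {s : S} {a : A} (hocc : 0 < M.occ μ h s a) :
    n * M.occ μ h s a / 2 ≤ (count D h s a : ℝ) := by
  have h1 := (abs_le.1 (hG.abs_count_sub hs h s a)).1
  have hN := hs.expCount_pos hocc
  have hu := mul_le_mul_of_nonneg_right hs.u_le' hN.le
  linarith

theorem MDP.GoodData.count_ne_zero (hG : M.GoodData μ C ι L ε D)
    (hs : M.LargeSample μ n C ι L u) {h : Fin H} {s : S} {a : A} (hocc : 0 < M.occ μ h s a) :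
    count D h s a ≠ 0 := by
  intro h0
  have h1 := hG.half_le_count hs hocc
  rw [h0] at h1
  have := hs.expCount_pos hocc
  simp at h1
  linarith

theorem MDP.coveredValue_mem' (M : MDP S A H) (μ : Policy S A H) (h : Fin H) (z : S) :
    0 ≤ M.coveredValue μ (h + 1) z ∧ M.coveredValue μ (h + 1) z ≤ H := by
  have h1 := M.coveredValue_mem μ (h + 1) h.2 z
  exact ⟨h1.1, h1.2.trans (by simp; positivity)⟩

theorem pessValue_mem' (C ι : ℝ) (D : Fin n → Episode S A H) (h : Fin H) (z : S) :
    0 ≤ pessValue C ι D (h + 1) z ∧ pessValue C ι D (h + 1) z ≤ H := by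
  have h1 := pessValue_mem C ι D (h + 1) h.2 z
  exact ⟨h1.1, h1.2.trans (by simp; positivity)⟩

theorem MDP.rewardVar_le (M : MDP S A H) (h : Fin H) (s : S) (a : A) : M.rewardVar h s a ≤ 1 := by
  have := M.rewardLaw_prob h s a
  have h1 := integral_mono_of_nonneg (μ := M.rewardLaw h s a)
    (f := fun x : ℝ => (x - M.reward h s a) ^ 2) (g := fun _ => (1 : ℝ))
    (Filter.Eventually.of_forall fun x => sq_nonneg _) (integrable_const _)
    ((M.rewardLaw_bdd h s a).mono fun x hx => by
      dsimp only
      rw [← sq_abs]; exact pow_le_one₀ (abs_nonneg _) (M.abs_sub_reward_le h s a hx))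
  exact h1.trans (by simp)

theorem MDP.transVar_le (M : MDP S A H) (h : Fin H) {V : S → ℝ} {b : ℝ}
    (hV : ∀ z, 0 ≤ V z ∧ V z ≤ b) (s : S) (a : A) : M.transVar h V s a ≤ b ^ 2 :=
  simplex_sum_le _ fun z => by
    rw [← sq_abs]; exact pow_le_pow_left₀ (abs_nonneg _) (M.abs_sub_transMean_le h hV s a z) 2

theorem MDP.GoodData.reward_mean_le (hG : M.GoodData μ C ι L ε D)
    (hs : M.LargeSample μ n C ι L u) {h : Fin H} {s : S} {a : A} (hocc : 0 < M.occ μ h s a) :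
    |sampleMean (visits D h s a) fun τ => (D τ).2.2 h - M.reward h s a| ≤
      3 * √(M.rewardVar h s a) * u + 6 * 1 * u ^ 2 := by
  have h1 := (hG.good h s a).reward_mean
  rw [← mul_assoc (n : ℝ)] at h1
  exact abs_div_count_le hs.u_pos (hs.L_le h s a hocc) (hs.expCount_pos hocc)
    (hG.half_le_count hs hocc) (M.rewardVar_nonneg h s a) zero_le_one h1

theorem MDP.GoodData.next_mean_le (hG : M.GoodData μ C ι L ε D)
    (hs : M.LargeSample μ n C ι L u) {h : Fin H} {s : S} {a : A} (hocc : 0 < M.occ μ h s a) :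
    |sampleMean (visits D h s a) fun τ => M.coveredValue μ (h + 1) ((D τ).1 h.succ) -
        M.transMean h (M.coveredValue μ (h + 1)) s a| ≤
      3 * √(M.transVar h (M.coveredValue μ (h + 1)) s a) * u + 6 * H * u ^ 2 := by
  have h1 := (hG.good h s a).next_mean
  rw [← mul_assoc (n : ℝ)] at h1
  exact abs_div_count_le hs.u_pos (hs.L_le h s a hocc) (hs.expCount_pos hocc)
    (hG.half_le_count hs hocc) (M.transVar_nonneg h _ s a) (Nat.cast_nonneg H) h1

theorem MDP.GoodData.abs_empBackup_coveredValue_sub (hG : M.GoodData μ C ι L ε D)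
    (hs : M.LargeSample μ n C ι L u) {h : Fin H} {s : S} {a : A} (hocc : 0 < M.occ μ h s a) :
    |empBackup D h (M.coveredValue μ (h + 1)) s a -
      M.backup h (M.coveredValue μ (h + 1)) s a| ≤ 7 * H * u := by
  have hc := hG.count_ne_zero hs hocc
  have hT := visits_nonempty hc
  have h1 := hG.reward_mean_le hs hocc
  have h2 := hG.next_mean_le hs hocc
  have h3 : √(M.rewardVar h s a) ≤ 1 := Real.sqrt_le_one.2 (M.rewardVar_le h s a)
  have h4 : √(M.transVar h (M.coveredValue μ (h + 1)) s a) ≤ H := by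
    rw [Real.sqrt_le_left (Nat.cast_nonneg H)]
    exact M.transVar_le h (M.coveredValue_mem' μ h) s a
  rw [sampleMean_sub_const hT] at h1 h2
  rw [empBackup_eq hc, sampleMean_add]
  have h5 : M.backup h (M.coveredValue μ (h + 1)) s a =
      M.reward h s a + M.transMean h (M.coveredValue μ (h + 1)) s a := rfl
  rw [h5, add_sub_add_comm]
  refine (abs_add_le _ _).trans ((add_le_add h1 h2).trans ?_)
  have hu := hs.u_pos
  have hu1 := hs.u_le'
  have hH := hs.one_le
  have e1 : √(M.rewardVar h s a) * u ≤ H * u := by gcongr; linarith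
  have e2 : √(M.transVar h (M.coveredValue μ (h + 1)) s a) * u ≤ H * u := by gcongr
  have e3 : u ^ 2 ≤ H * u * (1 / 100) := by nlinarith [mul_pos hu hu]
  have e4 : H * u ^ 2 ≤ H * u * (1 / 100) := by nlinarith [mul_pos hu (by linarith : (0 : ℝ) < H)]
  nlinarith

theorem MDP.GoodData.abs_empVar_coveredValue_sub (hG : M.GoodData μ C ι L ε D)
    (hs : M.LargeSample μ n C ι L u) {h : Fin H} {s : S} {a : A} (hocc : 0 < M.occ μ h s a) :
    |√(empVar D h (M.coveredValue μ (h + 1)) s a) -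
      √(M.bellmanVar h (M.coveredValue μ (h + 1)) s a)| ≤ 11 * (H * u) := by
  have hc := hG.count_ne_zero hs hocc
  have hT := visits_nonempty hc
  have hu := hs.u_pos
  have hu1 := hs.u_le'
  have hH := hs.one_le
  set V := M.coveredValue μ (h + 1)
  set T := visits D h s a
  have hc2 := hG.half_le_count hs hocc
  have hrv := M.rewardVar_nonneg h s a
  have htv := M.transVar_nonneg h V s a
  have hr : |sampleVar T (fun τ => (D τ).2.2 h) - M.rewardVar h s a| ≤
      3 * 1 * √(M.rewardVar h s a) * u + 22 * 1 ^ 2 * u ^ 2 := by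
    rw [sampleVar_eq hT _ (M.reward h s a)]
    refine abs_sub_sq_le hu hu1 zero_le_one (by simpa using M.rewardVar_le h s a)
      (hG.reward_mean_le hs hocc) ?_
    rw [← sampleMean_sub_const hT]
    have h1 := (hG.good h s a).reward_sq
    rw [← mul_assoc (n : ℝ)] at h1
    exact abs_div_count_le hu (hs.L_le h s a hocc) (hs.expCount_pos hocc) hc2
      (mul_nonneg (sq_nonneg _) hrv) (sq_nonneg _) h1
  have hv : |sampleVar T (fun τ => V ((D τ).1 h.succ)) - M.transVar h V s a| ≤
      3 * H * √(M.transVar h V s a) * u + 22 * (H : ℝ) ^ 2 * u ^ 2 := by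
    rw [sampleVar_eq hT _ (M.transMean h V s a)]
    refine abs_sub_sq_le hu hu1 (by linarith) (M.transVar_le h (M.coveredValue_mem' μ h) s a)
      (hG.next_mean_le hs hocc) ?_
    rw [← sampleMean_sub_const hT]
    have h1 := (hG.good h s a).next_sq
    rw [← mul_assoc (n : ℝ)] at h1
    exact abs_div_count_le hu (hs.L_le h s a hocc) (hs.expCount_pos hocc) hc2
      (mul_nonneg (sq_nonneg _) htv) (sq_nonneg _) h1
  have hE : 0 ≤ empVar D h V s a := by
    rw [empVar_eq hc]; exact add_nonneg (sampleVar_nonneg _ _) (sampleVar_nonneg _ _)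
  refine abs_sqrt_sub_sqrt_le hE (M.bellmanVar_nonneg h V s a) (by positivity) ?_
  rw [empVar_eq hc, M.bellmanVar_eq, add_sub_add_comm]
  refine (abs_add_le _ _).trans ((add_le_add hr hv).trans ?_)
  have e1 : √(M.rewardVar h s a) ≤ √(M.rewardVar h s a + M.transVar h V s a) :=
    Real.sqrt_le_sqrt (by linarith)
  have e2 : √(M.transVar h V s a) ≤ √(M.rewardVar h s a + M.transVar h V s a) :=
    Real.sqrt_le_sqrt (by linarith)
  have e3 : √(M.rewardVar h s a) * u ≤ H * u * √(M.rewardVar h s a + M.transVar h V s a) := by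
    calc √(M.rewardVar h s a) * u ≤ √(M.rewardVar h s a + M.transVar h V s a) * u := by gcongr
      _ ≤ √(M.rewardVar h s a + M.transVar h V s a) * (H * u) := by
        gcongr; nlinarith
      _ = _ := by ring
  have e4 : H * √(M.transVar h V s a) * u ≤ H * u * √(M.rewardVar h s a + M.transVar h V s a) := by
    calc H * √(M.transVar h V s a) * u = H * u * √(M.transVar h V s a) := by ring
      _ ≤ _ := by gcongr
  have e5 : u ^ 2 ≤ (H * u) ^ 2 := pow_le_pow_left₀ hu.le (by nlinarith) 2
  rw [mul_pow] at e5 ⊢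
  linarith

/-- Pairs that `μ` does not cover have zero pessimistic value. -/
theorem MDP.GoodData.pessQ_eq_zero (hG : M.GoodData μ C ι L ε D)
    (hs : M.LargeSample μ n C ι L u) {h : Fin H} {s : S} {a : A} (hocc : ¬0 < M.occ μ h s a) :
    pessQ C ι D h (pessValue C ι D (h + 1)) s a = 0 := by
  have hc := hG.unvisited h s a hocc
  have h1 : empBackup D h (pessValue C ι D (h + 1)) s a ≤ H := by
    rw [empBackup, empReward, if_pos hc, zero_add]
    simp only [empTrans, if_pos hc]
    have hS : (0 : ℝ) < Fintype.card S := by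
      have : Nonempty S := ⟨s⟩
      exact_mod_cast Fintype.card_pos
    calc ∑ z, 1 / (Fintype.card S : ℝ) * pessValue C ι D (h + 1) z
        ≤ ∑ _z : S, 1 / (Fintype.card S : ℝ) * H :=
          Finset.sum_le_sum fun z _ => mul_le_mul_of_nonneg_left (pessValue_mem' C ι D h z).2
            (by positivity)
      _ = H := by
          rw [Finset.sum_const, Finset.card_univ, nsmul_eq_mul]
          field_simp
  -- Since `C ≥ 2` and `ι ≥ 1/2`, the penalty `CHι` outweighs the default estimate, which has zero
  -- reward and uniform transitions and so is at most `H`.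
  have h2 : (H : ℝ) ≤ bonus C ι D h (pessValue C ι D (h + 1)) s a := by
    rw [bonus, if_pos hc]
    have := hs.two_le_C
    have := hs.half_le_ι
    have := hs.one_le
    have h3 : 1 ≤ C * ι := by nlinarith
    nlinarith
  exact max_eq_right ((min_le_left _ _).trans (by linarith))

theorem MDP.GoodData.bonus_le (hG : M.GoodData μ C ι L ε D)
    (hs : M.LargeSample μ n C ι L u) {h : Fin H} {s : S} {a : A} (hocc : 0 < M.occ μ h s a) :
    0 ≤ bonus C ι D h (pessValue C ι D (h + 1)) s a ∧
      bonus C ι D h (pessValue C ι D (h + 1)) s a ≤ 5 * H * u := by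
  have hc := hG.count_ne_zero hs hocc
  have hT := visits_nonempty hc
  have hu := hs.u_pos
  have hu1 := hs.u_le'
  have hH := hs.one_le
  have hι : 0 ≤ ι := by linarith [hs.half_le_ι]
  have hc2 := sqrt_div_count_le hu (hs.L_le h s a hocc) (hs.expCount_pos hocc)
    (hG.half_le_count hs hocc) hs.ι_le
  have hv : empVar D h (pessValue C ι D (h + 1)) s a ≤ 2 * (H : ℝ) ^ 2 := by
    rw [empVar_eq hc]
    have h1 := sampleVar_le_sq hT (x := fun τ => (D τ).2.2 h) (c := 0) (b := 1) fun τ _ => by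
      have := hG.reward_mem τ h
      rw [sub_zero, abs_le]; exact ⟨by linarith [this.1], this.2⟩
    have h2 := sampleVar_le_sq hT (x := fun τ => pessValue C ι D (h + 1) ((D τ).1 h.succ))
      (c := 0) (b := H) fun τ _ => by
        have := pessValue_mem' C ι D h ((D τ).1 h.succ)
        rw [sub_zero, abs_le]; exact ⟨by linarith [this.1], this.2⟩
    nlinarith
  rw [bonus, if_neg hc]
  refine ⟨by positivity, ?_⟩
  have h1 : √(empVar D h (pessValue C ι D (h + 1)) s a * ι / count D h s a) ≤ 2 * H * u := by
    rw [Real.sqrt_le_left (by positivity), mul_div_assoc]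
    calc _ ≤ 2 * (H : ℝ) ^ 2 * (2 * u ^ 2) :=
          mul_le_mul hv hc2.1 (by positivity) (by positivity)
      _ = _ := by ring
  have h2 : 14 * H * ι / count D h s a ≤ 14 * H * (2 * u ^ 2) := by
    rw [mul_div_assoc]; exact mul_le_mul_of_nonneg_left hc2.1 (by positivity)
  nlinarith [mul_pos (by linarith : (0 : ℝ) < H) hu]

theorem abs_empBackup_sub_le {h : Fin H} {s : S} {a : A} (hc : count D h s a ≠ 0) {V W : S → ℝ}
    {b : ℝ} (hVW : ∀ z, |V z - W z| ≤ b) : |empBackup D h V s a - empBackup D h W s a| ≤ b := by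
  have hT := visits_nonempty hc
  rw [empBackup_eq hc, empBackup_eq hc, sampleMean_add, sampleMean_add, add_sub_add_left_eq_sub]
  rw [abs_le]
  constructor
  · have : sampleMean (visits D h s a) (fun τ => W ((D τ).1 h.succ) + -b) ≤
        sampleMean (visits D h s a) fun τ => V ((D τ).1 h.succ) :=
      sampleMean_mono fun τ _ => by linarith [(abs_le.1 (hVW ((D τ).1 h.succ))).1]
    rw [sampleMean_add, sampleMean_const hT] at this
    linarith
  · have : sampleMean (visits D h s a) (fun τ => V ((D τ).1 h.succ)) ≤
        sampleMean (visits D h s a) fun τ => W ((D τ).1 h.succ) + b :=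
      sampleMean_mono fun τ _ => by linarith [(abs_le.1 (hVW ((D τ).1 h.succ))).2]
    rw [sampleMean_add, sampleMean_const hT] at this
    linarith

/-- `12 = 7 + 5`: the sampling error at the deterministic covered value and the size of the bonus.
The truncation does no harm because the covered backup lies in the truncation range. At uncovered
pairs both sides vanish, which is why the comparison is with the covered value. -/
theorem MDP.GoodData.abs_pessQ_sub (hG : M.GoodData μ C ι L ε D)
    (hs : M.LargeSample μ n C ι L u) (h : Fin H) {b : ℝ} (hb : 0 ≤ b)
    (hV : ∀ z, |pessValue C ι D (h + 1) z - M.coveredValue μ (h + 1) z| ≤ b) (s : S) (a : A) :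
    |pessQ C ι D h (pessValue C ι D (h + 1)) s a -
      M.coveredBackup μ h (M.coveredValue μ (h + 1)) s a| ≤ b + 12 * H * u := by
  have hu := hs.u_pos
  have hH := hs.one_le
  by_cases hocc : 0 < M.occ μ h s a
  · have hc := hG.count_ne_zero hs hocc
    have h1 := abs_le.1 (abs_empBackup_sub_le hc hV (s := s) (a := a))
    have h2 := abs_le.1 (hG.abs_empBackup_coveredValue_sub hs hocc)
    have h3 := hG.bonus_le hs hocc
    have h4 := M.coveredBackup_mem μ h (fun z => M.coveredValue_mem μ (h + 1) h.2 z) s a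
    rw [M.coveredBackup_of_pos μ hocc] at h4 ⊢
    rw [abs_le]
    unfold pessQ
    constructor
    · rw [neg_le_sub_iff_le_add, ← sub_le_iff_le_add]
      refine le_trans ?_ (le_max_left _ _)
      refine le_min ?_ ?_ <;> linarith [mul_pos (by linarith : (0 : ℝ) < H) hu]
    · rw [sub_le_iff_le_add]
      refine max_le ((min_le_left _ _).trans ?_) ?_ <;>
        linarith [mul_pos (by linarith : (0 : ℝ) < H) hu]
  · rw [hG.pessQ_eq_zero hs hocc, M.coveredBackup_of_not_pos μ hocc, sub_zero, abs_zero]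
    positivity

/-- The error grows by `12Hu` per step, a maximum being 1-Lipschitz. First order accuracy suffices,
since this gap is multiplied by a further factor `u` later. -/
theorem MDP.GoodData.abs_pessValue_sub (hG : M.GoodData μ C ι L ε D)
    (hs : M.LargeSample μ n C ι L u) : ∀ h ≤ H, ∀ s,
    |pessValue C ι D h s - M.coveredValue μ h s| ≤ ((H : ℝ) - (h : ℕ)) * (12 * H * u) := by
  have hu := hs.u_pos
  have hH := hs.one_le
  refine backward_induction (fun s => by rw [pessValue_end, M.coveredValue_end]; simp)
    fun h ih s => ?_
  have hh1 : ((h : ℕ) : ℝ) + 1 ≤ H := by exact_mod_cast h.2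
  have key := hG.abs_pessQ_sub hs h (b := ((H : ℝ) - ((h : ℕ) + 1 : ℕ)) * (12 * H * u))
    (by push_cast; exact mul_nonneg (by linarith) (by positivity)) ih s
  have hb : ((H : ℝ) - ((h : ℕ) + 1 : ℕ)) * (12 * H * u) + 12 * H * u =
      ((H : ℝ) - (h : ℕ)) * (12 * H * u) := by push_cast; ring
  rw [hb] at key
  rw [abs_le]
  constructor
  · rw [neg_le_sub_iff_le_add, M.coveredValue_step]
    refine Finset.sup'_le _ _ fun a _ => ?_
    have h1 := (abs_le.1 (key a)).1
    have h2 := pessQ_le_pessValue C ι D h s a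
    linarith
  · rw [sub_le_iff_le_add, pessValue_step]
    refine Finset.sup'_le _ _ fun a _ => ?_
    have h1 := (abs_le.1 (key a)).2
    have h2 := M.coveredBackup_le_coveredValue μ h s a
    linarith

end Deterministic

/-! ### Second order control of the gap, pessimism, and the regret bound -/

section Pessimism

variable {S A : Type*} [Fintype S] [Fintype A] [DecidableEq S] [DecidableEq A] [Nonempty A]
  {H n : ℕ} {M : MDP S A H} {μ : Policy S A H} {C ι L u ε : ℝ} {D : Fin n → Episode S A H}

/-- The number of episodes whose state after step `h` is `z`. -/
def nextCount (D : Fin n → Episode S A H) (h : Fin H) (z : S) : ℝ :=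
  ∑ τ, if (D τ).1 h.succ = z then 1 else 0

theorem sum_next (D : Fin n → Episode S A H) (h : Fin H) (F : S → ℝ) :
    ∑ τ, F ((D τ).1 h.succ) = ∑ z, nextCount D h z * F z := by
  simp only [nextCount, Finset.sum_mul]
  rw [Finset.sum_comm]
  refine Finset.sum_congr rfl fun τ _ => ?_
  simp

theorem nextCount_eq_sum_count (D : Fin n → Episode S A H) {h : Fin H} (hh : (h : ℕ) + 1 < H)
    (z : S) : nextCount D h z = ∑ a, (count D ⟨h + 1, hh⟩ z a : ℝ) := by
  have h1 : ∀ a, (count D ⟨h + 1, hh⟩ z a : ℝ) =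
      ∑ τ, if (D τ).1 h.succ = z then (if (D τ).2.1 ⟨h + 1, hh⟩ = a then 1 else 0) else 0 := by
    intro a
    rw [count, visits, Finset.card_filter]
    push_cast
    refine Finset.sum_congr rfl fun τ _ => ?_
    rw [← ite_and]
    rfl
  simp only [h1]
  rw [Finset.sum_comm]
  refine Finset.sum_congr rfl fun τ _ => ?_
  split_ifs <;> simp

theorem MDP.GoodData.abs_nextCount_sub (hG : M.GoodData μ C ι L ε D)
    (hs : M.LargeSample μ n C ι L u) {h : Fin H} (hh : (h : ℕ) + 1 < H) (z : S) :
    |nextCount D h z - n * M.stateOcc μ (h + 1) z| ≤ 2 * u * (n * M.stateOcc μ (h + 1) z) := by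
  have h1 : M.stateOcc μ (h + 1) z = ∑ a, M.occ μ ⟨h + 1, hh⟩ z a :=
    (M.sum_occ μ ⟨h + 1, hh⟩ z).symm
  rw [nextCount_eq_sum_count D hh, h1, Finset.mul_sum, ← Finset.sum_sub_distrib, Finset.mul_sum]
  exact (Finset.abs_sum_le_sum_abs _ _).trans
    (Finset.sum_le_sum fun a _ => hG.abs_count_sub hs ⟨h + 1, hh⟩ z a)

theorem MDP.transMean_abs_le (M : MDP S A H) (h : Fin H) {w : S → ℝ} {b : ℝ}
    (hw : ∀ z, |w z| ≤ b) (s : S) (a : A) : |M.transMean h w s a| ≤ b :=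
  abs_le.2 ⟨le_simplex_sum _ fun z => (abs_le.1 (hw z)).1,
    simplex_sum_le _ fun z => (abs_le.1 (hw z)).2⟩

/-- The sampling error of the data-dependent part of the value estimate is of second order,
although that part is not independent of the sampled transitions. -/
theorem MDP.GoodData.abs_gap_mean_le (hG : M.GoodData μ C ι L ε D)
    (hs : M.LargeSample μ n C ι L u) (hε : 0 < ε) {h : Fin H} {s : S} {a : A}
    (hocc : 0 < M.occ μ h s a) {w : S → ℝ}
    (hwdef : w = fun z => pessValue C ι D (h + 1) z - M.coveredValue μ (h + 1) z)
    (hw : ∀ z, |w z| ≤ ε) :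
    |sampleMean (visits D h s a) fun τ => w ((D τ).1 h.succ) - M.transMean h w s a| ≤
      20 * ε * u := by
  have hu := hs.u_pos
  have hu1 := hs.u_le'
  rcases Nat.lt_or_ge ((h : ℕ) + 1) H with hh | hh
  swap
  -- After the last step there are no action counts that could control the next state, but both
  -- value functions vanish.
  · have hH : (h : ℕ) + 1 = H := le_antisymm h.2 hh
    have hw0 : ∀ z, w z = 0 := fun z => by
      rw [hwdef, hH, pessValue_end, M.coveredValue_end]; simp
    simp only [MDP.transMean, hw0, mul_zero, Finset.sum_const_zero, sub_zero]
    simp only [sampleMean, Finset.sum_const_zero, zero_div, abs_zero]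
    positivity
  set N := n * M.occ μ h s a with hN
  have hN0 : 0 < N := hs.expCount_pos hocc
  have hc := hG.half_le_count hs hocc
  set b := M.backProb μ h s a with hb
  have hb0 : ∀ z, 0 ≤ b z := M.backProb_nonneg μ h s a
  set g : S → ℝ := fun z => w z - M.transMean h w s a with hg
  have hg2 : ∀ z, |g z| ≤ 2 * ε := fun z =>
    (abs_sub _ _).trans (by linarith [hw z, M.transMean_abs_le h hw s a])
  have hclip : ∀ z, g z = 2 * ε * M.clippedGap μ C ι ε h s a D z := by
    intro z
    have h1 : M.clippedGap μ C ι ε h s a D z = max (min (g z / (2 * ε)) 1) (-1) := by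
      simp only [MDP.clippedGap, hg, hwdef]
    have h2 := abs_le.1 (hg2 z)
    rw [h1, min_eq_left (by rw [div_le_one (by positivity)]; exact h2.2),
      max_eq_left (by rw [le_div_iff₀ (by positivity)]; linarith [h2.1])]
    field_simp
  have hbP : ∀ z, n * M.stateOcc μ (h + 1) z * b z = N * M.trans h s a z := fun z => by
    rw [mul_assoc, M.stateOcc_mul_backProb, hN, mul_assoc]
  have hdev : ∀ z, |nextCount D h z - n * M.stateOcc μ (h + 1) z| * b z ≤
      2 * u * (N * M.trans h s a z) := fun z => by
    rw [← hbP, ← mul_assoc]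
    exact mul_le_mul_of_nonneg_right (hG.abs_nextCount_sub hs hh z) (hb0 z)
  -- The sum of the conditional visit probabilities is close to the expected count, because the
  -- next-state counts have relative error `2u`.
  have hsumb : ∑ τ, b ((D τ).1 h.succ) ≤ 2 * N := by
    rw [sum_next D h b]
    calc ∑ z, nextCount D h z * b z ≤ ∑ z, (1 + 2 * u) * N * M.trans h s a z := by
          refine Finset.sum_le_sum fun z _ => ?_
          have h1 := hdev z
          have h2 := hbP z
          have h3 := mul_le_mul_of_nonneg_right
            (le_abs_self (nextCount D h z - n * M.stateOcc μ (h + 1) z)) (hb0 z)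
          rw [sub_mul] at h3
          linarith
      _ = (1 + 2 * u) * N := by rw [← Finset.mul_sum, simplex_sum, mul_one]
      _ ≤ 2 * N := by nlinarith
  have hsumb0 : 0 ≤ ∑ τ, b ((D τ).1 h.succ) := Finset.sum_nonneg fun τ _ => hb0 _
  -- With expected next-state counts this sum is `N` times the integral of the centered `g` under
  -- the transition law, which is zero. Only the relative errors `2u` of the counts remain; weighted
  -- by `b` they add up to `2uN` without a factor S.
  have hsecond : |∑ τ, b ((D τ).1 h.succ) * g ((D τ).1 h.succ)| ≤ 4 * u * ε * N := by
    rw [sum_next D h fun z => b z * g z]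
    have h1 : ∑ z, nextCount D h z * (b z * g z) =
        ∑ z, (nextCount D h z - n * M.stateOcc μ (h + 1) z) * b z * g z := by
      have h2 : ∑ z, n * M.stateOcc μ (h + 1) z * b z * g z = 0 := by
        simp only [hbP, mul_assoc, ← Finset.mul_sum]
        rw [M.sum_trans_mul_sub h w s a, mul_zero]
      rw [← sub_zero (∑ z, nextCount D h z * (b z * g z)), ← h2, ← Finset.sum_sub_distrib]
      exact Finset.sum_congr rfl fun z _ => by ring
    rw [h1]
    refine (Finset.abs_sum_le_sum_abs _ _).trans ?_
    calc ∑ z, |(nextCount D h z - n * M.stateOcc μ (h + 1) z) * b z * g z|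
        ≤ ∑ z, 2 * u * (N * M.trans h s a z) * (2 * ε) := by
          refine Finset.sum_le_sum fun z _ => ?_
          rw [abs_mul, abs_mul, abs_of_nonneg (hb0 z)]
          exact mul_le_mul (hdev z) (hg2 z) (abs_nonneg _)
            (mul_nonneg (by positivity) (mul_nonneg hN0.le (simplex_nonneg _ z)))
      _ = 4 * u * ε * N * ∑ z, M.trans h s a z := by
          rw [Finset.mul_sum]; exact Finset.sum_congr rfl fun z _ => by ring
      _ = _ := by rw [simplex_sum, mul_one]
  have hLpos : 0 < L := by linarith [hs.half_le_ι, hs.ι_le]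
  have hLN := hs.L_le h s a hocc
  rw [← hN] at hLN
  set l := √(L / N) with hl
  have hl0 : 0 < l := Real.sqrt_pos.2 (div_pos hLpos hN0)
  have hl2 : l ^ 2 = L / N := Real.sq_sqrt (by positivity)
  have hlu : l ≤ u := by
    rw [hl, Real.sqrt_le_left hu.le, div_le_iff₀ hN0]
    linarith
  have hLl : L / l ≤ u * N := by
    have : L = l ^ 2 * N := by rw [hl2]; field_simp
    rw [div_le_iff₀ hl0]
    calc L = l * N * l := by rw [this]; ring
      _ ≤ u * N * l := by gcongr
  have hfirst := (hG.good h s a).later hocc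
  rw [← hN, ← hl, ← hb] at hfirst
  -- The visit indicator is its conditional mean `b` plus a deviation; the deviation is controlled
  -- by `later`, the mean by `hsecond`.
  have hsum : ∑ τ ∈ visits D h s a, g ((D τ).1 h.succ) =
      2 * ε * ∑ τ, ((visitSet h s a).indicator (fun _ => (1 : ℝ)) (D τ) - b ((D τ).1 h.succ)) *
        M.clippedGap μ C ι ε h s a D ((D τ).1 h.succ) +
      ∑ τ, b ((D τ).1 h.succ) * g ((D τ).1 h.succ) := by
    rw [visits, Finset.sum_filter, Finset.mul_sum, ← Finset.sum_add_distrib]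
    refine Finset.sum_congr rfl fun τ _ => ?_
    have h1 := hclip ((D τ).1 h.succ)
    by_cases hτ : D τ ∈ visitSet h s a
    · rw [Set.indicator_of_mem hτ, if_pos (by exact hτ), h1]; ring
    · rw [Set.indicator_of_notMem hτ, if_neg (by exact hτ), h1]; ring
  change |(∑ τ ∈ visits D h s a, g ((D τ).1 h.succ)) / count D h s a| ≤ _
  have hc0 : (0 : ℝ) < count D h s a := by linarith
  rw [hsum, abs_div, abs_of_pos hc0, div_le_iff₀ hc0]
  have h5 : l * ∑ τ, b ((D τ).1 h.succ) + L / l ≤ 3 * u * N := by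
    have : l * ∑ τ, b ((D τ).1 h.succ) ≤ u * (2 * N) := mul_le_mul hlu hsumb hsumb0 hu.le
    linarith
  -- The total `10εuN` becomes `20εu` on division by a count of at least `N / 2`.
  calc _ ≤ 2 * ε * (3 * u * N) + 4 * u * ε * N := by
        refine (abs_add_le _ _).trans (add_le_add ?_ hsecond)
        rw [abs_mul, abs_of_pos (by positivity : 0 < 2 * ε)]
        exact mul_le_mul_of_nonneg_left (hfirst.trans h5) (by positivity)
    _ = 20 * ε * u * (N / 2) := by ring
    _ ≤ _ := by gcongr

theorem MDP.GoodData.abs_gap_le (hG : M.GoodData μ C ι L ε D)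
    (hs : M.LargeSample μ n C ι L u) (h : Fin H) (z : S) :
    |pessValue C ι D (h + 1) z - M.coveredValue μ (h + 1) z| ≤ 12 * (H : ℝ) ^ 2 * u := by
  refine (hG.abs_pessValue_sub hs (h + 1) h.2 z).trans ?_
  have hu := hs.u_pos
  have h1 : (H : ℝ) - ((h : ℕ) + 1 : ℕ) ≤ H := by simp; positivity
  calc _ ≤ (H : ℝ) * (12 * H * u) := mul_le_mul_of_nonneg_right h1 (by positivity)
    _ = _ := by ring

/-- Splits the estimate into the deterministic covered value, left for sharp Bernstein bounds, and
the gap, whose sampling error is `20 · 12 H² u · u`. -/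
theorem MDP.GoodData.empBackup_sub (hG : M.GoodData μ C ι L (12 * (H : ℝ) ^ 2 * u) D)
    (hs : M.LargeSample μ n C ι L u) {h : Fin H} {s : S} {a : A} (hocc : 0 < M.occ μ h s a) :
    |(empBackup D h (pessValue C ι D (h + 1)) s a - M.backup h (pessValue C ι D (h + 1)) s a) -
      (∑ τ ∈ visits D h s a, ((D τ).2.2 h + M.coveredValue μ (h + 1) ((D τ).1 h.succ) -
        M.backup h (M.coveredValue μ (h + 1)) s a)) / count D h s a| ≤
      240 * ((H : ℝ) ^ 2 * u ^ 2) := by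
  have hc := hG.count_ne_zero hs hocc
  have hT := visits_nonempty hc
  have hH := hs.one_le
  have hu := hs.u_pos
  set w : S → ℝ := fun z => pessValue C ι D (h + 1) z - M.coveredValue μ (h + 1) z with hw
  have h1 := hG.abs_gap_mean_le hs (by positivity) hocc hw (hG.abs_gap_le hs h)
  have h2 : (∑ τ ∈ visits D h s a, ((D τ).2.2 h + M.coveredValue μ (h + 1) ((D τ).1 h.succ) -
      M.backup h (M.coveredValue μ (h + 1)) s a)) / count D h s a =
      empBackup D h (M.coveredValue μ (h + 1)) s a -
        M.backup h (M.coveredValue μ (h + 1)) s a := by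
    rw [empBackup_eq hc, ← sampleMean_sub_const hT]
    rfl
  have h3 : M.transMean h w s a = M.backup h (pessValue C ι D (h + 1)) s a -
      M.backup h (M.coveredValue μ (h + 1)) s a := by
    simp only [MDP.transMean, MDP.backup, hw, mul_sub, Finset.sum_sub_distrib]
    ring
  have h4 : empBackup D h (pessValue C ι D (h + 1)) s a -
      empBackup D h (M.coveredValue μ (h + 1)) s a =
      sampleMean (visits D h s a) fun τ => w ((D τ).1 h.succ) := by
    rw [empBackup, empBackup, add_sub_add_left_eq_sub, ← sum_empTrans_mul hc w]
    simp only [hw, mul_sub, Finset.sum_sub_distrib]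
  rw [sampleMean_sub_const hT, ← h4, h3] at h1
  rw [h2]
  have e : empBackup D h (pessValue C ι D (h + 1)) s a -
      M.backup h (pessValue C ι D (h + 1)) s a -
      (empBackup D h (M.coveredValue μ (h + 1)) s a - M.backup h (M.coveredValue μ (h + 1)) s a) =
      empBackup D h (pessValue C ι D (h + 1)) s a - empBackup D h (M.coveredValue μ (h + 1)) s a -
      (M.backup h (pessValue C ι D (h + 1)) s a - M.backup h (M.coveredValue μ (h + 1)) s a) := by
    ring
  rw [e]
  refine h1.trans (le_of_eq ?_)
  ring

/-- `23 = 11 + 12`: the sampling error at the covered value, with `Hu ≤ H² u`, and the sup norm of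
the gap. -/
theorem MDP.GoodData.abs_sqrt_empVar_sub (hG : M.GoodData μ C ι L ε D)
    (hs : M.LargeSample μ n C ι L u) {h : Fin H} {s : S} {a : A} (hocc : 0 < M.occ μ h s a) :
    |√(empVar D h (pessValue C ι D (h + 1)) s a) -
      √(M.bellmanVar h (M.coveredValue μ (h + 1)) s a)| ≤ 23 * ((H : ℝ) ^ 2 * u) := by
  have hc := hG.count_ne_zero hs hocc
  have hT := visits_nonempty hc
  have hH := hs.one_le
  have hu := hs.u_pos
  have hgap := hG.abs_gap_le hs h
  have h1 := abs_le.1 (hG.abs_empVar_coveredValue_sub hs hocc)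
  have h0 := sampleVar_nonneg (visits D h s a) fun τ => (D τ).2.2 h
  have h2 := sqrt_add_sampleVar_add_le hT
    (x := fun τ => M.coveredValue μ (h + 1) ((D τ).1 h.succ))
    (w := fun τ => pessValue C ι D (h + 1) ((D τ).1 h.succ) -
      M.coveredValue μ (h + 1) ((D τ).1 h.succ)) h0
    (by positivity : 0 ≤ 12 * (H : ℝ) ^ 2 * u) fun τ _ => hgap _
  have h3 := sqrt_add_sampleVar_add_le hT
    (x := fun τ => pessValue C ι D (h + 1) ((D τ).1 h.succ))
    (w := fun τ => M.coveredValue μ (h + 1) ((D τ).1 h.succ) -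
      pessValue C ι D (h + 1) ((D τ).1 h.succ)) h0
    (by positivity : 0 ≤ 12 * (H : ℝ) ^ 2 * u) fun τ _ => by rw [abs_sub_comm]; exact hgap _
  simp only [add_sub_cancel] at h2 h3
  rw [← empVar_eq hc, ← empVar_eq hc] at h2 h3
  have h4 : (H : ℝ) * u ≤ (H : ℝ) ^ 2 * u := by nlinarith
  rw [abs_le]
  constructor <;> linarith [h1.1, h1.2]

theorem MDP.sqrt_bellmanVar_le (M : MDP S A H) (h : Fin H) {V : S → ℝ} (hH : (1 : ℝ) ≤ H)
    (hV : ∀ z, 0 ≤ V z ∧ V z ≤ (H : ℝ)) (s : S) (a : A) : √(M.bellmanVar h V s a) ≤ 2 * H := by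
  rw [Real.sqrt_le_left (by positivity), M.bellmanVar_eq]
  nlinarith [M.rewardVar_le h s a, M.transVar_le h hV s a]

/-- Pessimism, up to a second order term. -/
theorem MDP.GoodData.pessQ_le (hG : M.GoodData μ C ι L (12 * (H : ℝ) ^ 2 * u) D)
    (hs : M.LargeSample μ n C ι L u) (h : Fin H) (s : S) (a : A) :
    pessQ C ι D h (pessValue C ι D (h + 1)) s a ≤
      M.backup h (pessValue C ι D (h + 1)) s a + 348 * ((H : ℝ) ^ 2 * u ^ 2) := by
  have hH := hs.one_le
  have hu := hs.u_pos
  have hu1 := hs.u_le'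
  have hι : 0 ≤ ι := by linarith [hs.half_le_ι]
  have hbn := M.backup_nonneg h (fun z => (pessValue_mem' C ι D h z).1) s a
  by_cases hocc : 0 < M.occ μ h s a
  swap
  · rw [hG.pessQ_eq_zero hs hocc]; positivity
  have hc := hG.count_ne_zero hs hocc
  have hc2 := sqrt_div_count_le hu (hs.L_le h s a hocc) (hs.expCount_pos hocc)
    (hG.half_le_count hs hocc) hs.ι_le
  set σ := √(M.bellmanVar h (M.coveredValue μ (h + 1)) s a) with hσ
  have hσ2 : σ ^ 2 = M.bellmanVar h (M.coveredValue μ (h + 1)) s a :=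
    Real.sq_sqrt (M.bellmanVar_nonneg h _ s a)
  have hσ0 : 0 ≤ σ := Real.sqrt_nonneg _
  have hσH : σ ≤ 2 * H := M.sqrt_bellmanVar_le h hH (M.coveredValue_mem' μ h) s a
  have h1 := (hG.good h s a).upper
  rw [← mul_assoc (n : ℝ), ← hσ2] at h1
  have h2 := bernstein_div_count_le hu hu1 (hs.expCount_pos hocc) (hG.abs_count_sub hs h s a) hι
    hσ0 h1
  have h3 := (abs_le.1 (hG.empBackup_sub hs hocc)).2
  have h4 := (abs_le.1 (hG.abs_sqrt_empVar_sub hs hocc)).1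
  rw [← hσ] at h4
  have hsplit : √(empVar D h (pessValue C ι D (h + 1)) s a * ι / count D h s a) =
      √(empVar D h (pessValue C ι D (h + 1)) s a) * √(ι / count D h s a) := by
    rw [mul_div_assoc, Real.sqrt_mul]
    rw [empVar_eq hc]; exact add_nonneg (sampleVar_nonneg _ _) (sampleVar_nonneg _ _)
  set y := √(empVar D h (pessValue C ι D (h + 1)) s a)
  set q := √(ι / count D h s a)
  have hq0 : 0 ≤ q := Real.sqrt_nonneg _
  have hbonus : bonus C ι D h (pessValue C ι D (h + 1)) s a =
      2 * (y * q) + 14 * H * (ι / count D h s a) := by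
    rw [bonus, if_neg hc, hsplit, mul_div_assoc]
  -- Replaces the true by the empirical standard deviation. The error `23 H² u` meets `q ≤ 2u`,
  -- hence is second order.
  have h5 : σ * q ≤ y * q + 46 * ((H : ℝ) ^ 2 * u ^ 2) := by
    have e1 : σ * q ≤ (y + 23 * ((H : ℝ) ^ 2 * u)) * q :=
      mul_le_mul_of_nonneg_right (by linarith) hq0
    have e2 : 23 * ((H : ℝ) ^ 2 * u) * q ≤ 23 * ((H : ℝ) ^ 2 * u) * (2 * u) :=
      mul_le_mul_of_nonneg_left hc2.2 (by positivity)
    nlinarith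
  have h6 : σ * q * u ≤ 4 * ((H : ℝ) ^ 2 * u ^ 2) := by
    calc σ * q * u ≤ 2 * H * (2 * u) * u := by
          gcongr
          exact hc2.2
      _ = 4 * (H * u ^ 2) := by ring
      _ ≤ _ := by gcongr; nlinarith
  have h7 : 6 * (H : ℝ) * (ι / count D h s a) ≤ 14 * H * (ι / count D h s a) := by
    gcongr; norm_num
  unfold pessQ
  refine max_le ((min_le_left _ _).trans ?_) (by positivity)
  rw [hbonus]
  -- The leading terms cancel against the bonus, and `6H` is covered by its `14H`. What is left is
  -- `240 + 2 · 46 + 4 · 4 = 348`.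
  nlinarith

/-- The price of pessimism: `8 = 5 + 2 · 3/2` from the lower Bernstein bound and the bonus, and `378
= 240 + 2 · 46 + 28 + 18` from the second order terms. The bound is stated with the expected count,
as in the intrinsic term. -/
theorem MDP.GoodData.le_pessQ (hG : M.GoodData μ C ι L (12 * (H : ℝ) ^ 2 * u) D)
    (hs : M.LargeSample μ n C ι L u) {h : Fin H} {s : S} {a : A} (hocc : 0 < M.occ μ h s a) :
    M.backup h (pessValue C ι D (h + 1)) s a -
      8 * √(M.bellmanVar h (M.coveredValue μ (h + 1)) s a * ι / (n * M.occ μ h s a)) -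
      378 * ((H : ℝ) ^ 2 * u ^ 2) ≤ pessQ C ι D h (pessValue C ι D (h + 1)) s a := by
  have hH := hs.one_le
  have hu := hs.u_pos
  have hι : 0 ≤ ι := by linarith [hs.half_le_ι]
  have hc := hG.count_ne_zero hs hocc
  have hN := hs.expCount_pos hocc
  have hhalf := hG.half_le_count hs hocc
  have hc2 := sqrt_div_count_le hu (hs.L_le h s a hocc) hN hhalf hs.ι_le
  have hle := M.backup_le h (fun z => (pessValue_mem C ι D (h + 1) h.2 z).2) s a
  have h1 := (hG.good h s a).lower
  have hsplit' : √(M.bellmanVar h (M.coveredValue μ (h + 1)) s a * ι / (n * M.occ μ h s a)) =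
      √(M.bellmanVar h (M.coveredValue μ (h + 1)) s a) * √(ι / (n * M.occ μ h s a)) := by
    rw [mul_div_assoc, Real.sqrt_mul (M.bellmanVar_nonneg h _ s a)]
  rw [hsplit']
  set σ := √(M.bellmanVar h (M.coveredValue μ (h + 1)) s a) with hσ
  have hσ2 : σ ^ 2 = M.bellmanVar h (M.coveredValue μ (h + 1)) s a :=
    Real.sq_sqrt (M.bellmanVar_nonneg h _ s a)
  have hσ0 : 0 ≤ σ := Real.sqrt_nonneg _
  rw [← mul_assoc (n : ℝ), ← hσ2] at h1
  have h2 := bernstein_div_count_le' hN hhalf hι hσ0 (Nat.cast_nonneg H) h1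
  rw [Finset.sum_neg_distrib, neg_div] at h2
  have h3 := (abs_le.1 (hG.empBackup_sub hs hocc)).1
  have h4 := (abs_le.1 (hG.abs_sqrt_empVar_sub hs hocc)).2
  rw [← hσ] at h4
  have hsplit : √(empVar D h (pessValue C ι D (h + 1)) s a * ι / count D h s a) =
      √(empVar D h (pessValue C ι D (h + 1)) s a) * √(ι / count D h s a) := by
    rw [mul_div_assoc, Real.sqrt_mul]
    rw [empVar_eq hc]; exact add_nonneg (sampleVar_nonneg _ _) (sampleVar_nonneg _ _)
  set y := √(empVar D h (pessValue C ι D (h + 1)) s a)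
  set q := √(ι / count D h s a)
  set q' := √(ι / (n * M.occ μ h s a))
  have hq0 : 0 ≤ q := Real.sqrt_nonneg _
  have hqq : q ≤ 3 / 2 * q' := by
    rw [Real.sqrt_le_left (by positivity)]
    have : q' ^ 2 = ι / (n * M.occ μ h s a) := Real.sq_sqrt (by positivity)
    rw [mul_pow, this]
    calc ι / count D h s a ≤ ι / (n * M.occ μ h s a / 2) := by gcongr
      _ = 2 * (ι / (n * M.occ μ h s a)) := by field_simp
      _ ≤ _ := by
        have : 0 ≤ ι / (n * M.occ μ h s a) := by positivity
        linarith
  have hbonus : bonus C ι D h (pessValue C ι D (h + 1)) s a =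
      2 * (y * q) + 14 * H * (ι / count D h s a) := by
    rw [bonus, if_neg hc, hsplit, mul_div_assoc]
  have h5 : y * q ≤ 3 / 2 * (σ * q') + 46 * ((H : ℝ) ^ 2 * u ^ 2) := by
    have e1 : y * q ≤ (σ + 23 * ((H : ℝ) ^ 2 * u)) * q :=
      mul_le_mul_of_nonneg_right (by linarith) hq0
    have e2 : 23 * ((H : ℝ) ^ 2 * u) * q ≤ 23 * ((H : ℝ) ^ 2 * u) * (2 * u) :=
      mul_le_mul_of_nonneg_left hc2.2 (by positivity)
    have e3 : σ * q ≤ σ * (3 / 2 * q') := mul_le_mul_of_nonneg_left hqq hσ0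
    nlinarith
  have hHu : (H : ℝ) * u ^ 2 ≤ (H : ℝ) ^ 2 * u ^ 2 := by gcongr; nlinarith
  have h7 : 14 * (H : ℝ) * (ι / count D h s a) ≤ 28 * ((H : ℝ) ^ 2 * u ^ 2) := by
    have : 14 * (H : ℝ) * (ι / count D h s a) ≤ 14 * H * (2 * u ^ 2) := by
      gcongr; exact hc2.1
    linarith
  have h8 : 18 * (H : ℝ) * (ι / (n * M.occ μ h s a)) ≤ 18 * ((H : ℝ) ^ 2 * u ^ 2) := by
    have e : ι / (n * M.occ μ h s a) ≤ u ^ 2 := by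
      rw [div_le_iff₀ hN]
      linarith [hs.L_le h s a hocc, hs.ι_le]
    have : 18 * (H : ℝ) * (ι / (n * M.occ μ h s a)) ≤ 18 * H * u ^ 2 := by gcongr
    linarith
  have hσq : 0 ≤ σ * q' := mul_nonneg hσ0 (Real.sqrt_nonneg _)
  have hHu0 : 0 ≤ (H : ℝ) ^ 2 * u ^ 2 := by positivity
  unfold pessQ
  refine le_trans (le_min ?_ ?_) (le_max_left _ _)
  · rw [hbonus]; linarith
  · linarith

theorem MDP.sum_stateOcc (M : MDP S A H) (π : Policy S A H) :
    ∀ h ≤ H, ∑ s, M.stateOcc π h s = 1 := by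
  intro h hh
  induction h with
  | zero => exact simplex_sum M.init
  | succ h ih =>
    have e : ∀ z, M.stateOcc π (h + 1) z =
        ∑ x, ∑ y, M.occ π ⟨h, hh⟩ x y * M.trans ⟨h, hh⟩ x y z := M.stateOcc_succ π ⟨h, hh⟩
    simp only [e]
    rw [Finset.sum_comm, ← ih (by omega)]
    refine Finset.sum_congr rfl fun x _ => ?_
    rw [Finset.sum_comm]
    simp only [← Finset.mul_sum, simplex_sum, mul_one]
    exact M.sum_occ π ⟨h, hh⟩ x

/-- The regret bound on the good event. -/
theorem MDP.GoodData.regret_le {δ : ℝ}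
    (hG : M.GoodData μ C (logTerm S A H δ) L (12 * (H : ℝ) ^ 2 * u) D)
    (hs : M.LargeSample μ n C (logTerm S A H δ) L u) {πstar π : Policy S A H}
    (hopt : M.IsOptimal πstar) (hcov : ∀ h s a, 0 < M.occ πstar h s a → 0 < M.occ μ h s a)
    (hπ : IsAPVIOutput C δ D π) :
    M.optPerf - M.perf π ≤ 8 * M.intrinsicBound μ πstar n (logTerm S A H δ) +
      1000 * ((H : ℝ) ^ 3 * u ^ 2) := by
  set ι := logTerm S A H δ with hι
  set c := (H : ℝ) ^ 2 * u ^ 2 with hc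
  have hc0 : 0 ≤ c := by positivity
  -- pessimism
  have hpess : ∀ h ≤ H, ∀ s, pessValue C ι D h s ≤
      M.value π h s + ((H : ℝ) - (h : ℕ)) * (348 * c) := by
    refine backward_induction (fun s => by rw [pessValue_end, M.value_end]; simp) fun h ih s => ?_
    have hV : pessValue C ι D h s = ∑ a, π h s a *
        pessQ C ι D h (pessValue C ι D (h + 1)) s a := by
      rw [← hπ.pessV_eq h h.2.le, ← hπ.pessV_eq (h + 1) h.2, pessV, dif_pos h.2]
    have hstep : ∀ a, pessQ C ι D h (pessValue C ι D (h + 1)) s a ≤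
        M.backup h (M.value π (h + 1)) s a + ((H : ℝ) - (h : ℕ)) * (348 * c) := by
      intro a
      have h1 := hG.pessQ_le hs h s a
      have h2 := M.backup_mono h ih s a
      rw [M.backup_add_const] at h2
      push_cast at h2
      linarith
    rw [hV, M.value_step]
    calc _ ≤ ∑ a, π h s a * (M.backup h (M.value π (h + 1)) s a +
          ((H : ℝ) - (h : ℕ)) * (348 * c)) :=
          Finset.sum_le_sum fun a _ => mul_le_mul_of_nonneg_left (hstep a) (simplex_nonneg _ a)
      _ = _ := by
          simp only [mul_add, Finset.sum_add_distrib, ← Finset.sum_mul, simplex_sum, one_mul]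
  have hperf : ∑ s, M.init s * pessValue C ι D 0 s ≤ M.perf π + H * (348 * c) := by
    calc _ ≤ ∑ s, M.init s * (M.value π 0 s + H * (348 * c)) :=
          Finset.sum_le_sum fun s _ => mul_le_mul_of_nonneg_left
            (by simpa using hpess 0 (Nat.zero_le _) s) (simplex_nonneg _ s)
      _ = _ := by
          simp only [mul_add, Finset.sum_add_distrib, ← Finset.sum_mul, simplex_sum, one_mul]
          rfl
  -- the covered optimal policy
  have hdiff := M.perf_sub πstar (pessValue C ι D) (pessValue_end C ι D)
  -- Pairs that the optimal policy does not visit contribute nothing. The visited ones are covered,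
  -- and there the variance of the covered value equals that of the optimal value.
  have hterm : ∀ h s a, M.occ πstar h s a *
      (M.backup h (pessValue C ι D (h + 1)) s a - pessValue C ι D h s) ≤
      (if 0 < M.occ μ h s a then M.occ πstar h s a * (8 * √(M.bellmanVar h
        (M.optValue (h + 1)) s a * ι / (n * M.occ μ h s a))) else 0) +
        M.occ πstar h s a * (378 * c) := by
    intro h s a
    by_cases ho : 0 < M.occ πstar h s a
    · rw [if_pos (hcov h s a ho), ← mul_add]
      refine mul_le_mul_of_nonneg_left ?_ ho.le
      have h1 := hG.le_pessQ hs (hcov h s a ho)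
      rw [hopt.bellmanVar_coveredValue_eq hcov ho] at h1
      have h2 := pessQ_le_pessValue C ι D h s a
      linarith
    · have h0 : M.occ πstar h s a = 0 := le_antisymm (not_lt.1 ho) (M.occ_nonneg πstar h s a)
      rw [h0]
      simp
  have hsum : ∑ h : Fin H, ∑ s, ∑ a, M.occ πstar h s a *
      (M.backup h (pessValue C ι D (h + 1)) s a - pessValue C ι D h s) ≤
      8 * M.intrinsicBound μ πstar n ι + H * (378 * c) := by
    calc _ ≤ ∑ h : Fin H, ∑ s, ∑ a, ((if 0 < M.occ μ h s a then M.occ πstar h s a *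
          (8 * √(M.bellmanVar h (M.optValue (h + 1)) s a * ι / (n * M.occ μ h s a))) else 0) +
          M.occ πstar h s a * (378 * c)) :=
          Finset.sum_le_sum fun h _ => Finset.sum_le_sum fun s _ => Finset.sum_le_sum fun a _ =>
            hterm h s a
      _ = _ := by
          simp only [Finset.sum_add_distrib]
          congr 1
          · unfold MDP.intrinsicBound
            rw [Finset.mul_sum]
            refine Finset.sum_congr rfl fun h _ => ?_
            rw [Finset.sum_filter, Fintype.sum_prod_type, Finset.mul_sum]
            refine Finset.sum_congr rfl fun s _ => ?_
            rw [Finset.mul_sum]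
            refine Finset.sum_congr rfl fun a _ => ?_
            split_ifs
            · ring
            · simp
          · have e : ∀ h : Fin H, ∑ s, ∑ a, M.occ πstar h s a * (378 * c) = 378 * c := by
              intro h
              simp only [← Finset.sum_mul, M.sum_occ]
              rw [M.sum_stateOcc πstar h h.2.le, one_mul]
            simp only [e, Finset.sum_const, Finset.card_univ, Fintype.card_fin, nsmul_eq_mul]
  rw [hopt.perf_eq] at hdiff
  have hfin : (H : ℝ) ^ 3 * u ^ 2 = H * c := by rw [hc]; ring
  have : 0 ≤ H * c := mul_nonneg (Nat.cast_nonneg H) hc0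
  rw [hfin]
  -- The regret is the loss of the optimal policy against V̂ plus the excess of V̂ over the output
  -- policy: `378 + 348 ≤ 1000`.
  linarith

end Pessimism

/-! ### Calibration of the failure probabilities -/

section Calibration

theorem MDP.minOcc_le_one {S A : Type*} [Fintype S] [Fintype A] {H : ℕ} (M : MDP S A H)
    (μ : Policy S A H) (hH : 1 ≤ H) : M.minOcc μ ≤ 1 := by
  have h1 : ∑ s, M.stateOcc μ 0 s = 1 := simplex_sum M.init
  have h2 : ∑ s, ∑ a, M.occ μ ⟨0, hH⟩ s a = 1 := by
    simpa only [M.sum_occ] using h1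
  obtain ⟨s, -, hs⟩ : ∃ s ∈ Finset.univ, 0 < ∑ a, M.occ μ ⟨0, hH⟩ s a := by
    by_contra! hcon
    linarith [Finset.sum_nonpos hcon]
  obtain ⟨a, -, ha⟩ : ∃ a ∈ Finset.univ, 0 < M.occ μ ⟨0, hH⟩ s a := by
    by_contra! hcon
    linarith [Finset.sum_nonpos hcon]
  calc M.minOcc μ ≤ M.occ μ ⟨0, hH⟩ s a := M.minOcc_le μ ha
    _ ≤ ∑ a, M.occ μ ⟨0, hH⟩ s a :=
        Finset.single_le_sum (fun a _ => M.occ_nonneg μ _ s a) (Finset.mem_univ a)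
    _ ≤ ∑ s, ∑ a, M.occ μ ⟨0, hH⟩ s a :=
        Finset.single_le_sum (f := fun s => ∑ a, M.occ μ ⟨0, hH⟩ s a)
          (fun s _ => Finset.sum_nonneg fun a _ => M.occ_nonneg μ _ s a) (Finset.mem_univ s)
    _ = 1 := h2

theorem MDP.intrinsicBound_nonneg {S A : Type*} [Fintype S] [Fintype A] [Nonempty A] {H : ℕ}
    (M : MDP S A H) (μ π : Policy S A H) (n : ℕ) (ι : ℝ) : 0 ≤ M.intrinsicBound μ π n ι :=
  Finset.sum_nonneg fun _ _ => Finset.sum_nonneg fun _ _ =>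
    mul_nonneg (M.occ_nonneg _ _ _ _) (Real.sqrt_nonneg _)

/-- The failure probabilities of the deviation bounds add up to at most `δ`, where `m` stands for
`H S A`. -/
theorem mul_exp_add_exp_le {m n δ : ℝ} (hm : 2 ≤ m) (hn : 48 ≤ n) (hδ : 0 < δ) (hδ1 : δ < 1) :
    m * (Real.exp (-(2 * Real.log (m / δ))) + Real.exp (-(3 * Real.log (m / δ))) +
      12 * Real.exp (-Real.log (n * m / δ))) ≤ δ := by
  have hm0 : 0 < m := by linarith
  have hn0 : 0 < n := by linarith
  have e1 : Real.exp (-Real.log (m / δ)) = δ / m := by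
    rw [Real.exp_neg, Real.exp_log (by positivity), inv_div]
  have e2 : Real.exp (-Real.log (n * m / δ)) = δ / (n * m) := by
    rw [Real.exp_neg, Real.exp_log (by positivity), inv_div]
  have e3 : Real.exp (-(2 * Real.log (m / δ))) = (δ / m) ^ 2 := by
    rw [← e1, ← Real.exp_nat_mul]; congr 1; push_cast; ring
  have e4 : Real.exp (-(3 * Real.log (m / δ))) = (δ / m) ^ 3 := by
    rw [← e1, ← Real.exp_nat_mul]; congr 1; push_cast; ring
  rw [e2, e3, e4]
  have hr : δ / m ≤ 1 / 2 := by rw [div_le_div_iff₀ hm0 two_pos]; linarith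
  have hr0 : 0 < δ / m := by positivity
  have hk : 12 / n ≤ 1 / 4 := by rw [div_le_div_iff₀ hn0 four_pos]; linarith
  have : m * ((δ / m) ^ 2 + (δ / m) ^ 3 + 12 * (δ / (n * m))) =
      δ * (δ / m + (δ / m) ^ 2 + 12 / n) := by
    field_simp
  rw [this]
  -- The three contributions are at most 1/2, 1/4 and 1/4; the first is where `m ≥ 2` is essential.
  refine mul_le_of_le_one_right hδ.le ?_
  nlinarith

end Calibration

end OfflineRL

end

/-! ### Choice of parameters and conclusion -/

theorem mainTheorem1 :
    ∃ c₀ C' C'' : ℝ, ∃ k : ℕ, 0 < c₀ ∧ 0 < C' ∧ 0 < C'' ∧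
      ∀ (S A : Type*) [Fintype S] [Fintype A] [DecidableEq S] [DecidableEq A]
        [Nonempty S] [Nonempty A] [MeasurableSpace S] [MeasurableSpace A]
        [MeasurableSingletonClass S] [MeasurableSingletonClass A]
        (H : ℕ) (M : OfflineRL.MDP S A H) (μ πstar : OfflineRL.Policy S A H)
        (n : ℕ) (δ C : ℝ),
        1 ≤ H → 0 < δ → δ < 1 → 2 ≤ C →
        M.IsOptimal πstar →
        (∀ h s a, 0 < M.occ πstar h s a → 0 < M.occ μ h s a) →
        c₀ * (1 / M.minOcc μ) * OfflineRL.logTerm S A H δ < (n : ℝ) →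
        ∃ E : Set (Fin n → OfflineRL.Episode S A H),
          MeasurableSet E ∧ ENNReal.ofReal (1 - δ) ≤ M.dataLaw μ n E ∧
          ∀ D ∈ E, ∀ πhat : OfflineRL.Policy S A H, OfflineRL.IsAPVIOutput C δ D πhat →
            0 ≤ M.optPerf - M.perf πhat ∧
            M.optPerf - M.perf πhat ≤
              C' * M.intrinsicBound μ πstar n (OfflineRL.logTerm S A H δ) +
              C'' * (H : ℝ) ^ 3 *
                  Real.log ((n : ℝ) * H * Fintype.card S * Fintype.card A / δ) ^ k /
                (n * M.minOcc μ) := by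
  -- With `c₀ = 1` the sample size condition yields `n > 0`; any larger threshold is absorbed into
  -- the trivial case below. The 8 comes from `regret_le`, and 10000 makes that trivial case work.
  refine ⟨1, 8, 10000, 1, one_pos, by norm_num, by norm_num, ?_⟩
  intro S A _ _ _ _ _ _ _ _ _ _ H M μ πstar n δ C hH hδ hδ1 hC hopt hcov hn
  set ι := OfflineRL.logTerm S A H δ with hι
  set d := M.minOcc μ with hd
  set m : ℝ := (H : ℝ) * Fintype.card S * Fintype.card A with hm
  set L := Real.log ((n : ℝ) * H * Fintype.card S * Fintype.card A / δ) with hL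
  have hLm : L = Real.log (n * m / δ) := by rw [hL, hm]; congr 2; ring
  have hιm : ι = Real.log (m / δ) := rfl
  have hH1 : (1 : ℝ) ≤ H := by exact_mod_cast hH
  have hS1 : (1 : ℝ) ≤ Fintype.card S := by exact_mod_cast Fintype.card_pos (α := S)
  have hA1 : (1 : ℝ) ≤ Fintype.card A := by exact_mod_cast Fintype.card_pos (α := A)
  have hHS : (1 : ℝ) ≤ (H : ℝ) * Fintype.card S := by nlinarith
  have hm1 : 1 ≤ m := by nlinarith
  have hmδ : 1 ≤ m / δ := by rw [le_div_iff₀ hδ]; linarith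
  have hd0 : 0 < d := M.minOcc_pos μ hH
  have hι0 : 0 ≤ ι := by rw [hιm]; exact Real.log_nonneg hmδ
  have hn0 : (0 : ℝ) < n := lt_of_le_of_lt (by positivity) hn
  have hn1 : (1 : ℝ) ≤ n := by
    have : 0 < n := by exact_mod_cast hn0
    exact_mod_cast this
  have hιL : ι ≤ L := by
    rw [hLm, hιm]
    refine Real.log_le_log (by positivity) ?_
    gcongr
    nlinarith
  have hL0 : 0 ≤ L := hι0.trans hιL
  have hI := M.intrinsicBound_nonneg μ πstar n ι
  have hK : 0 < n * d := mul_pos hn0 hd0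
  have hR : 0 ≤ 10000 * (H : ℝ) ^ 3 * L ^ 1 / (n * d) := by positivity
  have hpos : ∀ π, 0 ≤ M.optPerf - M.perf π := fun π => sub_nonneg.2 (M.perf_le_optPerf π)
  have huniv : ENNReal.ofReal (1 - δ) ≤ M.dataLaw μ n Set.univ := by
    rw [measure_univ]
    exact ENNReal.ofReal_le_one.2 (by linarith)
  -- With one action `HSA` may be 1, too small for the probability budget and for `ι ≥ 1/2`. But
  -- then there is only one policy and the regret is zero.
  rcases subsingleton_or_nontrivial A with hA | hA
  · refine ⟨Set.univ, MeasurableSet.univ, huniv, fun D _ π _ => ⟨hpos π, ?_⟩⟩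
    have : π = πstar := by
      funext h s
      ext a
      have h1 := OfflineRL.simplex_sum (π h s)
      have h2 := OfflineRL.simplex_sum (πstar h s)
      rw [Fintype.sum_subsingleton _ a] at h1 h2
      exact h1.trans h2.symm
    rw [this, hopt.perf_eq, sub_self]
    positivity
  -- For small samples the second order term alone exceeds `H`, hence any regret. Otherwise `Hu ≤
  -- 1/100`.
  rcases le_or_gt (n * d) (10000 * (H : ℝ) ^ 2 * L) with hsmall | hlarge
  · refine ⟨Set.univ, MeasurableSet.univ, huniv, fun D _ π _ => ⟨hpos π, ?_⟩⟩
    have h1 : M.optPerf - M.perf π ≤ H := by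
      linarith [M.optPerf_le, M.perf_nonneg π]
    have h2 : (H : ℝ) ≤ 10000 * (H : ℝ) ^ 3 * L ^ 1 / (n * d) := by
      rw [le_div_iff₀ hK]
      nlinarith
    linarith
  have hA2 : (2 : ℝ) ≤ Fintype.card A := by exact_mod_cast Fintype.one_lt_card (α := A)
  have hm2 : 2 ≤ m := by nlinarith
  have hι2 : 1 / 2 ≤ ι := by
    have h1 : Real.log 2 ≤ ι := by
      rw [hιm]
      refine Real.log_le_log two_pos ?_
      rw [le_div_iff₀ hδ]
      linarith
    linarith [Real.log_two_gt_d9]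
  have hL2 : 1 / 2 ≤ L := hι2.trans hιL
  have hH2 : (1 : ℝ) ≤ (H : ℝ) ^ 2 := one_le_pow₀ hH1
  have hn48 : (48 : ℝ) ≤ n := by
    have h1 : n * d ≤ n := mul_le_of_le_one_right hn0.le (M.minOcc_le_one μ hH)
    nlinarith
  set u := √(L / (n * d)) with hu
  have hLK : 0 < L / (n * d) := by positivity
  have hu0 : 0 < u := Real.sqrt_pos.2 hLK
  have hu2 : u ^ 2 = L / (n * d) := Real.sq_sqrt hLK.le
  have hLn : ∀ h s a, 0 < M.occ μ h s a → L ≤ n * M.occ μ h s a * u ^ 2 := by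
    intro h s a hocc
    rw [hu2, ← mul_div_assoc, le_div_iff₀ hK, mul_comm L]
    gcongr
    exact M.minOcc_le μ hocc
  have hHu : (H : ℝ) * u ≤ 1 / 100 := by
    refine abs_le_of_sq_le_sq' ?_ (by norm_num) |>.2
    rw [mul_pow, hu2, ← mul_div_assoc, div_le_iff₀ hK]
    linarith
  have hs : M.LargeSample μ n C ι L u := ⟨hu0, hHu, hH, hC, hι2, hιL, hLn⟩
  -- The clipping level is the bound of `abs_gap_le`, a deterministic quantity, so it can be fixed
  -- before the data are drawn.
  have hprob : M.dataLaw μ n {D | ¬M.GoodData μ C ι L (12 * (H : ℝ) ^ 2 * u) D} ≤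
      ENNReal.ofReal δ := by
    refine (M.measure_not_goodData_le μ C _ hι0 (by linarith) fun h s a hocc => ?_).trans
      (ENNReal.ofReal_le_ofReal ?_)
    · refine (hLn h s a hocc).trans (mul_le_of_le_one_right ?_ ?_)
      · positivity
      · nlinarith
    · rw [hLm, hιm]
      exact OfflineRL.mul_exp_add_exp_le hm2 hn48 hδ hδ1
  -- Passing to a measurable hull of the bad set avoids having to prove that set measurable.
  set B := toMeasurable (M.dataLaw μ n)
    {D | ¬M.GoodData μ C ι L (12 * (H : ℝ) ^ 2 * u) D} with hB
  refine ⟨Bᶜ, (measurableSet_toMeasurable _ _).compl, ?_, fun D hD π hπ => ⟨hpos π, ?_⟩⟩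
  · rw [prob_compl_eq_one_sub (measurableSet_toMeasurable _ _), measure_toMeasurable,
      ENNReal.ofReal_sub _ hδ.le, ENNReal.ofReal_one]
    exact tsub_le_tsub_left hprob _
  · have hG : M.GoodData μ C ι L (12 * (H : ℝ) ^ 2 * u) D := by
      by_contra hcon
      exact hD (subset_toMeasurable _ _ hcon)
    refine (hG.regret_le hs hopt hcov hπ).trans (add_le_add le_rfl ?_)
    rw [hu2, pow_one, ← mul_div_assoc, ← mul_div_assoc]
    refine div_le_div_of_nonneg_right ?_ hK.le
    have h3 : 0 ≤ (H : ℝ) ^ 3 * L := by positivity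
    linarith
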